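/- **Lemma 3.1.** Let $X$ be a compact complex manifold of dimension $n$ with a Kähler metric $h$ (a Hermitian metric on the holomorphic tangent bundle $TX$, complex linear in the first variable, with closed fundamental form), and let $\Omega\in\Gamma(X,\Lambda^nT^*X)$ be a nowhere vanishing holomorphic $n$-form that is parallel for the Levi-Civita connection of $\operatorname{Re} h$. Let contraction of polyvectors with forms be the action of $\Lambda^\bullet TX$ on $\Lambda^\bullet T^*X$ in which vectors act by interior product, so $(v\wedge w)\lrcorner\alpha=v\lrcorner(w\lrcorner\alpha)$, extended to $\gamma\mapsto\gamma\lrcorner\Omega$ from $\Lambda^pTX\otimes\Lambda^q\bar T^*X$ to $\Lambda^{n-p}T^*X\otimes\Lambda^q\bar T^*X$. Let $$f_{p,q}:\Lambda^pTX\otimes\Lambda^q\bar T^*X\to\Lambda^p\bar T^*X\otimes\Lambda^qTX$$ be the isomorphism induced by $TX\cong\bar T^*X$, $v\mapsto h(v,\cdot)$, and its inverse. Let $$\bar\partial^*:\Gamma(X,\Lambda^{p}\bar T^*X\otimes\Lambda^qTX)\to\Gamma(X,\Lambda^{p-1}\bar T^*X\otimes\Lambda^qTX)$$ be the formal adjoint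 of the Dolbeault operator $\bar\partial$ on $\Lambda^qTX$-valued $(0,\bullet)$-forms, for the $L^2$ inner product given by the metrics induced by $h$ and the Riemannian volume. All sections are $C^\infty$. Then for all $p\ge1$, $q\ge 0$ and every $\gamma\in\Gamma(X,\Lambda^pTX\otimes\Lambda^q\bar T^*X)$ there is a unique section $\Delta\gamma$ of $\Lambda^{p-1}TX\otimes\Lambda^q\bar T^*X$ with $$(\Delta\gamma)\lrcorner\Omega=\partial(\gamma\lrcorner\Omega);$$ it is smooth, $f_{p,q}\gamma$ is smooth, $\bar\partial^*(f_{p,q}\gamma)$ exists and is unique, and $$f_{p-1,q}(\Delta\gamma)=-\bar\partial^*(f_{p,q}\gamma).$$ For $p=0$ one has $\partial(\gamma\lrcorner\Omega)=0$, so that both operators are zero. -/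

import Mathlib

open Set
open scoped Manifold ContDiff TensorProduct ComplexConjugate

noncomputable section

namespace BK

/-! ### Multilinear algebra of a complex vector space `V` (the role of `V` is a holomorphic
tangent space `T_x X`). -/

section LinearAlgebra

variable {V W : Type*} [AddCommGroup V] [Module ℂ V] [AddCommGroup W] [Module ℂ W]

/-- The space of conjugate-linear functionals on `V`; for `V = T_x X` this is the fibre of
`T̄^*X`. -/
abbrev CDual (V : Type*) [AddCommGroup V] [Module ℂ V] : Type _ := V →ₗ⋆[ℂ] ℂ

/-- The real-linear identification `V^* ≃ V̄^*`, `l ↦ conj ∘ l`. -/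
def conjDualEquiv (V : Type*) [AddCommGroup V] [Module ℂ V] :
    Module.Dual ℂ V ≃ₗ[ℝ] CDual V where
  toFun l :=
    { toFun := fun v => conj (l v)
      map_add' := fun u v => by simp
      map_smul' := fun c v => by simp }
  invFun l :=
    { toFun := fun v => conj (l v)
      map_add' := fun u v => by simp
      map_smul' := fun c v => by simp }
  left_inv l := by ext v; simp
  right_inv l := by ext v; simp
  map_add' l m := by ext v; simp
  map_smul' c l := by ext v; simp

/-- `conjDualEquiv`, as a complex conjugate-linear map. -/
def conjDualMap (V : Type*) [AddCommGroup V] [Module ℂ V] :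
    Module.Dual ℂ V →ₗ⋆[ℂ] CDual V where
  toFun l := conjDualEquiv V l
  map_add' l m := map_add (conjDualEquiv V) l m
  map_smul' c l := by ext v; simp [conjDualEquiv]

instance instFiniteCDual [Module.Finite ℂ V] : Module.Finite ℂ (CDual V) :=
  Module.Finite.of_surjective (conjDualMap V) (conjDualEquiv V).surjective

instance instFiniteExteriorAlgebra [Module.Finite ℂ V] :
    Module.Finite ℂ (ExteriorAlgebra ℂ V) :=
  Module.Finite.of_basis (Module.Basis.ExteriorAlgebra (Module.finBasis ℂ V))

/-- Pullback of conjugate-linear functionals. -/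
def cpull (A : V →ₗ[ℂ] W) : CDual W →ₗ[ℂ] CDual V where
  toFun l := l.comp A
  map_add' l m := by ext v; simp
  map_smul' c l := by ext v; simp

/-- `Λ^p V ⊗ Λ^q V̄^*`. -/
abbrev PV (p q : ℕ) (V : Type*) [AddCommGroup V] [Module ℂ V] : Type _ :=
  ⋀[ℂ]^p V ⊗[ℂ] ⋀[ℂ]^q (CDual V)

/-- `Λ^p V̄^* ⊗ Λ^q V`. -/
abbrev DF (p q : ℕ) (V : Type*) [AddCommGroup V] [Module ℂ V] : Type _ :=
  ⋀[ℂ]^p (CDual V) ⊗[ℂ] ⋀[ℂ]^q V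

/-- `Λ^• V^* ⊗ Λ^q V̄^*`, the forms of type `(r, q)`, all `r` together. -/
abbrev MF (q : ℕ) (V : Type*) [AddCommGroup V] [Module ℂ V] : Type _ :=
  ExteriorAlgebra ℂ (Module.Dual ℂ V) ⊗[ℂ] ⋀[ℂ]^q (CDual V)

/-- Functoriality of `PV`: `A` moves vectors, its inverse `B` moves covectors. -/
def PV.transport (p q : ℕ) (A : V →ₗ[ℂ] W) (B : W →ₗ[ℂ] V) : PV p q V →ₗ[ℂ] PV p q W :=
  TensorProduct.map (exteriorPower.map p A) (exteriorPower.map q (cpull B))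

/-- Functoriality of `DF`: `A` moves vectors, its inverse `B` moves covectors. -/
def DF.transport (p q : ℕ) (A : V →ₗ[ℂ] W) (B : W →ₗ[ℂ] V) : DF p q V →ₗ[ℂ] DF p q W :=
  TensorProduct.map (exteriorPower.map p (cpull B)) (exteriorPower.map q A)

/-- Functoriality of `MF`: covectors are moved by the inverse `B`. -/
def MF.transport (q : ℕ) (B : W →ₗ[ℂ] V) : MF q V →ₗ[ℂ] MF q W :=
  TensorProduct.map (ExteriorAlgebra.map B.dualMap).toLinearMap (exteriorPower.map q (cpull B))

/-- Left multiplication `v ∧ · : Λ^p V → Λ^{p+1} V` by a vector. -/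
def wedgeLeft (p : ℕ) (v : V) : ⋀[ℂ]^p V →ₗ[ℂ] ⋀[ℂ]^(p + 1) V :=
  exteriorPower.alternatingMapLinearEquiv ((exteriorPower.ιMulti ℂ (p + 1)).curryLeft v)

/-- Contraction of forms with polyvectors: the action of `Λ^• V` on `Λ^• V^*` in which a vector
acts by the interior product `v ⌟ ·` and `(v ∧ w) ⌟ α = v ⌟ (w ⌟ α)`. -/
def contract : ExteriorAlgebra ℂ V →ₐ[ℂ] Module.End ℂ (ExteriorAlgebra ℂ (Module.Dual ℂ V)) :=
  ExteriorAlgebra.lift ℂ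
    ⟨CliffordAlgebra.contractLeft ∘ₗ Module.Dual.eval ℂ V, fun v =>
      LinearMap.ext fun α => CliffordAlgebra.contractLeft_contractLeft (Module.Dual.eval ℂ V v) α⟩

/-- `γ ↦ γ ⌟ Ω`, the map `Λ^p V ⊗ Λ^q V̄^* → Λ^• V^* ⊗ Λ^q V̄^*` that contracts the
`p`-vector with the `n`-covector `Ω`. -/
def contractForm (p q : ℕ) {n : ℕ} (Ω : ⋀[ℂ]^n (Module.Dual ℂ V)) : PV p q V →ₗ[ℂ] MF q V :=
  TensorProduct.map
    ((contract (V := V)).toLinearMap.flip (Ω : ExteriorAlgebra ℂ (Module.Dual ℂ V)) ∘ₗ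
      (⋀[ℂ]^p V).subtype)
    LinearMap.id

/-! #### Induced sesquilinear forms -/

/-- For fixed `w₁, …, w_p`, the linear functional `v₁ ∧ ⋯ ∧ v_p ↦ det (B(vᵢ, wⱼ))`. -/
def gramAux (p : ℕ) (B : V →ₗ[ℂ] V →ₗ⋆[ℂ] ℂ) (w : Fin p → V) : ⋀[ℂ]^p V →ₗ[ℂ] ℂ :=
  exteriorPower.alternatingMapLinearEquiv
    (Matrix.detRowAlternating.compLinearMap (LinearMap.pi fun j => B.flip (w j)))

theorem gramAux_ιMulti (p : ℕ) (B : V →ₗ[ℂ] V →ₗ⋆[ℂ] ℂ) (w v : Fin p → V) :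
    gramAux p B w (exteriorPower.ιMulti ℂ p v) =
      (Matrix.of fun i j => B (v i) (w j)).det := by
  simp only [gramAux, exteriorPower.alternatingMapLinearEquiv_apply_ιMulti]
  rfl

/-- For fixed `a ∈ Λ^p V`, the alternating map `(w₁, …, w_p) ↦ conj ⟨a, w₁ ∧ ⋯ ∧ w_p⟩`. -/
def gramAlt (p : ℕ) (B : V →ₗ[ℂ] V →ₗ⋆[ℂ] ℂ) (a : ⋀[ℂ]^p V) : V [⋀^Fin p]→ₗ[ℂ] ℂ where
  toFun w := conj (gramAux p B w a)
  map_update_add' {inst} w i x y := by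
    obtain rfl : inst = instDecidableEqFin p := Subsingleton.elim _ _
    have key : gramAux p B (Function.update w i (x + y)) =
        gramAux p B (Function.update w i x) + gramAux p B (Function.update w i y) := by
      apply exteriorPower.linearMap_ext
      ext v
      simp only [LinearMap.compAlternatingMap_apply, LinearMap.add_apply, gramAux_ιMulti]
      have e : ∀ z, (Matrix.of fun k j => B (v k) (Function.update w i z j)) =
          Matrix.updateCol (Matrix.of fun k j => B (v k) (w j)) i (fun k => B (v k) z) := by
        intro z
        ext k j
        by_cases hj : j = i
        · subst hj; simp
        · simp [hj]
      rw [e, e, e, ← Matrix.det_updateCol_add]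
      congr 2
      ext k
      simp
    rw [key]
    simp
  map_update_smul' {inst} w i c x := by
    obtain rfl : inst = instDecidableEqFin p := Subsingleton.elim _ _
    have key : gramAux p B (Function.update w i (c • x)) =
        conj c • gramAux p B (Function.update w i x) := by
      apply exteriorPower.linearMap_ext
      ext v
      simp only [LinearMap.compAlternatingMap_apply, LinearMap.smul_apply, gramAux_ιMulti]
      have e : ∀ z, (Matrix.of fun k j => B (v k) (Function.update w i z j)) =
          Matrix.updateCol (Matrix.of fun k j => B (v k) (w j)) i (fun k => B (v k) z) := by
        intro z
        ext k j
        by_cases hj : j = i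
        · subst hj; simp
        · simp [hj]
      rw [e, e, smul_eq_mul, ← Matrix.det_updateCol_smul]
      congr 2
      ext k
      simp
    rw [key]
    simp
  map_eq_zero_of_eq' w i j hw hij := by
    have key : gramAux p B w = 0 := by
      apply exteriorPower.linearMap_ext
      ext v
      simp only [LinearMap.compAlternatingMap_apply, LinearMap.zero_apply, gramAux_ιMulti]
      exact Matrix.det_zero_of_column_eq hij (fun k => by simp [hw])
    simp [key]

/-- The sesquilinear form on `Λ^p V` induced by a sesquilinear form `B` on `V`:
`⟨v₁ ∧ ⋯ ∧ v_p, w₁ ∧ ⋯ ∧ w_p⟩ = det (B(vᵢ, wⱼ))`. -/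
def extForm (p : ℕ) (B : V →ₗ[ℂ] V →ₗ⋆[ℂ] ℂ) : ⋀[ℂ]^p V →ₗ[ℂ] ⋀[ℂ]^p V →ₗ⋆[ℂ] ℂ :=
  LinearMap.mk₂'ₛₗ (RingHom.id ℂ) (starRingEnd ℂ)
    (fun a c => conj (exteriorPower.alternatingMapLinearEquiv (gramAlt p B a) c))
    (fun a b c => by
      have : gramAlt p B (a + b) = gramAlt p B a + gramAlt p B b := by
        ext w; simp [gramAlt]
      simp [this])
    (fun r a c => by
      have : gramAlt p B (r • a) = conj r • gramAlt p B a := by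
        ext w; simp [gramAlt]
      simp [this])
    (fun a b c => by simp)
    (fun r a c => by simp)

theorem extForm_ιMulti (p : ℕ) (B : V →ₗ[ℂ] V →ₗ⋆[ℂ] ℂ) (v w : Fin p → V) :
    extForm p B (exteriorPower.ιMulti ℂ p v) (exteriorPower.ιMulti ℂ p w) =
      (Matrix.of fun i j => B (v i) (w j)).det := by
  simp only [extForm, LinearMap.mk₂'ₛₗ_apply,
    exteriorPower.alternatingMapLinearEquiv_apply_ιMulti]
  rw [← gramAux_ιMulti]
  exact Complex.conj_conj _

/-- The sesquilinear form on `V ⊗ W` with `⟨v ⊗ w, v' ⊗ w'⟩ = B(v, v') C(w, w')`. -/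
def tensorForm (B : V →ₗ[ℂ] V →ₗ⋆[ℂ] ℂ) (C : W →ₗ[ℂ] W →ₗ⋆[ℂ] ℂ) :
    V ⊗[ℂ] W →ₗ[ℂ] V ⊗[ℂ] W →ₗ⋆[ℂ] ℂ :=
  (TensorProduct.map₂ B C).compr₂ₛₗ (LinearMap.mul' ℂ ℂ)

theorem tensorForm_tmul (B : V →ₗ[ℂ] V →ₗ⋆[ℂ] ℂ) (C : W →ₗ[ℂ] W →ₗ⋆[ℂ] ℂ) (v v' : V)
    (w w' : W) : tensorForm B C (v ⊗ₜ w) (v' ⊗ₜ w') = B v v' * C w w' := by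
  simp [tensorForm]

/-- A positive definite sesquilinear form `B` is an isomorphism `V ≃ V̄^*`, `v ↦ B(v, ·)`. -/
theorem bijective_of_pos [Module.Finite ℂ V] (B : V →ₗ[ℂ] CDual V)
    (hB : ∀ v, v ≠ 0 → 0 < (B v v).re) : Function.Bijective B := by
  have hinj : Function.Injective B := by
    rw [← LinearMap.ker_eq_bot, LinearMap.ker_eq_bot']
    intro v hv
    by_contra hne
    have := hB v hne
    simp [hv] at this
  have : Module.Finite ℝ V := Module.Finite.trans ℂ V
  have : Module.Finite ℝ (Module.Dual ℂ V) := Module.Finite.trans ℂ _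
  have e1 : Module.finrank ℝ (Module.Dual ℂ V) = Module.finrank ℝ (CDual V) :=
    (conjDualEquiv V).finrank_eq
  have e2 : Module.finrank ℝ V = Module.finrank ℝ (Module.Dual ℂ V) := by
    rw [← Module.finrank_mul_finrank ℝ ℂ V, ← Module.finrank_mul_finrank ℝ ℂ (Module.Dual ℂ V),
      Subspace.dual_finrank_eq]
  have : Module.Finite ℝ (CDual V) := Module.Finite.trans ℂ _
  exact ⟨hinj, (LinearMap.injective_iff_surjective_of_finrank_eq_finrank
    (f := B.restrictScalars ℝ) (e2.trans e1)).1 hinj⟩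

/-- An isomorphism induces an isomorphism of exterior powers. -/
def extEquiv (p : ℕ) (e : V ≃ₗ[ℂ] W) : ⋀[ℂ]^p V ≃ₗ[ℂ] ⋀[ℂ]^p W :=
  LinearEquiv.ofLinearMap (exteriorPower.map p e.toLinearMap)
    (exteriorPower.map p e.symm.toLinearMap)
    (by rw [← exteriorPower.map_comp]; simp)
    (by rw [← exteriorPower.map_comp]; simp)

end LinearAlgebra

/-! ### Calculus on `ℂ^n` for functions with values in finite-dimensional spaces -/

section Calculus

variable {n : ℕ} {F : Type*} [AddCommGroup F] [Module ℂ F]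

/-- A function with values in a finite-dimensional complex space is (real) smooth on `U` if all
its scalar components are. -/
def SmoothOn (g : (Fin n → ℂ) → F) (U : Set (Fin n → ℂ)) : Prop :=
  ∀ l : F →ₗ[ℂ] ℂ, ContDiffOn ℝ ∞ (fun y => l (g y)) U

/-- `∂u/∂z_j = (∂_{x_j} u - i ∂_{y_j} u) / 2`. -/
def dz (j : Fin n) (u : (Fin n → ℂ) → ℂ) (y : Fin n → ℂ) : ℂ :=
  (fderiv ℝ u y (Pi.single j 1) - Complex.I * fderiv ℝ u y (Pi.single j Complex.I)) / 2

/-- `∂u/∂z̄_j = (∂_{x_j} u + i ∂_{y_j} u) / 2`. -/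
def dzbar (j : Fin n) (u : (Fin n → ℂ) → ℂ) (y : Fin n → ℂ) : ℂ :=
  (fderiv ℝ u y (Pi.single j 1) + Complex.I * fderiv ℝ u y (Pi.single j Complex.I)) / 2

/-- `∂g/∂z_j` for vector-valued `g`, computed componentwise in a basis of the values. -/
def dzVec [Module.Finite ℂ F] (j : Fin n) (g : (Fin n → ℂ) → F) (y : Fin n → ℂ) : F :=
  ∑ i, dz j (fun y' => (Module.finBasis ℂ F).coord i (g y')) y • Module.finBasis ℂ F i

/-- `∂g/∂z̄_j` for vector-valued `g`, computed componentwise in a basis of the values. -/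
def dzbarVec [Module.Finite ℂ F] (j : Fin n) (g : (Fin n → ℂ) → F) (y : Fin n → ℂ) : F :=
  ∑ i, dzbar j (fun y' => (Module.finBasis ℂ F).coord i (g y')) y • Module.finBasis ℂ F i

/-- The covector `dz_j` of `ℂ^n`. -/
def covec (j : Fin n) : Module.Dual ℂ (Fin n → ℂ) := LinearMap.proj j

/-- The conjugate covector `dz̄_j` of `ℂ^n`. -/
def covecBar (j : Fin n) : CDual (Fin n → ℂ) := conjDualEquiv _ (covec j)

end Calculus

/-! ### Complex manifolds -/

section Manifold

variable {n : ℕ} {X : Type*} [TopologicalSpace X] [ChartedSpace (Fin n → ℂ) X]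

/-- The holomorphic tangent space of `X` at `x`. -/
abbrev TX (n : ℕ) {X : Type*} [TopologicalSpace X] [ChartedSpace (Fin n → ℂ) X] (x : X) : Type :=
  TangentSpace 𝓘(ℂ, Fin n → ℂ) x

instance instFiniteTX (x : X) : Module.Finite ℂ (TX n x) :=
  inferInstanceAs (Module.Finite ℂ (Fin n → ℂ))

/-- The differential `T_x X → ℂ^n` of a chart. -/
def dChart (φ : OpenPartialHomeomorph X (Fin n → ℂ)) (x : X) : TX n x →ₗ[ℂ] (Fin n → ℂ) :=
  (mfderiv 𝓘(ℂ, Fin n → ℂ) 𝓘(ℂ, Fin n → ℂ) φ x).toLinearMap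

/-- The inverse `ℂ^n → T_x X` of the differential of a chart; it maps the standard basis to the
coordinate frame of the chart. -/
def dChartInv (φ : OpenPartialHomeomorph X (Fin n → ℂ)) (x : X) : (Fin n → ℂ) →ₗ[ℂ] TX n x :=
  (mfderiv 𝓘(ℂ, Fin n → ℂ) 𝓘(ℂ, Fin n → ℂ) φ x).inverse.toLinearMap

/-! #### Expressions of tensor fields in a chart, smooth sections -/

/-- A section of `Λ^p TX ⊗ Λ^q T̄^*X` in a chart. -/
def PV.inChart {p q : ℕ} (φ : OpenPartialHomeomorph X (Fin n → ℂ)) (γ : ∀ x : X, PV p q (TX n x))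
    (y : Fin n → ℂ) : PV p q (Fin n → ℂ) :=
  PV.transport p q (dChart φ (φ.symm y)) (dChartInv φ (φ.symm y)) (γ (φ.symm y))

/-- A section of `Λ^p T̄^*X ⊗ Λ^q TX` in a chart. -/
def DF.inChart {p q : ℕ} (φ : OpenPartialHomeomorph X (Fin n → ℂ)) (α : ∀ x : X, DF p q (TX n x))
    (y : Fin n → ℂ) : DF p q (Fin n → ℂ) :=
  DF.transport p q (dChart φ (φ.symm y)) (dChartInv φ (φ.symm y)) (α (φ.symm y))

/-- A section of `Λ^• T^*X ⊗ Λ^q T̄^*X` in a chart. -/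
def MF.inChart {q : ℕ} (φ : OpenPartialHomeomorph X (Fin n → ℂ)) (η : ∀ x : X, MF q (TX n x))
    (y : Fin n → ℂ) : MF q (Fin n → ℂ) :=
  MF.transport q (dChartInv φ (φ.symm y)) (η (φ.symm y))

/-- Smooth sections, `γ ∈ Γ(X, Λ^p TX ⊗ Λ^q T̄^*X)`. -/
def PV.IsSmooth {p q : ℕ} (γ : ∀ x : X, PV p q (TX n x)) : Prop :=
  ∀ φ ∈ atlas (Fin n → ℂ) X, SmoothOn (PV.inChart φ γ) φ.target

/-- Smooth sections, `α ∈ Γ(X, Λ^p T̄^*X ⊗ Λ^q TX)`. -/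
def DF.IsSmooth {p q : ℕ} (α : ∀ x : X, DF p q (TX n x)) : Prop :=
  ∀ φ ∈ atlas (Fin n → ℂ) X, SmoothOn (DF.inChart φ α) φ.target

/-! #### The operators `∂` and `∂̄` -/

/-- `∂ : Γ(Λ^• T^*X ⊗ Λ^q T̄^*X) → Γ(Λ^{•+1} T^*X ⊗ Λ^q T̄^*X)`, in holomorphic coordinates
`∂η = ∑ⱼ dzⱼ ∧ ∂η/∂zⱼ`. -/
def del {q : ℕ} (η : ∀ x : X, MF q (TX n x)) (x : X) : MF q (TX n x) :=
  MF.transport q (dChart (chartAt (Fin n → ℂ) x) x)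
    (∑ j : Fin n,
      TensorProduct.map (LinearMap.mulLeft ℂ (ExteriorAlgebra.ι ℂ (covec j))) LinearMap.id
        (dzVec j (MF.inChart (chartAt (Fin n → ℂ) x) η) (chartAt (Fin n → ℂ) x x)))

/-- `∂̄ : Γ(Λ^p T̄^*X ⊗ Λ^q TX) → Γ(Λ^{p+1} T̄^*X ⊗ Λ^q TX)`, the Dolbeault operator on
`(0, p)`-forms with values in the holomorphic bundle `Λ^q TX`: in the holomorphic frame of
`Λ^q TX` given by coordinates, `∂̄α = ∑ⱼ dz̄ⱼ ∧ ∂α/∂z̄ⱼ`. -/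
def dbar {p q : ℕ} (α : ∀ x : X, DF p q (TX n x)) (x : X) : DF (p + 1) q (TX n x) :=
  DF.transport (p + 1) q (dChartInv (chartAt (Fin n → ℂ) x) x) (dChart (chartAt (Fin n → ℂ) x) x)
    (∑ j : Fin n,
      TensorProduct.map (wedgeLeft p (covecBar j)) LinearMap.id
        (dzbarVec j (DF.inChart (chartAt (Fin n → ℂ) x) α) (chartAt (Fin n → ℂ) x x)))

/-! #### Kähler metrics -/

/-- The coefficient `h(u, v)` of a field of sesquilinear forms in a chart, for `u, v ∈ ℂ^n`. -/
def metricInChart (h : ∀ x : X, TX n x →ₗ[ℂ] TX n x →ₗ⋆[ℂ] ℂ)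
    (φ : OpenPartialHomeomorph X (Fin n → ℂ)) (u v y : Fin n → ℂ) : ℂ :=
  h (φ.symm y) (dChartInv φ (φ.symm y) u) (dChartInv φ (φ.symm y) v)

variable (n X) in
/-- A Kähler metric: a smooth Hermitian metric `h = g - iω` on the holomorphic tangent bundle
whose fundamental form `ω = -Im h` is closed. -/
structure KahlerMetric where
  /-- The metric, linear in the first and conjugate-linear in the second variable. -/
  toFun : ∀ x : X, TX n x →ₗ[ℂ] TX n x →ₗ⋆[ℂ] ℂ
  symm : ∀ (x : X) (u v : TX n x), conj (toFun x u v) = toFun x v u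
  pos : ∀ (x : X) (u : TX n x), u ≠ 0 → 0 < (toFun x u u).re
  smooth : ∀ φ ∈ atlas (Fin n → ℂ) X, ∀ u v : Fin n → ℂ,
    ContDiffOn ℝ ∞ (metricInChart toFun φ u v) φ.target
  closed : ∀ φ ∈ atlas (Fin n → ℂ) X, ∀ y ∈ φ.target, ∀ u v w : Fin n → ℂ,
    fderiv ℝ (fun y' => -(metricInChart toFun φ v w y').im) y u +
    fderiv ℝ (fun y' => -(metricInChart toFun φ w u y').im) y v +
    fderiv ℝ (fun y' => -(metricInChart toFun φ u v y').im) y w = 0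

namespace KahlerMetric

variable (h : KahlerMetric n X)

/-- The isomorphism `TX ≅ T̄^*X`, `v ↦ h(v, ·)`. -/
def flat (x : X) : TX n x ≃ₗ[ℂ] CDual (TX n x) :=
  LinearEquiv.ofBijective (h.toFun x) (bijective_of_pos (h.toFun x) (h.pos x))

/-- The isomorphism `f_{p,q} : Λ^p TX ⊗ Λ^q T̄^*X → Λ^p T̄^*X ⊗ Λ^q TX` induced by
`TX ≅ T̄^*X`. -/
def f (p q : ℕ) (x : X) : PV p q (TX n x) ≃ₗ[ℂ] DF p q (TX n x) :=
  TensorProduct.congr (extEquiv p (h.flat x)) (extEquiv q (h.flat x).symm)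

/-- The dual metric on `T̄^*X`. -/
def dualForm (x : X) : CDual (TX n x) →ₗ[ℂ] CDual (TX n x) →ₗ⋆[ℂ] ℂ :=
  ((h.toFun x).compl₂ (h.flat x).symm.toLinearMap).comp (h.flat x).symm.toLinearMap

/-- The induced Hermitian metric on `Λ^p T̄^*X ⊗ Λ^q TX`. -/
def dfForm (p q : ℕ) (x : X) : DF p q (TX n x) →ₗ[ℂ] DF p q (TX n x) →ₗ⋆[ℂ] ℂ :=
  tensorForm (extForm p (h.dualForm x)) (extForm q (h.toFun x))

/-- The density `det (h(∂_j, ∂_k))` of the Riemannian volume of `g = Re h` with respect to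
Lebesgue measure of `ℂ^n = ℝ^{2n}` in a chart. -/
def volDensity (φ : OpenPartialHomeomorph X (Fin n → ℂ)) (y : Fin n → ℂ) : ℝ :=
  (Matrix.of fun j k : Fin n =>
    metricInChart h.toFun φ (Pi.single j 1) (Pi.single k 1) y).det.re

end KahlerMetric

/-! #### Parallel holomorphic volume forms and the operator `Δ` -/

/-- An `(n, 0)`-form in a chart. -/
def formInChart (Ω : ∀ x : X, ⋀[ℂ]^n (Module.Dual ℂ (TX n x)))
    (φ : OpenPartialHomeomorph X (Fin n → ℂ)) (y : Fin n → ℂ) :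
    ⋀[ℂ]^n (Module.Dual ℂ (Fin n → ℂ)) :=
  exteriorPower.map n (dChartInv φ (φ.symm y)).dualMap (Ω (φ.symm y))

/-- `Ω` is a holomorphic section of `Λ^n T^*X`. -/
def IsHolomorphicForm (Ω : ∀ x : X, ⋀[ℂ]^n (Module.Dual ℂ (TX n x))) : Prop :=
  ∀ φ ∈ atlas (Fin n → ℂ) X, ∀ l : ⋀[ℂ]^n (Module.Dual ℂ (Fin n → ℂ)) →ₗ[ℂ] ℂ,
    DifferentiableOn ℂ (fun y => l (formInChart Ω φ y)) φ.target

/-- The function `y ↦ Ω(v₁, …, v_n)` in a chart, for constant vectors `vᵢ ∈ ℂ^n`. -/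
def formEval (Ω : ∀ x : X, ⋀[ℂ]^n (Module.Dual ℂ (TX n x)))
    (φ : OpenPartialHomeomorph X (Fin n → ℂ)) (v : Fin n → Fin n → ℂ) (y : Fin n → ℂ) : ℂ :=
  exteriorPower.pairingDual ℂ (Fin n → ℂ) n (formInChart Ω φ y) (exteriorPower.ιMulti ℂ n v)

namespace KahlerMetric

variable (h : KahlerMetric n X)

/-- The coefficient `g(u, v)` of the Riemannian metric `g = Re h` in a chart. -/
def riemInChart (φ : OpenPartialHomeomorph X (Fin n → ℂ)) (u v y : Fin n → ℂ) : ℝ :=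
  (metricInChart h.toFun φ u v y).re

/-- `Γ(u, v) = ∇_u v` is the value at `y` of the Levi-Civita connection of `g = Re h` on constant
vector fields `u, v` of the chart, by the Koszul formula. -/
def IsChristoffel (φ : OpenPartialHomeomorph X (Fin n → ℂ)) (y : Fin n → ℂ)
    (Γ : (Fin n → ℂ) → (Fin n → ℂ) → (Fin n → ℂ)) : Prop :=
  ∀ u v w : Fin n → ℂ,
    2 * h.riemInChart φ (Γ u v) w y =
      fderiv ℝ (h.riemInChart φ v w) y u + fderiv ℝ (h.riemInChart φ u w) y v -
        fderiv ℝ (h.riemInChart φ u v) y w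

/-- `∇Ω = 0` for the Levi-Civita connection: in every chart,
`u(Ω(v₁, …, v_n)) = ∑ᵢ Ω(v₁, …, ∇_u vᵢ, …, v_n)`. -/
def IsParallel (Ω : ∀ x : X, ⋀[ℂ]^n (Module.Dual ℂ (TX n x))) : Prop :=
  ∀ φ ∈ atlas (Fin n → ℂ) X, ∀ y ∈ φ.target,
    ∃ Γ : (Fin n → ℂ) → (Fin n → ℂ) → (Fin n → ℂ), h.IsChristoffel φ y Γ ∧
      ∀ (u : Fin n → ℂ) (v : Fin n → Fin n → ℂ),
        fderiv ℝ (formEval Ω φ v) y u =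
          ∑ i, formEval Ω φ (Function.update v i (Γ u (v i))) y

end KahlerMetric

/-- `δ = Δγ`, that is `δ ⌟ Ω = ∂(γ ⌟ Ω)`. -/
def IsDelta {p q : ℕ} (Ω : ∀ x : X, ⋀[ℂ]^n (Module.Dual ℂ (TX n x)))
    (γ : ∀ x : X, PV (p + 1) q (TX n x)) (δ : ∀ x : X, PV p q (TX n x)) : Prop :=
  ∀ x, contractForm p q (Ω x) (δ x) = del (fun x' => contractForm (p + 1) q (Ω x') (γ x')) x

open Classical in
/-- The Barannikov-Kontsevich operator
`Δ : Γ(X, Λ^{p+1} TX ⊗ Λ^q T̄^*X) → Γ(X, Λ^p TX ⊗ Λ^q T̄^*X)`, `(Δγ) ⌟ Ω = ∂(γ ⌟ Ω)`. -/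
def Delta {p q : ℕ} (Ω : ∀ x : X, ⋀[ℂ]^n (Module.Dual ℂ (TX n x)))
    (γ : ∀ x : X, PV (p + 1) q (TX n x)) : ∀ x : X, PV p q (TX n x) :=
  if H : ∃ δ : ∀ x : X, PV p q (TX n x), IsDelta Ω γ δ then H.choose else 0

/-! #### The formal adjoint of `∂̄` -/

/-- A partition of unity subordinate to the cover of `X` by the preferred charts. -/
theorem exists_chartPartition (n : ℕ) (X : Type*) [TopologicalSpace X]
    [ChartedSpace (Fin n → ℂ) X] [CompactSpace X] [T2Space X] :
    ∃ ρ : PartitionOfUnity X X, ρ.IsSubordinate fun i : X => (chartAt (Fin n → ℂ) i).source :=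
  PartitionOfUnity.exists_isSubordinate isClosed_univ _
    (fun i => (chartAt (Fin n → ℂ) i).open_source)
    (fun x _ => mem_iUnion.2 ⟨x, mem_chart_source _ x⟩)

variable [CompactSpace X] [T2Space X]

namespace KahlerMetric

variable (h : KahlerMetric n X)

/-- `∫_X u dvol_g`, computed in charts with a partition of unity. -/
def integral (u : X → ℂ) : ℂ :=
  ∑ᶠ i : X, ∫ y in (chartAt (Fin n → ℂ) i).target,
    (((exists_chartPartition n X).choose i ((chartAt (Fin n → ℂ) i).symm y) *
      h.volDensity (chartAt (Fin n → ℂ) i) y : ℝ) : ℂ) * u ((chartAt (Fin n → ℂ) i).symm y)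

/-- The `L²` inner product `(α, β) = ∫_X ⟨α, β⟩ dvol_g` on `Γ(X, Λ^p T̄^*X ⊗ Λ^q TX)`. -/
def l2 {p q : ℕ} (α β : ∀ x : X, DF p q (TX n x)) : ℂ :=
  h.integral fun x => h.dfForm p q x (α x) (β x)

/-- `η` is smooth and equal to `∂̄^* β`: `(∂̄α, β) = (α, η)` for all smooth `α`. -/
def IsDbarAdjoint {p q : ℕ} (β : ∀ x : X, DF (p + 1) q (TX n x))
    (η : ∀ x : X, DF p q (TX n x)) : Prop :=
  DF.IsSmooth η ∧ ∀ α : ∀ x : X, DF p q (TX n x), DF.IsSmooth α → h.l2 (dbar α) β = h.l2 α η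

open Classical in
/-- The formal `L²`-adjoint
`∂̄^* : Γ(X, Λ^{p+1} T̄^*X ⊗ Λ^q TX) → Γ(X, Λ^p T̄^*X ⊗ Λ^q TX)` of `∂̄`. -/
def dbarStar {p q : ℕ} (β : ∀ x : X, DF (p + 1) q (TX n x)) : ∀ x : X, DF p q (TX n x) :=
  if H : ∃ η : ∀ x : X, DF p q (TX n x), h.IsDbarAdjoint β η then H.choose else 0

end KahlerMetric

end Manifold

end BK

end

open BK

open Set
open scoped Manifold ContDiff TensorProduct ComplexConjugate

noncomputable section

namespace BK


/-! ### Differential calculus for functions with values in finite-dimensional complex spaces -/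

section VectorCalculus

variable {E : Type*} [NormedAddCommGroup E] [NormedSpace ℝ E]
variable {F : Type*} [AddCommGroup F] [Module ℂ F]
variable {G : Type*} [AddCommGroup G] [Module ℂ G]
variable {H : Type*} [AddCommGroup H] [Module ℂ H]

/-! In a holomorphic chart write Ω = F dz₁ ∧ ⋯ ∧ dz_n and let D = det (h(∂_j, ∂_k)) be the density
of the Riemannian volume (`topCoeff`, `volDet`). Both Δ and -∂̄^* are divergences, one weighted by F
and the other by D, and the point is that the two weights have the same logarithmic derivative.

For Δ: a covector l satisfies l ∧ Ω = 0 for reasons of degree, so moving l past interior products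
gives l ∧ (m ⌟ Ω) = (l ⌟ m) ⌟ Ω (`ι_mul_contract`). Hence ∂(γ ⌟ Ω) is again a contraction with Ω,
and Δγ = F⁻¹ ∑ⱼ dz_j ⌟ ∂_j(F γ) (`contractForm_eq_del_iff`). Contraction with a nonzero Ω is
injective (`contract_injective`), which makes Δγ unique. If γ has polyvector degree 0, then γ ⌟ Ω is
a multiple of Ω and every dz_j ∧ kills it.

For ∂̄^*: in ⟨α, f γ⟩ the metric cancels and the natural sesquilinear pairing remains
(`dfFormOf_fOf_eq_pairing`), so the metric enters the L² product only through D. In this pairing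
dz̄_j ∧ is adjoint to dz_j ⌟ (`pairing_wedge`), and conjugate-linearity in γ turns ∂̄ on the pairing
into ∂ on γ (`dbarDir_sesq`). Therefore D (⟨∂̄α, f γ⟩ + ⟨α, f Δγ⟩) = ∑ⱼ ∂̄_j (D ⟨α, f (dz_j ⌟ γ)⟩)
as soon as ∂̄_j D / D is the conjugate of ∂_j F / F (`divergence_identity`).

This relation is where the geometry enters (`topCoeff_volDet`). Closedness of the fundamental form
gives h(∇_u v, w) = ∂_u h(v, w) for the Levi-Civita connection (`metricInChart_christoffel`), so ∂_u
D = tr(Γ_u) D. Parallelism of Ω gives ∂_u F = tr(Γ_u) F. Finally D is real.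

To globalize, ∂, ∂̄ and the integral are shown not to depend on charts (`inChart_del`,
`inChart_dbar`, `KahlerMetric.integral_eq_chartIntegral`), and α is cut by a smooth partition of
unity into pieces for which the divergence integrates to zero (`integral_dbar`). Uniqueness of the
adjoint is the fundamental lemma of the calculus of variations (`eq_of_integral_pairFun_eq`). -/

/-- Real differentiability at a point, tested on scalar components. -/
def DiffAt (g : E → F) (y : E) : Prop :=
  ∀ l : F →ₗ[ℂ] ℂ, DifferentiableAt ℝ (fun y' => l (g y')) y

/-- The directional derivative, computed componentwise in a basis of the values. -/
def dirVec [Module.Finite ℂ F] (g : E → F) (y : E) : E →ₗ[ℝ] F where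
  toFun v := ∑ i, fderiv ℝ (fun y' => (Module.finBasis ℂ F).coord i (g y')) y v •
    Module.finBasis ℂ F i
  map_add' v w := by simp [add_smul, Finset.sum_add_distrib]
  map_smul' c v := by simp [Finset.smul_sum, ← Complex.coe_smul, smul_smul]

theorem dirVec_apply [Module.Finite ℂ F] (g : E → F) (y v : E) :
    dirVec g y v = ∑ i, fderiv ℝ (fun y' => (Module.finBasis ℂ F).coord i (g y')) y v •
      Module.finBasis ℂ F i := rfl

/-- Differentiability and smoothness are tested on complex-linear functionals only. Expanding in a
complex basis extends this to all real-linear ones, which admits conjugate-linear and sesquilinear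
operations. -/
theorem realFunctional_eq_sum [Module.Finite ℂ F] (l : F →ₗ[ℝ] ℂ) (x : F) :
    l x = ∑ i, (LinearMap.toContinuousLinearMap
      (l ∘ₗ (LinearMap.toSpanSingleton ℂ F (Module.finBasis ℂ F i)).restrictScalars ℝ) : ℂ →L[ℝ] ℂ)
        ((Module.finBasis ℂ F).coord i x) := by
  conv_lhs => rw [← (Module.finBasis ℂ F).sum_repr x, map_sum]
  rfl

theorem DiffAt.differentiableAt_comp [Module.Finite ℂ F] {g : E → F} {y : E} (hg : DiffAt g y)
    (l : F →ₗ[ℝ] ℂ) : DifferentiableAt ℝ (fun y' => l (g y')) y := by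
  simp only [realFunctional_eq_sum l]
  refine DifferentiableAt.fun_sum fun i _ => ?_
  exact (ContinuousLinearMap.differentiableAt _).comp y (hg ((Module.finBasis ℂ F).coord i))

theorem DiffAt.fderiv_comp [Module.Finite ℂ F] {g : E → F} {y : E} (hg : DiffAt g y)
    (l : F →ₗ[ℝ] ℂ) (v : E) : fderiv ℝ (fun y' => l (g y')) y v = l (dirVec g y v) := by
  have h1 : HasFDerivAt (fun y' => l (g y')) (∑ i, (LinearMap.toContinuousLinearMap
      (l ∘ₗ (LinearMap.toSpanSingleton ℂ F (Module.finBasis ℂ F i)).restrictScalars ℝ) :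
        ℂ →L[ℝ] ℂ).comp (fderiv ℝ (fun y' => (Module.finBasis ℂ F).coord i (g y')) y)) y := by
    simp only [realFunctional_eq_sum l]
    refine HasFDerivAt.fun_sum fun i _ => ?_
    exact (ContinuousLinearMap.hasFDerivAt _).comp y
      (hg ((Module.finBasis ℂ F).coord i)).hasFDerivAt
  rw [h1.fderiv, dirVec_apply, map_sum]
  simp

theorem DiffAt.fderiv_comp' [Module.Finite ℂ F] {g : E → F} {y : E} (hg : DiffAt g y)
    (l : F →ₗ[ℂ] ℂ) (v : E) : fderiv ℝ (fun y' => l (g y')) y v = l (dirVec g y v) :=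
  hg.fderiv_comp (l.restrictScalars ℝ) v

theorem eq_of_forall_functional {a b : F} (h : ∀ l : F →ₗ[ℂ] ℂ, l a = l b) : a = b := by
  rw [← sub_eq_zero, ← Module.forall_dual_apply_eq_zero_iff ℂ]
  intro l
  rw [map_sub, h l, sub_self]

/-- Frees the directional derivative from the chosen basis: it is determined by its scalar
components, so each rule below reduces to the scalar one. -/
theorem DiffAt.dirVec_eq [Module.Finite ℂ F] {g : E → F} {y : E} (hg : DiffAt g y) {v : E} {w : F}
    (h : ∀ l : F →ₗ[ℂ] ℂ, fderiv ℝ (fun y' => l (g y')) y v = l w) : dirVec g y v = w :=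
  eq_of_forall_functional fun l => by rw [← hg.fderiv_comp', h]

theorem DiffAt.comp_linear [Module.Finite ℂ F] {g : E → F} {y : E} (hg : DiffAt g y)
    (L : F →ₗ[ℝ] G) : DiffAt (fun y' => L (g y')) y := fun l =>
  hg.differentiableAt_comp (l.restrictScalars ℝ ∘ₗ L)

theorem dirVec_comp_linear [Module.Finite ℂ F] [Module.Finite ℂ G] {g : E → F} {y : E}
    (hg : DiffAt g y) (L : F →ₗ[ℝ] G) (v : E) :
    dirVec (fun y' => L (g y')) y v = L (dirVec g y v) :=
  (hg.comp_linear L).dirVec_eq fun l => hg.fderiv_comp (l.restrictScalars ℝ ∘ₗ L) v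

theorem diffAt_const (c : F) (y : E) : DiffAt (fun _ => c) y :=
  fun _ => differentiableAt_const _

theorem dirVec_const [Module.Finite ℂ F] (c : F) (y v : E) : dirVec (fun _ => c) y v = 0 :=
  (diffAt_const c y).dirVec_eq fun l => by simp

theorem DiffAt.add {f g : E → F} {y : E} (hf : DiffAt f y) (hg : DiffAt g y) :
    DiffAt (fun y' => f y' + g y') y := fun l => by
  simp only [map_add]; exact (hf l).fun_add (hg l)

theorem dirVec_add [Module.Finite ℂ F] {f g : E → F} {y : E} (hf : DiffAt f y) (hg : DiffAt g y)
    (v : E) : dirVec (fun y' => f y' + g y') y v = dirVec f y v + dirVec g y v :=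
  (hf.add hg).dirVec_eq fun l => by
    simp only [map_add]
    rw [fderiv_fun_add (hf l) (hg l), ← hf.fderiv_comp', ← hg.fderiv_comp']
    rfl

theorem DiffAt.congr {f g : E → F} {y : E} (hf : DiffAt f y) (h : g =ᶠ[nhds y] f) :
    DiffAt g y := fun l =>
  (hf l).congr_of_eventuallyEq (h.fun_comp l)

theorem dirVec_congr [Module.Finite ℂ F] {f g : E → F} {y : E} (h : g =ᶠ[nhds y] f) (v : E) :
    dirVec g y v = dirVec f y v := by
  simp only [dirVec_apply]
  refine Finset.sum_congr rfl fun i _ => ?_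
  congr 2
  exact (h.fun_comp ((Module.finBasis ℂ F).coord i)).fderiv_eq

theorem diffAt_scalar {u : E → ℂ} {y : E} : DiffAt u y ↔ DifferentiableAt ℝ u y := by
  refine ⟨fun h => h LinearMap.id, fun h l => ?_⟩
  have : (fun y' => l (u y')) = fun y' => u y' * l 1 := by
    ext y'; rw [← smul_eq_mul, ← map_smul, smul_eq_mul, mul_one]
  rw [this]
  exact h.mul_const _

theorem dirVec_scalar {u : E → ℂ} {y : E} (hu : DifferentiableAt ℝ u y) (v : E) :
    dirVec u y v = fderiv ℝ u y v :=
  ((diffAt_scalar.2 hu).fderiv_comp' LinearMap.id v).symm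

/-- Expanding the first factor in a real basis turns a vector-valued product rule into a finite sum
of scalar product rules. A real basis serves complex bilinear and sesquilinear maps alike. -/
theorem bilin_eq_sum [Module.Finite ℝ F] (b : F →ₗ[ℝ] G →ₗ[ℝ] H) (l : H →ₗ[ℂ] ℂ) (x : F)
    (z : G) : l (b x z) = ∑ i, (Complex.ofRealCLM.toLinearMap ∘ₗ (Module.finBasis ℝ F).coord i) x *
      (l.restrictScalars ℝ ∘ₗ b (Module.finBasis ℝ F i)) z := by
  conv_lhs => rw [← (Module.finBasis ℝ F).sum_repr x]
  simp only [map_sum, LinearMap.sum_apply, map_smul, LinearMap.smul_apply]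
  refine Finset.sum_congr rfl fun i _ => ?_
  rw [← Complex.coe_smul, map_smul, smul_eq_mul]
  rfl

variable [Module.Finite ℂ F] [Module.Finite ℂ G]

theorem DiffAt.bilin {f : E → F} {g : E → G} {y : E} (hf : DiffAt f y)
    (hg : DiffAt g y) (b : F →ₗ[ℝ] G →ₗ[ℝ] H) : DiffAt (fun y' => b (f y') (g y')) y := fun l => by
  have : Module.Finite ℝ F := Module.Finite.trans ℂ F
  simp only [bilin_eq_sum b l]
  exact DifferentiableAt.fun_sum fun i _ =>
    (hf.differentiableAt_comp _).fun_mul (hg.differentiableAt_comp _)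

theorem dirVec_bilin [Module.Finite ℂ H] {f : E → F} {g : E → G} {y : E} (hf : DiffAt f y)
    (hg : DiffAt g y) (b : F →ₗ[ℝ] G →ₗ[ℝ] H) (v : E) :
    dirVec (fun y' => b (f y') (g y')) y v = b (dirVec f y v) (g y) + b (f y) (dirVec g y v) :=
  (hf.bilin hg b).dirVec_eq fun l => by
    have : Module.Finite ℝ F := Module.Finite.trans ℂ F
    simp only [map_add, bilin_eq_sum b l]
    rw [fderiv_fun_sum fun i _ =>
      (hf.differentiableAt_comp _).fun_mul (hg.differentiableAt_comp _), sum_apply,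
      ← Finset.sum_add_distrib]
    refine Finset.sum_congr rfl fun i _ => ?_
    rw [fderiv_fun_mul (hf.differentiableAt_comp _) (hg.differentiableAt_comp _)]
    simp only [add_apply, smul_apply, hf.fderiv_comp,
      hg.fderiv_comp, smul_eq_mul]
    ring

theorem DiffAt.comp {E' : Type*} [NormedAddCommGroup E'] [NormedSpace ℝ E'] {g : E → F}
    {ψ : E' → E} {y : E'} (hg : DiffAt g (ψ y)) (hψ : DifferentiableAt ℝ ψ y) :
    DiffAt (fun y' => g (ψ y')) y := fun l =>
  DifferentiableAt.comp (g := fun z => l (g z)) y (hg l) hψ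

theorem dirVec_comp {E' : Type*} [NormedAddCommGroup E'] [NormedSpace ℝ E'] {g : E → F}
    {ψ : E' → E} {y : E'} (hg : DiffAt g (ψ y)) (hψ : DifferentiableAt ℝ ψ y) (v : E') :
    dirVec (fun y' => g (ψ y')) y v = dirVec g (ψ y) (fderiv ℝ ψ y v) :=
  (hg.comp hψ).dirVec_eq fun l => by
    rw [← hg.fderiv_comp']
    exact congrArg (fun L => L v) (fderiv_comp (g := fun z => l (g z)) y (hg l) hψ)

/-- A complex bilinear map as a real bilinear map. -/
def realBilin (b : F →ₗ[ℂ] G →ₗ[ℂ] H) : F →ₗ[ℝ] G →ₗ[ℝ] H :=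
  LinearMap.mk₂ ℝ (fun x z => b x z) (fun x x' z => by simp) (fun c x z => by
    rw [← Complex.coe_smul, map_smul, LinearMap.smul_apply, Complex.coe_smul])
    (fun x z z' => by simp) (fun c x z => by
    rw [← Complex.coe_smul, map_smul, Complex.coe_smul])

/-- A sesquilinear map as a real bilinear map. -/
def realSesq (b : F →ₗ[ℂ] G →ₗ⋆[ℂ] H) : F →ₗ[ℝ] G →ₗ[ℝ] H :=
  LinearMap.mk₂ ℝ (fun x z => b x z) (fun x x' z => by simp) (fun c x z => by
    rw [← Complex.coe_smul, map_smul, LinearMap.smul_apply, Complex.coe_smul])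
    (fun x z z' => by simp) (fun c x z => by
    rw [← Complex.coe_smul, map_smulₛₗ, Complex.conj_ofReal, Complex.coe_smul])

theorem DiffAt.bilinC {f : E → F} {g : E → G} {y : E} (hf : DiffAt f y)
    (hg : DiffAt g y) (b : F →ₗ[ℂ] G →ₗ[ℂ] H) : DiffAt (fun y' => b (f y') (g y')) y :=
  hf.bilin hg (realBilin b)

theorem dirVec_bilinC [Module.Finite ℂ H] {f : E → F} {g : E → G} {y : E} (hf : DiffAt f y)
    (hg : DiffAt g y) (b : F →ₗ[ℂ] G →ₗ[ℂ] H) (v : E) :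
    dirVec (fun y' => b (f y') (g y')) y v = b (dirVec f y v) (g y) + b (f y) (dirVec g y v) :=
  dirVec_bilin hf hg (realBilin b) v

theorem DiffAt.sesq {f : E → F} {g : E → G} {y : E} (hf : DiffAt f y)
    (hg : DiffAt g y) (b : F →ₗ[ℂ] G →ₗ⋆[ℂ] H) : DiffAt (fun y' => b (f y') (g y')) y :=
  hf.bilin hg (realSesq b)

theorem dirVec_sesq [Module.Finite ℂ H] {f : E → F} {g : E → G} {y : E} (hf : DiffAt f y)
    (hg : DiffAt g y) (b : F →ₗ[ℂ] G →ₗ⋆[ℂ] H) (v : E) :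
    dirVec (fun y' => b (f y') (g y')) y v = b (dirVec f y v) (g y) + b (f y) (dirVec g y v) :=
  dirVec_bilin hf hg (realSesq b) v

/-- A complex linear map as a real linear map composes with differentiable functions. -/
theorem DiffAt.linC {g : E → F} {y : E} (hg : DiffAt g y) (L : F →ₗ[ℂ] G) :
    DiffAt (fun y' => L (g y')) y := hg.comp_linear (L.restrictScalars ℝ)

theorem dirVec_linC {g : E → F} {y : E} (hg : DiffAt g y) (L : F →ₗ[ℂ] G) (v : E) :
    dirVec (fun y' => L (g y')) y v = L (dirVec g y v) :=
  dirVec_comp_linear hg (L.restrictScalars ℝ) v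

end VectorCalculus

/-! ### Smooth vector-valued functions on ℂⁿ and their (1, 0) and (0, 1) derivatives -/

section SmoothCalculus

variable {n : ℕ}
variable {F : Type*} [AddCommGroup F] [Module ℂ F]
variable {G : Type*} [AddCommGroup G] [Module ℂ G]
variable {H : Type*} [AddCommGroup H] [Module ℂ H]

theorem SmoothOn.diffAt {g : (Fin n → ℂ) → F} {U : Set (Fin n → ℂ)} (hg : SmoothOn g U)
    (hU : IsOpen U) {y : Fin n → ℂ} (hy : y ∈ U) : DiffAt g y := fun l =>
  ((hg l).contDiffAt (hU.mem_nhds hy)).differentiableAt (by simp)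

theorem SmoothOn.congr {f g : (Fin n → ℂ) → F} {U : Set (Fin n → ℂ)} (hf : SmoothOn f U)
    (h : ∀ y ∈ U, g y = f y) : SmoothOn g U := fun l =>
  (hf l).congr fun y hy => by rw [h y hy]

theorem smoothOn_scalar {u : (Fin n → ℂ) → ℂ} {U : Set (Fin n → ℂ)} :
    SmoothOn u U ↔ ContDiffOn ℝ ∞ u U := by
  refine ⟨fun h => h LinearMap.id, fun h l => ?_⟩
  have : (fun y' => l (u y')) = fun y' => u y' * l 1 := by
    ext y'; rw [← smul_eq_mul, ← map_smul, smul_eq_mul, mul_one]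
  rw [this]
  exact h.mul contDiffOn_const

theorem smoothOn_const (c : F) (U : Set (Fin n → ℂ)) : SmoothOn (fun _ => c) U :=
  fun _ => contDiffOn_const

theorem SmoothOn.add {f g : (Fin n → ℂ) → F} {U : Set (Fin n → ℂ)} (hf : SmoothOn f U)
    (hg : SmoothOn g U) : SmoothOn (fun y => f y + g y) U := fun l => by
  simp only [map_add]; exact (hf l).add (hg l)

theorem SmoothOn.neg {f : (Fin n → ℂ) → F} {U : Set (Fin n → ℂ)} (hf : SmoothOn f U) :
    SmoothOn (fun y => -f y) U := fun l => by
  simp only [map_neg]; exact (hf l).neg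

theorem SmoothOn.sum {ι : Type*} {s : Finset ι} {f : ι → (Fin n → ℂ) → F}
    {U : Set (Fin n → ℂ)} (hf : ∀ i ∈ s, SmoothOn (f i) U) :
    SmoothOn (fun y => ∑ i ∈ s, f i y) U := fun l => by
  simp only [map_sum]; exact ContDiffOn.sum fun i hi => hf i hi l

variable [Module.Finite ℂ F] [Module.Finite ℂ G]

theorem SmoothOn.contDiffOn_comp {g : (Fin n → ℂ) → F} {U : Set (Fin n → ℂ)}
    (hg : SmoothOn g U) (l : F →ₗ[ℝ] ℂ) : ContDiffOn ℝ ∞ (fun y => l (g y)) U := by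
  simp only [realFunctional_eq_sum l]
  refine ContDiffOn.sum fun i _ => ?_
  exact (ContinuousLinearMap.contDiff _).comp_contDiffOn (hg ((Module.finBasis ℂ F).coord i))

theorem SmoothOn.linear {g : (Fin n → ℂ) → F} {U : Set (Fin n → ℂ)}
    (hg : SmoothOn g U) (L : F →ₗ[ℝ] G) : SmoothOn (fun y => L (g y)) U := fun l =>
  hg.contDiffOn_comp (l.restrictScalars ℝ ∘ₗ L)

theorem SmoothOn.linC {g : (Fin n → ℂ) → F} {U : Set (Fin n → ℂ)}
    (hg : SmoothOn g U) (L : F →ₗ[ℂ] G) : SmoothOn (fun y => L (g y)) U :=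
  hg.linear (L.restrictScalars ℝ)

theorem SmoothOn.bilin {f : (Fin n → ℂ) → F} {g : (Fin n → ℂ) → G} {U : Set (Fin n → ℂ)}
    (hf : SmoothOn f U) (hg : SmoothOn g U) (b : F →ₗ[ℝ] G →ₗ[ℝ] H) :
    SmoothOn (fun y => b (f y) (g y)) U := fun l => by
  have : Module.Finite ℝ F := Module.Finite.trans ℂ F
  simp only [bilin_eq_sum b l]
  exact ContDiffOn.sum fun i _ => (hf.contDiffOn_comp _).mul (hg.contDiffOn_comp _)

theorem SmoothOn.bilinC {f : (Fin n → ℂ) → F} {g : (Fin n → ℂ) → G} {U : Set (Fin n → ℂ)}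
    (hf : SmoothOn f U) (hg : SmoothOn g U) (b : F →ₗ[ℂ] G →ₗ[ℂ] H) :
    SmoothOn (fun y => b (f y) (g y)) U := hf.bilin hg (realBilin b)

theorem SmoothOn.sesq {f : (Fin n → ℂ) → F} {g : (Fin n → ℂ) → G} {U : Set (Fin n → ℂ)}
    (hf : SmoothOn f U) (hg : SmoothOn g U) (b : F →ₗ[ℂ] G →ₗ⋆[ℂ] H) :
    SmoothOn (fun y => b (f y) (g y)) U := hf.bilin hg (realSesq b)

theorem SmoothOn.smul {u : (Fin n → ℂ) → ℂ} {g : (Fin n → ℂ) → G} {U : Set (Fin n → ℂ)}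
    (hu : ContDiffOn ℝ ∞ u U) (hg : SmoothOn g U) : SmoothOn (fun y => u y • g y) U :=
  (smoothOn_scalar.2 hu).bilinC hg (LinearMap.lsmul ℂ G)

theorem SmoothOn.dirVec {g : (Fin n → ℂ) → F} {U : Set (Fin n → ℂ)}
    (hg : SmoothOn g U) (hU : IsOpen U) (v : Fin n → ℂ) :
    SmoothOn (fun y => dirVec g y v) U := fun l => by
  have : ContDiffOn ℝ ∞ (fun y => fderiv ℝ (fun y' => l (g y')) y v) U :=
    ((hg l).fderiv_of_isOpen hU (m := ∞) (by simp)).clm_apply contDiffOn_const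
  exact this.congr fun y hy => ((hg.diffAt hU hy).fderiv_comp' l v).symm

theorem SmoothOn.comp_smooth {n' : ℕ} {g : (Fin n → ℂ) → F} {U : Set (Fin n → ℂ)} {ψ : (Fin n' → ℂ) → (Fin n → ℂ)}
    {U' : Set (Fin n' → ℂ)} (hg : SmoothOn g U) (hψ : ContDiffOn ℝ ∞ ψ U') (h : MapsTo ψ U' U) :
    SmoothOn (fun y => g (ψ y)) U' := fun l => (hg l).comp hψ h

/-- `∂_v g`, the `(1, 0)`-part of the directional derivative. -/
def delDir (g : (Fin n → ℂ) → F) (y v : Fin n → ℂ) : F :=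
  (2⁻¹ : ℂ) • (dirVec g y v - Complex.I • dirVec g y (Complex.I • v))

/-- `∂̄_v g`, the `(0, 1)`-part of the directional derivative. -/
def dbarDir (g : (Fin n → ℂ) → F) (y v : Fin n → ℂ) : F :=
  (2⁻¹ : ℂ) • (dirVec g y v + Complex.I • dirVec g y (Complex.I • v))

theorem single_I (j : Fin n) :
    (Pi.single j Complex.I : Fin n → ℂ) = Complex.I • Pi.single j (1 : ℂ) := by
  rw [← Pi.single_smul, smul_eq_mul, mul_one]

theorem dzVec_eq (j : Fin n) (g : (Fin n → ℂ) → F) (y : Fin n → ℂ) :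
    dzVec j g y = delDir g y (Pi.single j 1) := by
  simp only [dzVec, delDir, dirVec_apply, dz, single_I, Finset.smul_sum,
    ← Finset.sum_sub_distrib, smul_smul, ← sub_smul]
  refine Finset.sum_congr rfl fun i _ => ?_
  congr 1; ring

theorem dzbarVec_eq (j : Fin n) (g : (Fin n → ℂ) → F) (y : Fin n → ℂ) :
    dzbarVec j g y = dbarDir g y (Pi.single j 1) := by
  simp only [dzbarVec, dbarDir, dirVec_apply, dzbar, single_I, Finset.smul_sum,
    ← Finset.sum_add_distrib, smul_smul, ← add_smul]
  refine Finset.sum_congr rfl fun i _ => ?_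
  congr 1; ring

theorem SmoothOn.delDir {g : (Fin n → ℂ) → F} {U : Set (Fin n → ℂ)}
    (hg : SmoothOn g U) (hU : IsOpen U) (v : Fin n → ℂ) :
    SmoothOn (fun y => delDir g y v) U := fun l => by
  simp only [BK.delDir, map_smul, map_sub]
  simp only [smul_eq_mul]
  exact contDiffOn_const.mul ((hg.dirVec hU v l).sub (contDiffOn_const.mul (hg.dirVec hU _ l)))

theorem SmoothOn.dbarDir {g : (Fin n → ℂ) → F} {U : Set (Fin n → ℂ)}
    (hg : SmoothOn g U) (hU : IsOpen U) (v : Fin n → ℂ) :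
    SmoothOn (fun y => dbarDir g y v) U := fun l => by
  simp only [BK.dbarDir, map_smul, map_add]
  simp only [smul_eq_mul]
  exact contDiffOn_const.mul ((hg.dirVec hU v l).add (contDiffOn_const.mul (hg.dirVec hU _ l)))

variable {y : Fin n → ℂ}

theorem delDir_congr {f g : (Fin n → ℂ) → F} (h : g =ᶠ[nhds y] f) (v : Fin n → ℂ) :
    delDir g y v = delDir f y v := by
  simp only [delDir, dirVec_congr h]

theorem dbarDir_congr {f g : (Fin n → ℂ) → F} (h : g =ᶠ[nhds y] f) (v : Fin n → ℂ) :
    dbarDir g y v = dbarDir f y v := by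
  simp only [dbarDir, dirVec_congr h]

theorem dbarDir_const (c : F) (v : Fin n → ℂ) : dbarDir (fun _ => c) y v = 0 := by
  simp [dbarDir, dirVec_const]

theorem delDir_linC {g : (Fin n → ℂ) → F} (hg : DiffAt g y) (L : F →ₗ[ℂ] G) (v : Fin n → ℂ) :
    delDir (fun y' => L (g y')) y v = L (delDir g y v) := by
  simp only [delDir, dirVec_linC hg, map_smul, map_sub]

theorem dbarDir_add {f g : (Fin n → ℂ) → F} (hf : DiffAt f y) (hg : DiffAt g y) (v : Fin n → ℂ) :
    dbarDir (fun y' => f y' + g y') y v = dbarDir f y v + dbarDir g y v := by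
  simp only [dbarDir, dirVec_add hf hg]
  module

theorem delDir_bilinC [Module.Finite ℂ H] {f : (Fin n → ℂ) → F} {g : (Fin n → ℂ) → G}
    (hf : DiffAt f y) (hg : DiffAt g y) (b : F →ₗ[ℂ] G →ₗ[ℂ] H) (v : Fin n → ℂ) :
    delDir (fun y' => b (f y') (g y')) y v = b (delDir f y v) (g y) + b (f y) (delDir g y v) := by
  simp only [delDir, dirVec_bilinC hf hg, map_smul, map_sub, LinearMap.smul_apply,
    LinearMap.sub_apply, ← smul_add]
  congr 1
  simp only [smul_add]; abel

theorem dbarDir_bilinC [Module.Finite ℂ H] {f : (Fin n → ℂ) → F} {g : (Fin n → ℂ) → G}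
    (hf : DiffAt f y) (hg : DiffAt g y) (b : F →ₗ[ℂ] G →ₗ[ℂ] H) (v : Fin n → ℂ) :
    dbarDir (fun y' => b (f y') (g y')) y v =
      b (dbarDir f y v) (g y) + b (f y) (dbarDir g y v) := by
  simp only [dbarDir, dirVec_bilinC hf hg, map_smul, map_add, LinearMap.smul_apply,
    LinearMap.add_apply, ← smul_add]
  congr 1
  simp only [smul_add]; abel

/-- A conjugate-linear slot moves i across with the opposite sign and so exchanges ∂̄ with ∂. This
is why the adjoint of a ∂̄-operator is expressed by ∂-derivatives of γ. -/
theorem dbarDir_sesq [Module.Finite ℂ H] {f : (Fin n → ℂ) → F} {g : (Fin n → ℂ) → G}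
    (hf : DiffAt f y) (hg : DiffAt g y) (b : F →ₗ[ℂ] G →ₗ⋆[ℂ] H) (v : Fin n → ℂ) :
    dbarDir (fun y' => b (f y') (g y')) y v =
      b (dbarDir f y v) (g y) + b (f y) (delDir g y v) := by
  simp only [dbarDir, delDir, dirVec_sesq hf hg, map_smul, map_smulₛₗ, map_add, map_sub,
    LinearMap.smul_apply, LinearMap.add_apply, Complex.conj_I, map_inv₀, map_ofNat, ← smul_add,
    neg_smul]
  congr 1
  simp only [smul_add]; abel

theorem dirVec_I_smul (g : (Fin n → ℂ) → F) (c : ℂ) (v : Fin n → ℂ) :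
    dirVec g y (c • v) = c.re • dirVec g y v + c.im • dirVec g y (Complex.I • v) := by
  have : c • v = c.re • v + c.im • (Complex.I • v) := by
    conv_lhs => rw [← Complex.re_add_im c, add_smul, mul_smul]
    simp only [Complex.coe_smul]
  rw [this, map_add, map_smul, map_smul]

theorem delDir_add_dir (g : (Fin n → ℂ) → F) (v w : Fin n → ℂ) :
    delDir g y (v + w) = delDir g y v + delDir g y w := by
  simp only [delDir, smul_add Complex.I v w, map_add]
  module

theorem dbarDir_add_dir (g : (Fin n → ℂ) → F) (v w : Fin n → ℂ) :
    dbarDir g y (v + w) = dbarDir g y v + dbarDir g y w := by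
  simp only [dbarDir, smul_add Complex.I v w, map_add]
  module

theorem delDir_smul_dir (g : (Fin n → ℂ) → F) (c : ℂ) (v : Fin n → ℂ) :
    delDir g y (c • v) = c • delDir g y v := by
  simp only [delDir, smul_comm Complex.I c v, smul_comm c (2⁻¹ : ℂ)]
  congr 1
  rw [dirVec_I_smul g c v, dirVec_I_smul g c (Complex.I • v), smul_smul Complex.I Complex.I v,
    Complex.I_mul_I, neg_one_smul, map_neg]
  conv_rhs => rw [← Complex.re_add_im c]
  simp only [← Complex.coe_smul]
  match_scalars
  · ring_nf
  · ring_nf; rw [Complex.I_sq]; ring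

theorem dbarDir_smul_dir (g : (Fin n → ℂ) → F) (c : ℂ) (v : Fin n → ℂ) :
    dbarDir g y (c • v) = conj c • dbarDir g y v := by
  simp only [dbarDir, smul_comm Complex.I c v, smul_comm (conj c) (2⁻¹ : ℂ)]
  congr 1
  rw [dirVec_I_smul g c v, dirVec_I_smul g c (Complex.I • v), smul_smul Complex.I Complex.I v,
    Complex.I_mul_I, neg_one_smul, map_neg]
  conv_rhs => rw [← Complex.re_add_im c]
  simp only [← Complex.coe_smul, map_add, map_mul, Complex.conj_ofReal, Complex.conj_I]
  match_scalars
  · ring_nf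
  · ring_nf; rw [Complex.I_sq]; ring

end SmoothCalculus

/-! ### Exterior algebra: interior products and contractions -/

section ExteriorLemmas

open ExteriorAlgebra

variable {V W : Type*} [AddCommGroup V] [Module ℂ V] [AddCommGroup W] [Module ℂ W]

/-- The interior product on the exterior algebra. -/
def contractL (l : Module.Dual ℂ V) : ExteriorAlgebra ℂ V →ₗ[ℂ] ExteriorAlgebra ℂ V :=
  CliffordAlgebra.contractLeft (Q := (0 : QuadraticForm ℂ V)) l

theorem contractL_ι_mul (l : Module.Dual ℂ V) (v : V) (m : ExteriorAlgebra ℂ V) :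
    contractL l (ι ℂ v * m) = l v • m - ι ℂ v * contractL l m :=
  CliffordAlgebra.contractLeft_ι_mul (Q := (0 : QuadraticForm ℂ V)) l v m

theorem contractL_algebraMap (l : Module.Dual ℂ V) (r : ℂ) :
    contractL l (algebraMap ℂ (ExteriorAlgebra ℂ V) r) = 0 :=
  CliffordAlgebra.contractLeft_algebraMap (Q := (0 : QuadraticForm ℂ V)) l r

theorem exterior_left_induction {C : ExteriorAlgebra ℂ V → Prop}
    (algebraMap : ∀ r : ℂ, C (algebraMap ℂ _ r)) (add : ∀ x y, C x → C y → C (x + y))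
    (ι_mul : ∀ x v, C x → C (ι ℂ v * x)) (x : ExteriorAlgebra ℂ V) : C x :=
  CliffordAlgebra.left_induction (0 : QuadraticForm ℂ V) (P := C) algebraMap add ι_mul x

theorem exists_algebraMap_eq (a : ⋀[ℂ]^0 V) :
    ∃ r : ℂ, algebraMap ℂ _ r = (a : ExteriorAlgebra ℂ V) := by
  have h : (a : ExteriorAlgebra ℂ V) ∈ LinearMap.range (ι ℂ : V →ₗ[ℂ] ExteriorAlgebra ℂ V) ^ 0 := a.2
  rw [Submodule.pow_zero] at h
  exact Submodule.mem_one.1 h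

theorem coe_wedgeLeft (p : ℕ) (v : V) (a : ⋀[ℂ]^p V) :
    (wedgeLeft p v a : ExteriorAlgebra ℂ V) = ι ℂ v * (a : ExteriorAlgebra ℂ V) := by
  have : (⋀[ℂ]^(p + 1) V).subtype ∘ₗ wedgeLeft p v =
      LinearMap.mulLeft ℂ (ι ℂ v) ∘ₗ (⋀[ℂ]^p V).subtype := by
    apply exteriorPower.linearMap_ext
    ext w
    simp [wedgeLeft]
  exact LinearMap.congr_fun this a

theorem wedgeLeft_ιMulti (p : ℕ) (v : V) (w : Fin p → V) :
    wedgeLeft p v (exteriorPower.ιMulti ℂ p w) =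
      exteriorPower.ιMulti ℂ (p + 1) (Fin.cons v w : Fin (p + 1) → V) := by
  simp only [wedgeLeft, exteriorPower.alternatingMapLinearEquiv_apply_ιMulti,
    AlternatingMap.curryLeft_apply_apply]
  rfl

theorem wedgeLeft_map (p : ℕ) (A : V →ₗ[ℂ] W) (v : V) (a : ⋀[ℂ]^p V) :
    exteriorPower.map (p + 1) A (wedgeLeft p v a) = wedgeLeft p (A v) (exteriorPower.map p A a) := by
  have : exteriorPower.map (p + 1) A ∘ₗ wedgeLeft p v =
      wedgeLeft p (A v) ∘ₗ exteriorPower.map p A := by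
    apply exteriorPower.linearMap_ext
    ext w
    simp [-exteriorPower.ιMulti_apply_coe, wedgeLeft_ιMulti]
    congr 2
    ext i
    refine Fin.cases ?_ (fun i => ?_) i <;> simp
  exact LinearMap.congr_fun this a

/-- The wedge product with a vector, as a bilinear map. -/
def wedgeBilin (p : ℕ) (V : Type*) [AddCommGroup V] [Module ℂ V] :
    V →ₗ[ℂ] ⋀[ℂ]^p V →ₗ[ℂ] ⋀[ℂ]^(p + 1) V where
  toFun v := wedgeLeft p v
  map_add' v w := by
    ext a; simp [coe_wedgeLeft, add_mul]
  map_smul' c v := by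
    ext a; simp [coe_wedgeLeft]

theorem exteriorPower_induction {p : ℕ} {C : ⋀[ℂ]^p V → Prop} (zero : C 0)
    (add : ∀ a b, C a → C b → C (a + b)) (smul : ∀ (c : ℂ) a, C a → C (c • a))
    (mk : ∀ v : Fin p → V, C (exteriorPower.ιMulti ℂ p v)) (a : ⋀[ℂ]^p V) : C a := by
  have ha : a ∈ Submodule.span ℂ (Set.range (exteriorPower.ιMulti ℂ p (M := V))) := by
    rw [exteriorPower.ιMulti_span]; trivial
  induction ha using Submodule.span_induction with
  | mem x hx => obtain ⟨v, rfl⟩ := hx; exact mk v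
  | zero => exact zero
  | add x y _ _ hx hy => exact add x y hx hy
  | smul c x _ hx => exact smul c x hx

theorem exteriorPower_succ_induction {p : ℕ} {C : ⋀[ℂ]^(p + 1) V → Prop} (zero : C 0)
    (add : ∀ a b, C a → C b → C (a + b))
    (wedge : ∀ (v : V) (a : ⋀[ℂ]^p V), C (wedgeLeft p v a)) (a : ⋀[ℂ]^(p + 1) V) : C a := by
  suffices h : ∀ c : ℂ, C (c • a) by simpa using h 1
  refine exteriorPower_induction (C := fun a => ∀ c : ℂ, C (c • a)) (by simpa using zero)
    (fun a b ha hb c => by rw [smul_add]; exact add _ _ (ha c) (hb c))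
    (fun d a ha c => by rw [smul_smul]; exact ha _) (fun v c => ?_) a
  have : exteriorPower.ιMulti ℂ (p + 1) v =
      wedgeLeft p (v 0) (exteriorPower.ιMulti ℂ p (Fin.tail v)) := by
    rw [wedgeLeft_ιMulti, Fin.cons_self_tail]
  rw [this, ← map_smul]
  exact wedge _ _

/-- The interior product `Λ^{p+1} V → Λ^p V` with a covector, which goes into the first slot. -/
def interior (p : ℕ) (l : Module.Dual ℂ V) : ⋀[ℂ]^(p + 1) V →ₗ[ℂ] ⋀[ℂ]^p V :=
  exteriorPower.alternatingMapLinearEquiv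
    (AlternatingMap.alternatizeUncurryFin (l.smulRight (exteriorPower.ιMulti ℂ p)))

theorem interior_ιMulti (p : ℕ) (l : Module.Dual ℂ V) (v : Fin (p + 1) → V) :
    interior p l (exteriorPower.ιMulti ℂ (p + 1) v) =
      ∑ i : Fin (p + 1), (-1 : ℂ) ^ (i : ℕ) • l (v i) •
        exteriorPower.ιMulti ℂ p (i.removeNth v) := by
  rw [interior, exteriorPower.alternatingMapLinearEquiv_apply_ιMulti,
    AlternatingMap.alternatizeUncurryFin_apply]
  refine Finset.sum_congr rfl fun i _ => ?_
  simp only [LinearMap.smulRight_apply, AlternatingMap.smul_apply]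
  rcases Nat.even_or_odd (i : ℕ) with h | h
  · simp only [h.neg_one_pow, one_smul]
  · simp only [h.neg_one_pow]
    rw [neg_one_smul]
    exact (neg_one_smul ℂ (l (v i) • exteriorPower.ιMulti ℂ p (i.removeNth v))).symm

/-- Iterating the antiderivation rule moves the covector through the factors and produces the
alternating signs. It identifies the determinant-style `interior` with contraction in the exterior
algebra. -/
theorem contractL_ιMulti (p : ℕ) (l : Module.Dual ℂ V) (v : Fin (p + 1) → V) :
    contractL l (ιMulti ℂ (p + 1) v) =
      ∑ i : Fin (p + 1), (-1 : ℂ) ^ (i : ℕ) • l (v i) • ιMulti ℂ p (i.removeNth v) := by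
  induction p with
  | zero =>
    rw [ιMulti_succ_apply, contractL_ι_mul, ιMulti_zero_apply, ← map_one (algebraMap ℂ _),
      contractL_algebraMap]
    simp
  | succ p ih =>
    rw [ιMulti_succ_apply]
    rw [contractL_ι_mul]
    rw [show Matrix.vecTail v = Fin.tail v from rfl, ih (Fin.tail v), Fin.sum_univ_succ (n := p + 1),
      sub_eq_add_neg, Finset.mul_sum, ← Finset.sum_neg_distrib]
    congr 1
    · simp [Fin.removeNth_zero]
    · refine Finset.sum_congr rfl fun i _ => ?_
      have : ιMulti ℂ (p + 1) (i.succ.removeNth v) =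
          ι ℂ (v 0) * ιMulti ℂ p (i.removeNth (Fin.tail v)) := by
        rw [ιMulti_succ_apply]
        congr 2
        ext j
        simp [Matrix.vecTail, Fin.removeNth, Fin.tail]
      rw [this]
      simp only [mul_smul_comm, Fin.val_succ, pow_succ, mul_neg, mul_one, neg_smul]
      rfl

theorem coe_interior (p : ℕ) (l : Module.Dual ℂ V) (a : ⋀[ℂ]^(p + 1) V) :
    (interior p l a : ExteriorAlgebra ℂ V) =
      contractL l (a : ExteriorAlgebra ℂ V) := by
  have : (⋀[ℂ]^p V).subtype ∘ₗ interior p l =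
      contractL l ∘ₗ
        (⋀[ℂ]^(p + 1) V).subtype := by
    apply exteriorPower.linearMap_ext
    ext v
    simp only [LinearMap.compAlternatingMap_apply, LinearMap.comp_apply, interior_ιMulti, map_sum,
      map_smul, Submodule.subtype_apply, exteriorPower.ιMulti_apply_coe]
    exact (contractL_ιMulti p l v).symm
  exact LinearMap.congr_fun this a

theorem contract_ι_mul (v : V) (m : ExteriorAlgebra ℂ V)
    (α : ExteriorAlgebra ℂ (Module.Dual ℂ V)) :
    contract (ι ℂ v * m) α = contractL (Module.Dual.eval ℂ V v) (contract m α) := by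
  rw [map_mul, Module.End.mul_apply, contract, lift_ι_apply]
  rfl

/-- The operators l ∧ and v ⌟ anticommute up to the scalar l(v). Moving l through the vectors of m
produces exactly the terms of l ⌟ m, and the term in which l reaches Ω vanishes by hypothesis. -/
theorem ι_mul_contract (l : Module.Dual ℂ V) (Ω : ExteriorAlgebra ℂ (Module.Dual ℂ V))
    (hΩ : ι ℂ l * Ω = 0) (m : ExteriorAlgebra ℂ V) :
    ι ℂ l * contract m Ω =
      contract (contractL l m) Ω := by
  induction m using exterior_left_induction with
  | algebraMap r =>
    rw [contractL_algebraMap]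
    rw [AlgHom.commutes]
    simp [hΩ]
  | add x y hx hy =>
    rw [map_add, LinearMap.add_apply, mul_add, hx, hy, map_add, map_add, LinearMap.add_apply]
  | ι_mul x v hx =>
    rw [contractL_ι_mul]
    have h1 := contractL_ι_mul (Module.Dual.eval ℂ V v) l (contract x Ω)
    rw [hx] at h1
    rw [map_sub, LinearMap.sub_apply, contract_ι_mul, contract_ι_mul, h1]
    simp

theorem ι_mul_top [Module.Finite ℂ V] {n : ℕ} (hn : Module.finrank ℂ V = n) (l : V)
    (Ω : ⋀[ℂ]^n V) : ι ℂ l * (Ω : ExteriorAlgebra ℂ V) = 0 := by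
  rw [← coe_wedgeLeft]
  have h0 : Module.finrank ℂ (⋀[ℂ]^(n + 1) V) = 0 := by
    rw [exteriorPower.finrank_eq, hn, Nat.choose_succ_self]
  have : Subsingleton (⋀[ℂ]^(n + 1) V) := Module.finrank_zero_iff.1 h0
  rw [Subsingleton.elim (wedgeLeft n l Ω) 0]
  rfl

/-- Euler's identity: ∑ⱼ bⱼ ∧ (bʲ ⌟ ·) is a derivation that fixes vectors, hence it counts the
degree. -/
theorem sum_ι_mul_contractLeft {I : Type*} [Fintype I] (b : Module.Basis I ℂ V) (p : ℕ)
    (a : ⋀[ℂ]^p V) :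
    ∑ j, ι ℂ (b j) * contractL (b.coord j)
      (a : ExteriorAlgebra ℂ V) = (p : ℂ) • (a : ExteriorAlgebra ℂ V) := by
  induction p with
  | zero =>
    obtain ⟨r, hr⟩ := exists_algebraMap_eq a
    rw [← hr]
    simp only [Nat.cast_zero, zero_smul]
    refine Finset.sum_eq_zero fun j _ => ?_
    rw [contractL_algebraMap]
    simp
  | succ p ih =>
    induction a using exteriorPower_succ_induction with
    | zero => simp
    | add a a' ha ha' =>
      simp only [Submodule.coe_add, map_add, mul_add, Finset.sum_add_distrib, ha, ha', smul_add]
    | wedge v a =>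
      rw [coe_wedgeLeft]
      have h1 : ∀ j, ι ℂ (b j) * contractL
          (b.coord j) (ι ℂ v * (a : ExteriorAlgebra ℂ V)) =
          ι ℂ (b.coord j v • b j) * (a : ExteriorAlgebra ℂ V) +
          ι ℂ v * (ι ℂ (b j) * contractL
            (b.coord j) (a : ExteriorAlgebra ℂ V)) := by
        intro j
        rw [contractL_ι_mul]
        rw [mul_sub, mul_smul_comm, map_smul, smul_mul_assoc, sub_eq_add_neg]
        congr 1
        rw [← mul_assoc, ← mul_assoc, ← neg_mul]
        congr 1
        rw [neg_eq_iff_add_eq_zero]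
        exact ι_add_mul_swap _ _
      simp only [h1, Finset.sum_add_distrib, ← Finset.sum_mul, ← Finset.mul_sum, ih a, ← map_sum]
      have h2 : ∑ j, b.coord j v • b j = v := b.sum_repr v
      rw [h2, mul_smul_comm, Nat.cast_succ, add_smul, one_smul, add_comm]

/-- In Euler's identity the left side vanishes, and the degree p + 1 is invertible in ℂ. -/
theorem eq_zero_of_interior [Module.Finite ℂ V] {p : ℕ} (a : ⋀[ℂ]^(p + 1) V)
    (h : ∀ l, interior p l a = 0) : a = 0 := by
  have h1 := sum_ι_mul_contractLeft (Module.finBasis ℂ V) (p + 1) a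
  simp only [← coe_interior, h, ZeroMemClass.coe_zero, mul_zero, Finset.sum_const_zero] at h1
  have h2 : ((p + 1 : ℕ) : ℂ) ≠ 0 := by exact_mod_cast Nat.succ_ne_zero p
  have := (smul_eq_zero.1 h1.symm).resolve_left h2
  exact Subtype.ext this

/-- If a ⌟ Ω = 0, then (l ⌟ a) ⌟ Ω = l ∧ (a ⌟ Ω) = 0 for every l, so induction on the degree kills
all l ⌟ a and hence a. In degree 0 contraction is scalar multiplication of Ω ≠ 0. -/
theorem contract_injective [Module.Finite ℂ V] {n : ℕ} (hn : Module.finrank ℂ V = n)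
    (Ω : ⋀[ℂ]^n (Module.Dual ℂ V)) (hΩ : Ω ≠ 0) (p : ℕ) (a : ⋀[ℂ]^p V)
    (h : contract (a : ExteriorAlgebra ℂ V) (Ω : ExteriorAlgebra ℂ (Module.Dual ℂ V)) = 0) :
    a = 0 := by
  have htop : ∀ l : Module.Dual ℂ V, ι ℂ l * (Ω : ExteriorAlgebra ℂ (Module.Dual ℂ V)) = 0 :=
    fun l => ι_mul_top (by rw [Subspace.dual_finrank_eq, hn]) l Ω
  induction p with
  | zero =>
    obtain ⟨r, hr⟩ := exists_algebraMap_eq a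
    rw [← hr, AlgHom.commutes, Module.algebraMap_end_apply] at h
    have hr0 : r = 0 := (smul_eq_zero.1 h).resolve_right fun h' => hΩ (Subtype.ext h')
    apply Subtype.ext
    rw [← hr, hr0, map_zero]; rfl
  | succ p ih =>
    refine eq_zero_of_interior a fun l => ih _ ?_
    rw [coe_interior, ← ι_mul_contract l _ (htop l), h, mul_zero]

/-- Contraction with A v after pullback by B evaluates covectors at B (A v) = v. Thus a left inverse
of A suffices for naturality. -/
theorem map_dual_contract (A : V →ₗ[ℂ] W) (B : W →ₗ[ℂ] V) (hBA : B ∘ₗ A = LinearMap.id)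
    (m : ExteriorAlgebra ℂ V) (α : ExteriorAlgebra ℂ (Module.Dual ℂ V)) :
    contract (ExteriorAlgebra.map A m) (ExteriorAlgebra.map B.dualMap α) =
      ExteriorAlgebra.map B.dualMap (contract m α) := by
  have key : ∀ (v : V) (β : ExteriorAlgebra ℂ (Module.Dual ℂ V)),
      contractL
        (Module.Dual.eval ℂ W (A v)) (ExteriorAlgebra.map B.dualMap β) =
      ExteriorAlgebra.map B.dualMap (contractL (Module.Dual.eval ℂ V v) β) := by
    intro v β
    induction β using exterior_left_induction with
    | algebraMap r =>
      rw [contractL_algebraMap, AlgHom.commutes, contractL_algebraMap, map_zero]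
    | add x y hx hy =>
      rw [map_add, map_add, hx, hy, map_add, map_add]
    | ι_mul x l hx =>
      rw [contractL_ι_mul]
      rw [map_mul, map_apply_ι, contractL_ι_mul, hx, map_sub, map_mul, map_apply_ι, map_smul]
      have : B (A v) = v := LinearMap.congr_fun hBA v
      simp [this]
  induction m using exterior_left_induction with
  | algebraMap r =>
    rw [AlgHom.commutes, AlgHom.commutes, AlgHom.commutes]
    simp
  | add x y hx hy =>
    rw [map_add, map_add, LinearMap.add_apply, hx, hy, map_add, LinearMap.add_apply, map_add]
  | ι_mul x v hx =>
    rw [map_mul, map_apply_ι, contract_ι_mul, hx, contract_ι_mul, key]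

theorem coe_exteriorPower_map (p : ℕ) (A : V →ₗ[ℂ] W) (a : ⋀[ℂ]^p V) :
    (exteriorPower.map p A a : ExteriorAlgebra ℂ W) =
      ExteriorAlgebra.map A (a : ExteriorAlgebra ℂ V) := by
  have : (⋀[ℂ]^p W).subtype ∘ₗ exteriorPower.map p A =
      (ExteriorAlgebra.map A).toLinearMap ∘ₗ (⋀[ℂ]^p V).subtype := by
    apply exteriorPower.linearMap_ext
    ext v
    simp only [LinearMap.compAlternatingMap_apply, LinearMap.comp_apply,
      exteriorPower.map_apply_ιMulti, Submodule.subtype_apply, exteriorPower.ιMulti_apply_coe,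
      AlgHom.toLinearMap_apply, ExteriorAlgebra.map_apply_ιMulti]
  exact LinearMap.congr_fun this a

theorem contractForm_tmul (p q : ℕ) {n : ℕ} (Ω : ⋀[ℂ]^n (Module.Dual ℂ V)) (a : ⋀[ℂ]^p V)
    (m : ⋀[ℂ]^q (CDual V)) : contractForm p q Ω (a ⊗ₜ m) =
      contract (a : ExteriorAlgebra ℂ V) (Ω : ExteriorAlgebra ℂ (Module.Dual ℂ V)) ⊗ₜ m := rfl

theorem contractForm_injective [Module.Finite ℂ V] {n : ℕ} (hn : Module.finrank ℂ V = n)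
    (Ω : ⋀[ℂ]^n (Module.Dual ℂ V)) (hΩ : Ω ≠ 0) (p q : ℕ) :
    Function.Injective (contractForm p q Ω) := by
  refine Module.Flat.rTensor_preserves_injective_linearMap (M := ⋀[ℂ]^q (CDual V)) _ ?_
  rw [← LinearMap.ker_eq_bot, LinearMap.ker_eq_bot']
  intro a ha
  exact contract_injective hn Ω hΩ p a ha

theorem contractForm_transport (p q : ℕ) {n : ℕ} (Ω : ⋀[ℂ]^n (Module.Dual ℂ V)) (A : V →ₗ[ℂ] W)
    (B : W →ₗ[ℂ] V) (hBA : B ∘ₗ A = LinearMap.id) (γ : PV p q V) :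
    MF.transport q B (contractForm p q Ω γ) =
      contractForm p q (exteriorPower.map n B.dualMap Ω) (PV.transport p q A B γ) := by
  induction γ using TensorProduct.induction_on with
  | zero => simp
  | add x y hx hy => simp only [map_add, hx, hy]
  | tmul a m =>
    simp only [PV.transport, TensorProduct.map_tmul, contractForm_tmul, MF.transport,
      coe_exteriorPower_map, map_dual_contract A B hBA]
    rfl

/-- Interior product with a covector in the polyvector part. -/
def PV.interior (p q : ℕ) (l : Module.Dual ℂ V) : PV (p + 1) q V →ₗ[ℂ] PV p q V :=
  TensorProduct.map (BK.interior p l) LinearMap.id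

/-- This makes Δ exist: each summand dz_j ∧ ∂_j(γ ⌟ Ω) of ∂ is again a contraction with Ω, now of a
polyvector of one degree less. -/
theorem wedge_contractForm [Module.Finite ℂ V] {n : ℕ} (hn : Module.finrank ℂ V = n)
    (p q : ℕ) (Ω : ⋀[ℂ]^n (Module.Dual ℂ V)) (l : Module.Dual ℂ V) (γ : PV (p + 1) q V) :
    TensorProduct.map (LinearMap.mulLeft ℂ (ι ℂ l)) LinearMap.id (contractForm (p + 1) q Ω γ) =
      contractForm p q Ω (PV.interior p q l γ) := by
  induction γ using TensorProduct.induction_on with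
  | zero => simp
  | add x y hx hy => simp only [map_add, hx, hy]
  | tmul a m =>
    simp only [PV.interior, TensorProduct.map_tmul, contractForm_tmul, LinearMap.mulLeft_apply,
      coe_interior]
    rw [ι_mul_contract l _ (ι_mul_top (by rw [Subspace.dual_finrank_eq, hn]) l Ω)]

theorem wedge_contractForm_zero [Module.Finite ℂ V] {n : ℕ} (hn : Module.finrank ℂ V = n)
    (q : ℕ) (Ω : ⋀[ℂ]^n (Module.Dual ℂ V)) (l : Module.Dual ℂ V) (γ : PV 0 q V) :
    TensorProduct.map (LinearMap.mulLeft ℂ (ι ℂ l)) LinearMap.id (contractForm 0 q Ω γ) = 0 := by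
  induction γ using TensorProduct.induction_on with
  | zero => simp
  | add x y hx hy => simp only [map_add, hx, hy, add_zero]
  | tmul a m =>
    obtain ⟨r, hr⟩ := exists_algebraMap_eq a
    simp only [TensorProduct.map_tmul, contractForm_tmul, LinearMap.mulLeft_apply]
    rw [← hr, AlgHom.commutes, Module.algebraMap_end_apply, mul_smul_comm,
      ι_mul_top (by rw [Subspace.dual_finrank_eq, hn]) l Ω, smul_zero, TensorProduct.zero_tmul]

end ExteriorLemmas

/-! ### The natural pairing of `Λ^p V̄^* ⊗ Λ^q V` and `Λ^p V ⊗ Λ^q V̄^*` -/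

section Pairing

variable {V W : Type*} [AddCommGroup V] [Module ℂ V] [AddCommGroup W] [Module ℂ W]
variable {V₁ V₂ V₃ V₄ : Type*} [AddCommGroup V₁] [Module ℂ V₁] [AddCommGroup V₂] [Module ℂ V₂]
  [AddCommGroup V₃] [Module ℂ V₃] [AddCommGroup V₄] [Module ℂ V₄]

theorem extTensor_induction {p q : ℕ} {C : ⋀[ℂ]^p V₁ ⊗[ℂ] ⋀[ℂ]^q V₂ → Prop} (zero : C 0)
    (add : ∀ a b, C a → C b → C (a + b)) (smul : ∀ (c : ℂ) a, C a → C (c • a))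
    (mk : ∀ (v : Fin p → V₁) (w : Fin q → V₂),
      C (exteriorPower.ιMulti ℂ p v ⊗ₜ exteriorPower.ιMulti ℂ q w))
    (a : ⋀[ℂ]^p V₁ ⊗[ℂ] ⋀[ℂ]^q V₂) : C a := by
  induction a using TensorProduct.induction_on with
  | zero => exact zero
  | add x y hx hy => exact add x y hx hy
  | tmul a b =>
    induction a using exteriorPower_induction with
    | zero => simpa using zero
    | add x y hx hy => rw [TensorProduct.add_tmul]; exact add _ _ hx hy
    | smul c x hx => rw [← TensorProduct.smul_tmul']; exact smul _ _ hx
    | mk v =>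
      induction b using exteriorPower_induction with
      | zero => simpa using zero
      | add x y hx hy => rw [TensorProduct.tmul_add]; exact add _ _ hx hy
      | smul c x hx => rw [TensorProduct.tmul_smul]; exact smul _ _ hx
      | mk w => exact mk v w

theorem extTensor_sesq_ext {p q r s : ℕ}
    {S T : ⋀[ℂ]^p V₁ ⊗[ℂ] ⋀[ℂ]^q V₂ →ₗ[ℂ] ⋀[ℂ]^r V₃ ⊗[ℂ] ⋀[ℂ]^s V₄ →ₗ⋆[ℂ] ℂ}
    (h : ∀ (v₁ : Fin p → V₁) (v₂ : Fin q → V₂) (v₃ : Fin r → V₃) (v₄ : Fin s → V₄),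
      S (exteriorPower.ιMulti ℂ p v₁ ⊗ₜ exteriorPower.ιMulti ℂ q v₂)
        (exteriorPower.ιMulti ℂ r v₃ ⊗ₜ exteriorPower.ιMulti ℂ s v₄) =
      T (exteriorPower.ιMulti ℂ p v₁ ⊗ₜ exteriorPower.ιMulti ℂ q v₂)
        (exteriorPower.ιMulti ℂ r v₃ ⊗ₜ exteriorPower.ιMulti ℂ s v₄)) : S = T := by
  refine LinearMap.ext fun a => LinearMap.ext fun g => ?_
  induction a using extTensor_induction with
  | zero => simp
  | add x y hx hy => simp only [map_add, LinearMap.add_apply, hx, hy]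
  | smul c x hx => simp only [map_smul, LinearMap.smul_apply, hx]
  | mk v₁ v₂ =>
    induction g using extTensor_induction with
    | zero => simp
    | add x y hx hy => simp only [map_add, hx, hy]
    | smul c x hx => simp only [map_smulₛₗ, hx]
    | mk v₃ v₄ => exact h v₁ v₂ v₃ v₄

section Metric

variable [Module.Finite ℂ V] (B : V →ₗ[ℂ] V →ₗ⋆[ℂ] ℂ) (pos : ∀ u : V, u ≠ 0 → 0 < (B u u).re)

/-- The isomorphism `V ≃ V̄^*` of a positive definite form. -/
def flatOf : V ≃ₗ[ℂ] CDual V := LinearEquiv.ofBijective B (bijective_of_pos B pos)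

theorem flatOf_apply (v w : V) : flatOf B pos v w = B v w := rfl

/-- The induced isomorphism `Λ^p V ⊗ Λ^q V̄^* ≃ Λ^p V̄^* ⊗ Λ^q V`. -/
def fOf (p q : ℕ) : PV p q V ≃ₗ[ℂ] DF p q V :=
  TensorProduct.congr (extEquiv p (flatOf B pos)) (extEquiv q (flatOf B pos).symm)

/-- The induced form on `Λ^p V̄^* ⊗ Λ^q V`. -/
def dfFormOf (p q : ℕ) : DF p q V →ₗ[ℂ] DF p q V →ₗ⋆[ℂ] ℂ :=
  tensorForm (extForm p ((B.compl₂ (flatOf B pos).symm.toLinearMap).comp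
    (flatOf B pos).symm.toLinearMap)) (extForm q B)

/-- The isomorphism f cancels the inverse isomorphisms hidden in the dual metric and in B(w, ·), so
only evaluations of covectors on vectors are left and B drops out. Hermitian symmetry accounts for
the conjugate in the second determinant. -/
theorem dfFormOf_fOf_ιMulti (symm : ∀ u v : V, conj (B u v) = B v u) (p q : ℕ) (l : Fin p → CDual V) (w : Fin q → V) (v : Fin p → V)
    (m : Fin q → CDual V) :
    dfFormOf B pos p q (exteriorPower.ιMulti ℂ p l ⊗ₜ exteriorPower.ιMulti ℂ q w)
      (fOf B pos p q (exteriorPower.ιMulti ℂ p v ⊗ₜ exteriorPower.ιMulti ℂ q m)) =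
    (Matrix.of fun i j => l i (v j)).det * (Matrix.of fun i j => conj (m j (w i))).det := by
  have h1 : fOf B pos p q (exteriorPower.ιMulti ℂ p v ⊗ₜ exteriorPower.ιMulti ℂ q m) =
      exteriorPower.ιMulti ℂ p (fun i => flatOf B pos (v i)) ⊗ₜ
        exteriorPower.ιMulti ℂ q (fun i => (flatOf B pos).symm (m i)) := by
    rw [fOf, TensorProduct.congr_tmul]
    exact congrArg₂ _ (exteriorPower.map_apply_ιMulti _ _) (exteriorPower.map_apply_ιMulti _ _)
  rw [h1, dfFormOf, tensorForm_tmul, extForm_ιMulti, extForm_ιMulti]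
  congr 3
  · ext i j
    simp only [LinearMap.comp_apply, LinearMap.compl₂_apply,
      LinearEquiv.coe_coe, LinearEquiv.symm_apply_apply]
    rw [← flatOf_apply B pos, LinearEquiv.apply_symm_apply]
  · ext i j
    rw [← symm, ← flatOf_apply B pos, LinearEquiv.apply_symm_apply]

end Metric

/-- The standard Hermitian form of `ℂ^n`. -/
def stdForm (n : ℕ) : (Fin n → ℂ) →ₗ[ℂ] (Fin n → ℂ) →ₗ⋆[ℂ] ℂ :=
  LinearMap.mk₂'ₛₗ (RingHom.id ℂ) (starRingEnd ℂ) (fun u v => ∑ i, u i * conj (v i))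
    (fun u u' v => by simp [add_mul, Finset.sum_add_distrib])
    (fun c u v => by simp [Finset.mul_sum, mul_assoc])
    (fun u v v' => by simp [mul_add, Finset.sum_add_distrib])
    (fun c u v => by simp [Finset.mul_sum, mul_left_comm])

theorem stdForm_apply (n : ℕ) (u v : Fin n → ℂ) : stdForm n u v = ∑ i, u i * conj (v i) := rfl

theorem stdForm_symm (n : ℕ) (u v : Fin n → ℂ) : conj (stdForm n u v) = stdForm n v u := by
  simp [stdForm_apply, mul_comm]

theorem stdForm_pos (n : ℕ) (u : Fin n → ℂ) (hu : u ≠ 0) : 0 < (stdForm n u u).re := by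
  obtain ⟨i, hi⟩ := Function.ne_iff.1 hu
  rw [stdForm_apply, Complex.re_sum]
  refine Finset.sum_pos' (fun j _ => ?_) ⟨i, Finset.mem_univ i, ?_⟩
  · rw [Complex.mul_conj, Complex.ofReal_re]; exact Complex.normSq_nonneg _
  · rw [Complex.mul_conj, Complex.ofReal_re]; exact Complex.normSq_pos.2 hi

/-- The natural sesquilinear pairing of `Λ^p V̄^* ⊗ Λ^q V` and `Λ^p V ⊗ Λ^q V̄^*` for `V = ℂ^n`. -/
def pairing (n p q : ℕ) : DF p q (Fin n → ℂ) →ₗ[ℂ] PV p q (Fin n → ℂ) →ₗ⋆[ℂ] ℂ :=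
  (dfFormOf (stdForm n) (stdForm_pos n) p q).compl₂ (fOf (stdForm n) (stdForm_pos n) p q).toLinearMap

/-- The right side no longer mentions the standard form, which served only to construct the pairing.
Every other positive Hermitian form leads to the same formula. -/
theorem pairing_ιMulti (n p q : ℕ) (l : Fin p → CDual (Fin n → ℂ)) (w : Fin q → Fin n → ℂ)
    (v : Fin p → Fin n → ℂ) (m : Fin q → CDual (Fin n → ℂ)) :
    pairing n p q (exteriorPower.ιMulti ℂ p l ⊗ₜ exteriorPower.ιMulti ℂ q w)
      (exteriorPower.ιMulti ℂ p v ⊗ₜ exteriorPower.ιMulti ℂ q m) =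
    (Matrix.of fun i j => l i (v j)).det * (Matrix.of fun i j => conj (m j (w i))).det :=
  dfFormOf_fOf_ιMulti (stdForm n) (stdForm_pos n) (stdForm_symm n) p q l w v m

theorem DF.transport_ιMulti (p q : ℕ) (A : V →ₗ[ℂ] W) (B : W →ₗ[ℂ] V) (l : Fin p → CDual V)
    (w : Fin q → V) : DF.transport p q A B
      (exteriorPower.ιMulti ℂ p l ⊗ₜ exteriorPower.ιMulti ℂ q w) =
    exteriorPower.ιMulti ℂ p (fun i => cpull B (l i)) ⊗ₜ
      exteriorPower.ιMulti ℂ q (fun i => A (w i)) := by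
  rw [DF.transport, TensorProduct.map_tmul, exteriorPower.map_apply_ιMulti,
    exteriorPower.map_apply_ιMulti]
  rfl

theorem PV.transport_ιMulti (p q : ℕ) (A : V →ₗ[ℂ] W) (B : W →ₗ[ℂ] V) (v : Fin p → V)
    (m : Fin q → CDual V) : PV.transport p q A B
      (exteriorPower.ιMulti ℂ p v ⊗ₜ exteriorPower.ιMulti ℂ q m) =
    exteriorPower.ιMulti ℂ p (fun i => A (v i)) ⊗ₜ
      exteriorPower.ιMulti ℂ q (fun i => cpull B (m i)) := by
  rw [PV.transport, TensorProduct.map_tmul, exteriorPower.map_apply_ιMulti,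
    exteriorPower.map_apply_ιMulti]
  rfl

/-- `⟨a, f g⟩` does not depend on the metric. -/
theorem dfFormOf_fOf_eq_pairing [Module.Finite ℂ V] (C : V →ₗ[ℂ] V →ₗ⋆[ℂ] ℂ)
    (symm : ∀ u v : V, conj (C u v) = C v u) (pos : ∀ u : V, u ≠ 0 → 0 < (C u u).re)
    {n : ℕ} (p q : ℕ) (A : V →ₗ[ℂ] (Fin n → ℂ)) (B : (Fin n → ℂ) →ₗ[ℂ] V)
    (hBA : B ∘ₗ A = LinearMap.id) (a : DF p q V) (g : PV p q V) :
    dfFormOf C pos p q a (fOf C pos p q g) =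
      pairing n p q (DF.transport p q A B a) (PV.transport p q A B g) := by
  have h : (dfFormOf C pos p q).compl₂ (fOf C pos p q).toLinearMap =
      ((pairing n p q).compl₂ (PV.transport p q A B)).comp (DF.transport p q A B) := by
    refine extTensor_sesq_ext fun l w v m => ?_
    simp only [LinearMap.compl₂_apply, LinearMap.comp_apply, LinearEquiv.coe_coe]
    rw [dfFormOf_fOf_ιMulti C pos symm, DF.transport_ιMulti, PV.transport_ιMulti, pairing_ιMulti]
    have h' : ∀ v, B (A v) = v := fun v => LinearMap.congr_fun hBA v
    simp [cpull, h']
  exact LinearMap.congr_fun (LinearMap.congr_fun h a) g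

theorem PV.interior_ιMulti (p q : ℕ) (l : Module.Dual ℂ V) (v : Fin (p + 1) → V)
    (m : Fin q → CDual V) : PV.interior p q l
      (exteriorPower.ιMulti ℂ (p + 1) v ⊗ₜ exteriorPower.ιMulti ℂ q m) =
    ∑ i : Fin (p + 1), ((-1 : ℂ) ^ (i : ℕ) * l (v i)) •
      (exteriorPower.ιMulti ℂ p (i.removeNth v) ⊗ₜ exteriorPower.ιMulti ℂ q m) := by
  rw [PV.interior, TensorProduct.map_tmul, BK.interior_ιMulti, TensorProduct.sum_tmul]
  refine Finset.sum_congr rfl fun i _ => ?_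
  rw [TensorProduct.smul_tmul', smul_smul]
  rfl

/-- Wedge product with a conjugate covector is adjoint to the interior product. -/
theorem pairing_wedge (n p q : ℕ) (l : Module.Dual ℂ (Fin n → ℂ)) (a : DF p q (Fin n → ℂ))
    (g : PV (p + 1) q (Fin n → ℂ)) :
    pairing n (p + 1) q
      (TensorProduct.map (wedgeLeft p (conjDualEquiv _ l)) LinearMap.id a) g =
      pairing n p q a (PV.interior p q l g) := by
  have h : (pairing n (p + 1) q).comp
        (TensorProduct.map (wedgeLeft p (conjDualEquiv _ l)) LinearMap.id) =
      (pairing n p q).compl₂ (PV.interior p q l) := by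
    refine extTensor_sesq_ext fun c w v m => ?_
    simp only [LinearMap.compl₂_apply, LinearMap.comp_apply]
    -- The wedged covector is the first row of the enlarged determinant. Laplace expansion along
    -- this row is the alternating sum that defines the interior product.
    rw [PV.interior_ιMulti, TensorProduct.map_tmul, wedgeLeft_ιMulti, LinearMap.id_apply,
      pairing_ιMulti, map_sum, Matrix.det_succ_row_zero, Finset.sum_mul]
    refine Finset.sum_congr rfl fun j _ => ?_
    rw [map_smulₛₗ, pairing_ιMulti, smul_eq_mul]
    simp only [map_mul, map_pow, map_neg, map_one, Matrix.of_apply, Fin.cons_zero, mul_assoc]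
    rfl
  exact LinearMap.congr_fun (LinearMap.congr_fun h a) g

/-- The basis `dz̄_j` of conjugate covectors. -/
def covecBarBasis (n : ℕ) : Module.Basis (Fin n) ℂ (CDual (Fin n → ℂ)) :=
  Module.Basis.ofEquivFun
    { toFun := fun l j => l (Pi.single j 1)
      map_add' := fun l m => by ext j; simp
      map_smul' := fun c l => by ext j; simp
      invFun := fun c => ∑ j, c j • covecBar j
      left_inv := fun l => by
        ext v
        conv_rhs => rw [pi_eq_sum_univ' v, map_sum]
        simp [covecBar, covec, conjDualEquiv, mul_comm]
      right_inv := fun c => by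
        ext j
        simp [covecBar, covec, conjDualEquiv, Pi.single_apply] }

/-- Pairing with wedges of the dual basis elements reads off the conjugated coordinates of g in the
product basis. -/
theorem eq_zero_of_pairing (n p q : ℕ) (g : PV p q (Fin n → ℂ))
    (h : ∀ a, pairing n p q a g = 0) : g = 0 := by
  let b := (Pi.basisFun ℂ (Fin n)).exteriorPower p
  let b' := (covecBarBasis n).exteriorPower q
  have key : ∀ s t (g : PV p q (Fin n → ℂ)), conj ((b.tensorProduct b').repr g (s, t)) =
      pairing n p q
        (exteriorPower.ιMulti ℂ p (fun i => covecBar (Set.powersetCard.ofFinEmbEquiv.symm s i)) ⊗ₜ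
        exteriorPower.ιMulti ℂ q
          (fun i => Pi.single (Set.powersetCard.ofFinEmbEquiv.symm t i) (1 : ℂ))) g := by
    intro s t g
    induction g using extTensor_induction with
    | zero => simp
    | add x y hx hy => simp only [map_add, Finsupp.add_apply, hx, hy]
    | smul c x hx => simp only [map_smul, map_smulₛₗ, Finsupp.smul_apply, smul_eq_mul, map_mul, hx]
    | mk v m =>
      rw [pairing_ιMulti, Module.Basis.tensorProduct_repr_tmul_apply, smul_eq_mul, mul_comm, map_mul,
        exteriorPower.basis_repr_apply, exteriorPower.basis_repr_apply,
        exteriorPower.ιMultiDual_apply_ιMulti, exteriorPower.ιMultiDual_apply_ιMulti,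
        RingHom.map_det, RingHom.map_det, ← Matrix.det_transpose]
      congr 1
      rw [← Matrix.det_transpose]
      rfl
  apply (b.tensorProduct b').repr.injective
  ext ⟨s, t⟩
  have := key s t g
  rw [h] at this
  simpa using this

end Pairing

/-! ### Families of linear maps and induced maps of exterior powers -/

section Families

variable {n : ℕ}
variable {F G H : Type*} [AddCommGroup F] [Module ℂ F] [AddCommGroup G] [Module ℂ G]
  [AddCommGroup H] [Module ℂ H] [Module.Finite ℂ F] [Module.Finite ℂ G] [Module.Finite ℂ H]

theorem hom_eq_sum (T : F →ₗ[ℂ] G) :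
    T = ∑ i, LinearMap.smulRightₗ ((Module.finBasis ℂ F).coord i) (T (Module.finBasis ℂ F i)) := by
  refine (Module.finBasis ℂ F).ext fun j => ?_
  simp [Finsupp.single_apply]

theorem smoothOn_hom {T : (Fin n → ℂ) → F →ₗ[ℂ] G} {U : Set (Fin n → ℂ)}
    (h : ∀ a, SmoothOn (fun y => T y a) U) : SmoothOn T U :=
  (SmoothOn.sum (s := Finset.univ) fun i _ => (h (Module.finBasis ℂ F i)).linC
    (LinearMap.smulRightₗ ((Module.finBasis ℂ F).coord i))).congr fun y _ => hom_eq_sum (T y)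

theorem diffAt_sum {E : Type*} [NormedAddCommGroup E] [NormedSpace ℝ E] {ι : Type*} {s : Finset ι}
    {f : ι → E → F} {y : E} (hf : ∀ i ∈ s, DiffAt (f i) y) :
    DiffAt (fun y' => ∑ i ∈ s, f i y') y := fun l => by
  simp only [map_sum]; exact DifferentiableAt.fun_sum fun i hi => hf i hi l

theorem diffAt_hom {T : (Fin n → ℂ) → F →ₗ[ℂ] G} {y : Fin n → ℂ}
    (h : ∀ a, DiffAt (fun y => T y a) y) : DiffAt T y :=
  (diffAt_sum (s := Finset.univ) fun i _ => (h (Module.finBasis ℂ F i)).linC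
    (LinearMap.smulRightₗ ((Module.finBasis ℂ F).coord i))).congr
      (Filter.Eventually.of_forall fun y => hom_eq_sum (T y))

theorem SmoothOn.apply_const {T : (Fin n → ℂ) → F →ₗ[ℂ] G} {U : Set (Fin n → ℂ)}
    (h : SmoothOn T U) (a : F) : SmoothOn (fun y => T y a) U :=
  h.linC (LinearMap.applyₗ a)

theorem SmoothOn.apply {T : (Fin n → ℂ) → F →ₗ[ℂ] G} {g : (Fin n → ℂ) → F} {U : Set (Fin n → ℂ)}
    (h : SmoothOn T U) (hg : SmoothOn g U) : SmoothOn (fun y => T y (g y)) U :=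
  h.bilinC hg LinearMap.id

/-- Conjugate-linear dependence of the pullback of conjugate covectors on the map. -/
def cpullReal (V W : Type*) [AddCommGroup V] [Module ℂ V] [AddCommGroup W] [Module ℂ W] :
    (V →ₗ[ℂ] W) →ₗ[ℝ] (CDual W →ₗ[ℂ] CDual V) where
  toFun A := cpull A
  map_add' A B := by ext l v; simp [cpull]
  map_smul' c A := by ext l v; simp [cpull, ← Complex.coe_smul]

theorem SmoothOn.cpull {A : (Fin n → ℂ) → F →ₗ[ℂ] G} {U : Set (Fin n → ℂ)}
    (hA : SmoothOn A U) : SmoothOn (fun y => cpull (A y)) U :=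
  hA.linear (cpullReal F G)

/-- Induction along v ∧ a ↦ A v ∧ Λᵖ A (a) leaves only the product rule. On Λ⁰ the induced map does
not depend on A, so it may be compared with the one of the zero map. -/
theorem SmoothOn.exteriorPower_map {A : (Fin n → ℂ) → F →ₗ[ℂ] G} {U : Set (Fin n → ℂ)}
    (hA : SmoothOn A U) (p : ℕ) : SmoothOn (fun y => exteriorPower.map p (A y)) U := by
  induction p with
  | zero =>
    refine smoothOn_hom fun a => ?_
    have : ∀ y, exteriorPower.map 0 (A y) a = exteriorPower.map 0 (0 : F →ₗ[ℂ] G) a := by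
      intro y
      have : exteriorPower.map 0 (A y) = exteriorPower.map 0 (0 : F →ₗ[ℂ] G) := by
        apply exteriorPower.linearMap_ext
        ext v
        simp [exteriorPower.map_apply_ιMulti]
      rw [this]
    simp only [this]
    exact smoothOn_const _ _
  | succ p ih =>
    refine smoothOn_hom fun a => ?_
    induction a using exteriorPower_succ_induction with
    | zero => simp only [map_zero]; exact smoothOn_const _ _
    | add a b ha hb => simp only [map_add]; exact ha.add hb
    | wedge v a =>
      simp only [wedgeLeft_map]
      exact (hA.apply_const v).bilinC (ih.apply_const a) (wedgeBilin p G)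

theorem SmoothOn.tensor_map {F' G' : Type*} [AddCommGroup F'] [Module ℂ F'] [AddCommGroup G']
    [Module ℂ G'] [Module.Finite ℂ F'] [Module.Finite ℂ G'] {A : (Fin n → ℂ) → F →ₗ[ℂ] G}
    {B : (Fin n → ℂ) → F' →ₗ[ℂ] G'} {U : Set (Fin n → ℂ)} (hA : SmoothOn A U)
    (hB : SmoothOn B U) : SmoothOn (fun y => TensorProduct.map (A y) (B y)) U :=
  hA.bilinC hB (TensorProduct.mapBilinear (RingHom.id ℂ) F F' G G')

theorem SmoothOn.tensor_map_apply {F' G' : Type*} [AddCommGroup F'] [Module ℂ F'] [AddCommGroup G']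
    [Module ℂ G'] [Module.Finite ℂ F'] [Module.Finite ℂ G'] {A : (Fin n → ℂ) → F →ₗ[ℂ] G}
    {B : (Fin n → ℂ) → F' →ₗ[ℂ] G'} {τ : (Fin n → ℂ) → F ⊗[ℂ] F'} {U : Set (Fin n → ℂ)}
    (hA : SmoothOn A U) (hB : SmoothOn B U) (hτ : SmoothOn τ U) :
    SmoothOn (fun y => TensorProduct.map (A y) (B y) (τ y)) U :=
  (hA.tensor_map hB).apply hτ

theorem SmoothOn.df_transport {A : (Fin n → ℂ) → F →ₗ[ℂ] G} {B : (Fin n → ℂ) → G →ₗ[ℂ] F}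
    {p q : ℕ} {τ : (Fin n → ℂ) → DF p q F} {U : Set (Fin n → ℂ)} (hA : SmoothOn A U)
    (hB : SmoothOn B U) (hτ : SmoothOn τ U) :
    SmoothOn (fun y => DF.transport p q (A y) (B y) (τ y)) U :=
  (hB.cpull.exteriorPower_map p).tensor_map_apply (hA.exteriorPower_map q) hτ

/-- The Wirtinger type derivative `(∂_v + s ∂_{iv}) / 2`. -/
def wirt (s : ℂ) (g : (Fin n → ℂ) → F) (y v : Fin n → ℂ) : F :=
  (2⁻¹ : ℂ) • (dirVec g y v + s • dirVec g y (Complex.I • v))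

/-- With s = -i for ∂ and s = i for ∂̄, one computation proves that both operators are independent
of charts. -/
theorem delDir_eq_wirt (g : (Fin n → ℂ) → F) (y v : Fin n → ℂ) :
    delDir g y v = wirt (-Complex.I) g y v := by
  simp [delDir, wirt, sub_eq_add_neg]

theorem dbarDir_eq_wirt (g : (Fin n → ℂ) → F) (y v : Fin n → ℂ) :
    dbarDir g y v = wirt Complex.I g y v := rfl

variable {s : ℂ} {y : Fin n → ℂ}

theorem wirt_const (c : F) (v : Fin n → ℂ) : wirt s (fun _ => c) y v = 0 := by
  simp [wirt, dirVec_const]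

theorem wirt_linC {g : (Fin n → ℂ) → F} (hg : DiffAt g y) (L : F →ₗ[ℂ] G) (v : Fin n → ℂ) :
    wirt s (fun y' => L (g y')) y v = L (wirt s g y v) := by
  simp only [wirt, dirVec_linC hg, map_smul, map_add]

theorem wirt_add {f g : (Fin n → ℂ) → F} (hf : DiffAt f y) (hg : DiffAt g y) (v : Fin n → ℂ) :
    wirt s (fun y' => f y' + g y') y v = wirt s f y v + wirt s g y v := by
  simp only [wirt, dirVec_add hf hg]
  module

theorem wirt_bilinC {f : (Fin n → ℂ) → F} {g : (Fin n → ℂ) → G}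
    (hf : DiffAt f y) (hg : DiffAt g y) (b : F →ₗ[ℂ] G →ₗ[ℂ] H) (v : Fin n → ℂ) :
    wirt s (fun y' => b (f y') (g y')) y v =
      b (wirt s f y v) (g y) + b (f y) (wirt s g y v) := by
  simp only [wirt, dirVec_bilinC hf hg, map_smul, map_add, LinearMap.smul_apply,
    LinearMap.add_apply]
  module

theorem wirt_congr {f g : (Fin n → ℂ) → F} (h : g =ᶠ[nhds y] f) (v : Fin n → ℂ) :
    wirt s g y v = wirt s f y v := by
  simp only [wirt, dirVec_congr h]

/-- The differential of a holomorphic ψ commutes with i, so composition with ψ preserves the type of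
the derivative. -/
theorem wirt_comp {n' : ℕ} {g : (Fin n → ℂ) → F} {ψ : (Fin n' → ℂ) → (Fin n → ℂ)} {z : Fin n' → ℂ}
    (hg : DiffAt g (ψ z)) (hψ : DifferentiableAt ℂ ψ z) (v : Fin n' → ℂ) :
    wirt s (fun y' => g (ψ y')) z v = wirt s g (ψ z) (fderiv ℂ ψ z v) := by
  have h1 := hψ.restrictScalars ℝ
  simp only [wirt, dirVec_comp hg h1, hψ.fderiv_restrictScalars ℝ,
    ContinuousLinearMap.coe_restrictScalars', map_smul]

open ExteriorAlgebra

theorem diffAt_exteriorAlgebra_map {B : (Fin n → ℂ) → F →ₗ[ℂ] G} (hB : DiffAt B y)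
    (a : ExteriorAlgebra ℂ F) : DiffAt (fun y' => ExteriorAlgebra.map (B y') a) y := by
  induction a using exterior_left_induction with
  | algebraMap r => simp only [AlgHom.commutes]; exact diffAt_const _ _
  | add x y hx hy => simp only [map_add]; exact hx.add hy
  | ι_mul x u hx =>
    simp only [map_mul, map_apply_ι]
    exact ((hB.linC (LinearMap.applyₗ u)).linC (ι ℂ)).bilinC hx (LinearMap.mul ℂ _)

/-- A family of pullbacks `B` that is closed, `∑ⱼ cⱼ ∧ ∂ⱼ(B u) = 0`, induces closed pullbacks of
forms. -/
theorem sum_wedge_wirt_map {B : (Fin n → ℂ) → F →ₗ[ℂ] G} (hB : DiffAt B y) (c : Fin n → G)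
    (hc : ∀ u, ∑ j, ι ℂ (c j) * ι ℂ (wirt s B y (Pi.single j 1) u) = 0)
    (a : ExteriorAlgebra ℂ F) :
    ∑ j, ι ℂ (c j) * wirt s (fun y' => ExteriorAlgebra.map (B y') a) y (Pi.single j 1) = 0 := by
  induction a using exterior_left_induction with
  | algebraMap r => simp only [AlgHom.commutes, wirt_const, mul_zero, Finset.sum_const_zero]
  | add x z hx hz =>
    simp only [map_add, wirt_add (diffAt_exteriorAlgebra_map hB x)
      (diffAt_exteriorAlgebra_map hB z), mul_add, Finset.sum_add_distrib, hx, hz, add_zero]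
  | ι_mul x u hx =>
    have h1 : ∀ v, wirt s (fun y' => ExteriorAlgebra.map (B y') (ι ℂ u * x)) y v =
        ι ℂ (wirt s B y v u) * ExteriorAlgebra.map (B y) x +
          ι ℂ (B y u) * wirt s (fun y' => ExteriorAlgebra.map (B y') x) y v := by
      intro v
      have hBu : DiffAt (fun y' => ι ℂ (B y' u)) y := (hB.linC (LinearMap.applyₗ u)).linC (ι ℂ)
      have := wirt_bilinC (s := s) hBu (diffAt_exteriorAlgebra_map hB x) (LinearMap.mul ℂ _) v
      simp only [LinearMap.mul_apply'] at this
      simp only [map_mul, map_apply_ι, this]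
      congr 2
      have h2 := wirt_linC (s := s) hB (ι ℂ ∘ₗ LinearMap.applyₗ u) v
      exact h2
    simp only [h1, mul_add, Finset.sum_add_distrib, ← mul_assoc]
    rw [← Finset.sum_mul, hc u, zero_mul, zero_add]
    -- Moving c_j past B u costs a sign common to all j, and what remains is the sum for x, which
    -- vanishes by induction.
    have h3 : ∀ j, ι ℂ (c j) * ι ℂ (B y u) = -(ι ℂ (B y u) * ι ℂ (c j)) := fun j => by
      rw [eq_neg_iff_add_eq_zero]; exact ι_add_mul_swap _ _
    simp only [h3, neg_mul, mul_assoc, Finset.sum_neg_distrib, ← Finset.mul_sum, hx, mul_zero,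
      neg_zero]

variable {M M' : Type*} [AddCommGroup M] [Module ℂ M] [Module.Finite ℂ M] [AddCommGroup M']
  [Module ℂ M'] [Module.Finite ℂ M']

theorem wirt_tensor_map_apply {A : (Fin n → ℂ) → F →ₗ[ℂ] G}
    {B : (Fin n → ℂ) → M →ₗ[ℂ] M'} {τ : (Fin n → ℂ) → F ⊗[ℂ] M}
    (hA : DiffAt A y) (hB : DiffAt B y) (hτ : DiffAt τ y) (v : Fin n → ℂ) :
    wirt s (fun y => TensorProduct.map (A y) (B y) (τ y)) y v =
      TensorProduct.map (wirt s A y v) (B y) (τ y) + TensorProduct.map (A y) (wirt s B y v) (τ y) +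
      TensorProduct.map (A y) (B y) (wirt s τ y v) := by
  have h1 := wirt_bilinC (s := s) hA hB (TensorProduct.mapBilinear (RingHom.id ℂ) F M G M') v
  have h2 := wirt_bilinC (s := s) (hA.bilinC hB (TensorProduct.mapBilinear (RingHom.id ℂ) F M G M'))
    hτ LinearMap.id v
  rw [LinearMap.id_apply, LinearMap.id_apply, h1, LinearMap.add_apply] at h2
  exact h2

theorem diffAt_exteriorAlgebra_map_hom {B : (Fin n → ℂ) → F →ₗ[ℂ] G} (hB : DiffAt B y) :
    DiffAt (fun y' => (ExteriorAlgebra.map (B y')).toLinearMap) y :=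
  diffAt_hom fun a => diffAt_exteriorAlgebra_map hB a

theorem sum_wedge_wirt_map_tensor {B : (Fin n → ℂ) → F →ₗ[ℂ] G} (hB : DiffAt B y) (c : Fin n → G)
    (hc : ∀ u, ∑ j, ι ℂ (c j) * ι ℂ (wirt s B y (Pi.single j 1) u) = 0)
    (S : M →ₗ[ℂ] M') (τ : ExteriorAlgebra ℂ F ⊗[ℂ] M) :
    ∑ j, TensorProduct.map (LinearMap.mulLeft ℂ (ι ℂ (c j))) LinearMap.id
      (TensorProduct.map (wirt s (fun y' => (ExteriorAlgebra.map (B y')).toLinearMap) y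
        (Pi.single j 1)) S τ) = 0 := by
  induction τ using TensorProduct.induction_on with
  | zero => simp
  | add x y hx hy => simp only [map_add, Finset.sum_add_distrib, hx, hy, add_zero]
  | tmul a m =>
    have h1 : ∀ v, wirt s (fun y' => (ExteriorAlgebra.map (B y')).toLinearMap) y v a =
        wirt s (fun y' => ExteriorAlgebra.map (B y') a) y v := fun v =>
      (wirt_linC (s := s) (diffAt_exteriorAlgebra_map_hom hB) (LinearMap.applyₗ (R := ℂ) a) v).symm
    simp only [TensorProduct.map_tmul, h1, LinearMap.mulLeft_apply, LinearMap.id_apply]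
    rw [← TensorProduct.sum_tmul, sum_wedge_wirt_map hB c hc a, TensorProduct.zero_tmul]

/-- Exterior differentiation commutes with pullback along a holomorphic map. -/
theorem sum_wedge_wirt_pullback {n' : ℕ} {ψ : (Fin n → ℂ) → (Fin n' → ℂ)}
    (hψ : DifferentiableAt ℂ ψ y) {B : (Fin n → ℂ) → F →ₗ[ℂ] G} (hB : DiffAt B y)
    (c : Fin n → G) (c' : Fin n' → F)
    (hc : ∀ u, ∑ j, ι ℂ (c j) * ι ℂ (wirt s B y (Pi.single j 1) u) = 0)
    {S : (Fin n → ℂ) → M →ₗ[ℂ] M'} (hS : DiffAt S y) (hS0 : ∀ v, wirt s S y v = 0)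
    (a : Fin n → Fin n' → ℂ) (hBc : ∀ k, B y (c' k) = ∑ j, a j k • c j)
    (η : (Fin n' → ℂ) → ExteriorAlgebra ℂ F ⊗[ℂ] M) (hη : DiffAt η (ψ y))
    (ha : ∀ j, wirt s η (ψ y) (fderiv ℂ ψ y (Pi.single j 1)) =
      ∑ k, a j k • wirt s η (ψ y) (Pi.single k 1)) :
    ∑ j, TensorProduct.map (LinearMap.mulLeft ℂ (ι ℂ (c j))) LinearMap.id
      (wirt s (fun y' => TensorProduct.map (ExteriorAlgebra.map (B y')).toLinearMap (S y')
        (η (ψ y'))) y (Pi.single j 1)) =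
    TensorProduct.map (ExteriorAlgebra.map (B y)).toLinearMap (S y)
      (∑ k, TensorProduct.map (LinearMap.mulLeft ℂ (ι ℂ (c' k))) LinearMap.id
        (wirt s η (ψ y) (Pi.single k 1))) := by
  -- Leibniz rule for three factors: S is annihilated by this type of derivative. The term in which
  -- the pullback of forms is differentiated remains, and it cancels after wedging because B is
  -- closed.
  have h1 : ∀ v, wirt s (fun y' => TensorProduct.map (ExteriorAlgebra.map (B y')).toLinearMap (S y')
      (η (ψ y'))) y v = TensorProduct.map
        (wirt s (fun y' => (ExteriorAlgebra.map (B y')).toLinearMap) y v) (S y) (η (ψ y)) +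
      TensorProduct.map (ExteriorAlgebra.map (B y)).toLinearMap (S y)
        (wirt s η (ψ y) (fderiv ℂ ψ y v)) := by
    intro v
    have hcomp : DiffAt (fun y' => η (ψ y')) y := hη.comp (hψ.restrictScalars ℝ)
    rw [wirt_tensor_map_apply (diffAt_exteriorAlgebra_map_hom hB) hS hcomp, hS0, wirt_comp hη hψ,
      TensorProduct.map_zero_right, LinearMap.zero_apply, add_zero]
  simp only [h1, map_add, Finset.sum_add_distrib]
  rw [sum_wedge_wirt_map_tensor hB c hc, zero_add]
  have h2 : ∀ k (τ : ExteriorAlgebra ℂ F ⊗[ℂ] M),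
      TensorProduct.map (ExteriorAlgebra.map (B y)).toLinearMap (S y)
        (TensorProduct.map (LinearMap.mulLeft ℂ (ι ℂ (c' k))) LinearMap.id τ) =
      ∑ j, a j k • TensorProduct.map (LinearMap.mulLeft ℂ (ι ℂ (c j))) LinearMap.id
        (TensorProduct.map (ExteriorAlgebra.map (B y)).toLinearMap (S y) τ) := by
    intro k τ
    induction τ using TensorProduct.induction_on with
    | zero => simp
    | add x y hx hy => simp only [map_add, smul_add, Finset.sum_add_distrib, hx, hy]
    | tmul x m =>
      simp only [TensorProduct.map_tmul, LinearMap.mulLeft_apply, LinearMap.id_apply,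
        AlgHom.toLinearMap_apply, map_mul, map_apply_ι, hBc, map_sum, map_smul, Finset.sum_mul,
        TensorProduct.sum_tmul, smul_mul_assoc, TensorProduct.smul_tmul']
  simp only [map_sum, h2, ha, map_smul]
  rw [Finset.sum_comm]

end Families

/-! ### Transition functions, the operators `∂` and `∂̄` in arbitrary charts -/

section TransportLemmas

variable {V V' W : Type*} [AddCommGroup V] [Module ℂ V] [AddCommGroup V'] [Module ℂ V']
  [AddCommGroup W] [Module ℂ W]

theorem cpull_comp (A : V →ₗ[ℂ] V') (A' : V' →ₗ[ℂ] W) :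
    cpull (A' ∘ₗ A) = cpull A ∘ₗ cpull A' := rfl

theorem cpull_id : cpull (LinearMap.id : V →ₗ[ℂ] V) = LinearMap.id := rfl

theorem DF.transport_transport (p q : ℕ) (A : V →ₗ[ℂ] V') (B : V' →ₗ[ℂ] V) (A' : V' →ₗ[ℂ] W)
    (B' : W →ₗ[ℂ] V') (a : DF p q V) : DF.transport p q A' B' (DF.transport p q A B a) =
      DF.transport p q (A' ∘ₗ A) (B ∘ₗ B') a := by
  simp only [DF.transport]
  rw [cpull_comp, exteriorPower.map_comp, exteriorPower.map_comp, TensorProduct.map_comp]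
  rfl

theorem PV.transport_transport (p q : ℕ) (A : V →ₗ[ℂ] V') (B : V' →ₗ[ℂ] V) (A' : V' →ₗ[ℂ] W)
    (B' : W →ₗ[ℂ] V') (a : PV p q V) : PV.transport p q A' B' (PV.transport p q A B a) =
      PV.transport p q (A' ∘ₗ A) (B ∘ₗ B') a := by
  simp only [PV.transport]
  rw [cpull_comp, exteriorPower.map_comp, exteriorPower.map_comp, TensorProduct.map_comp]
  rfl

theorem MF.transport_transport (q : ℕ) (B : V' →ₗ[ℂ] V) (B' : W →ₗ[ℂ] V') (a : MF q V) :
    MF.transport q B' (MF.transport q B a) = MF.transport q (B ∘ₗ B') a := by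
  simp only [MF.transport]
  rw [cpull_comp, exteriorPower.map_comp, show (B ∘ₗ B').dualMap = B'.dualMap ∘ₗ B.dualMap from rfl,
    ← ExteriorAlgebra.map_comp_map, AlgHom.comp_toLinearMap, TensorProduct.map_comp]
  rfl

theorem DF.transport_id (p q : ℕ) (a : DF p q V) :
    DF.transport p q LinearMap.id LinearMap.id a = a := by
  simp [DF.transport, cpull_id]

theorem PV.transport_id (p q : ℕ) (a : PV p q V) :
    PV.transport p q LinearMap.id LinearMap.id a = a := by
  simp [PV.transport, cpull_id]

theorem MF.transport_id (q : ℕ) (a : MF q V) : MF.transport q LinearMap.id a = a := by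
  simp [MF.transport, cpull_id]

/-- The inclusion of `Λ^p V̄^* ⊗ Λ^q V` into `Λ^• V̄^* ⊗ Λ^q V`. -/
def DF.emb (p q : ℕ) (V : Type*) [AddCommGroup V] [Module ℂ V] :
    DF p q V →ₗ[ℂ] ExteriorAlgebra ℂ (CDual V) ⊗[ℂ] ⋀[ℂ]^q V :=
  TensorProduct.map (⋀[ℂ]^p (CDual V)).subtype LinearMap.id

/-- Identities for (0, p)-forms may be checked in the full exterior algebra. There dz̄_j ∧ is left
multiplication, and `sum_wedge_wirt_pullback` applies to ∂̄ as it does to ∂. -/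
theorem DF.emb_injective (p q : ℕ) : Function.Injective (DF.emb p q V) :=
  Module.Flat.rTensor_preserves_injective_linearMap (M := ⋀[ℂ]^q V) _
    (Submodule.subtype_injective _)

theorem DF.emb_transport (p q : ℕ) (A : V →ₗ[ℂ] W) (B : W →ₗ[ℂ] V) (a : DF p q V) :
    DF.emb p q W (DF.transport p q A B a) =
      TensorProduct.map (ExteriorAlgebra.map (cpull B)).toLinearMap (exteriorPower.map q A)
        (DF.emb p q V a) := by
  induction a using TensorProduct.induction_on with
  | zero => simp
  | add x y hx hy => simp only [map_add, hx, hy]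
  | tmul a m =>
    simp only [DF.emb, DF.transport, TensorProduct.map_tmul, Submodule.subtype_apply,
      coe_exteriorPower_map]
    rfl

theorem DF.emb_wedge (p q : ℕ) (l : CDual V) (a : DF p q V) :
    DF.emb (p + 1) q V (TensorProduct.map (wedgeLeft p l) LinearMap.id a) =
      TensorProduct.map (LinearMap.mulLeft ℂ (ExteriorAlgebra.ι ℂ l)) LinearMap.id
        (DF.emb p q V a) := by
  induction a using TensorProduct.induction_on with
  | zero => simp
  | add x y hx hy => simp only [map_add, hx, hy]
  | tmul a m =>
    simp only [DF.emb, TensorProduct.map_tmul, Submodule.subtype_apply, coe_wedgeLeft,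
      LinearMap.mulLeft_apply]

end TransportLemmas

/-! ### Coordinate covectors and derivatives of holomorphic maps -/

section CoordinateLemmas

variable {n : ℕ}

theorem sum_smul_single (v : Fin n → ℂ) : ∑ k, v k • (Pi.single k 1 : Fin n → ℂ) = v := by
  ext j; simp [Pi.single_apply]

theorem dual_eq_sum (u : Module.Dual ℂ (Fin n → ℂ)) :
    u = ∑ k, u (Pi.single k 1) • covec k := by
  ext j; simp [covec, Pi.single_apply]

theorem cdual_eq_sum (u : CDual (Fin n → ℂ)) :
    u = ∑ k, u (Pi.single k 1) • covecBar k := by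
  refine LinearMap.ext fun v => ?_
  conv_lhs => rw [← sum_smul_single v, map_sum]
  simp [covecBar, covec, conjDualEquiv, mul_comm]

/-- Symmetric coefficients against an antisymmetric product: exchanging the indices shows that the
sum equals its negative. It is applied to second derivatives of transition functions. -/
theorem sum_ι_mul_ι_of_symm {U : Type*} [AddCommGroup U] [Module ℂ U] (c : Fin n → U)
    (s : Fin n → Fin n → ℂ) (hs : ∀ j k, s j k = s k j) :
    ∑ j, ExteriorAlgebra.ι ℂ (c j) * ExteriorAlgebra.ι ℂ (∑ k, s j k • c k) = 0 := by
  have h1 : ∑ j, ExteriorAlgebra.ι ℂ (c j) * ExteriorAlgebra.ι ℂ (∑ k, s j k • c k) =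
      ∑ j, ∑ k, s j k • (ExteriorAlgebra.ι ℂ (c j) * ExteriorAlgebra.ι ℂ (c k)) := by
    simp only [map_sum, map_smul, Finset.mul_sum, mul_smul_comm]
  have h2 : ∑ j, ∑ k, s j k • (ExteriorAlgebra.ι ℂ (c j) * ExteriorAlgebra.ι ℂ (c k)) =
      -∑ j, ∑ k, s j k • (ExteriorAlgebra.ι ℂ (c j) * ExteriorAlgebra.ι ℂ (c k)) := by
    conv_lhs => rw [Finset.sum_comm]
    rw [← Finset.sum_neg_distrib]
    refine Finset.sum_congr rfl fun j _ => ?_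
    rw [← Finset.sum_neg_distrib]
    refine Finset.sum_congr rfl fun k _ => ?_
    rw [hs k j, ← smul_neg]
    congr 1
    rw [eq_neg_iff_add_eq_zero]
    exact ExteriorAlgebra.ι_add_mul_swap _ _
  rw [h1]
  rw [eq_neg_iff_add_eq_zero, ← two_smul ℂ] at h2
  exact (smul_eq_zero.1 h2).resolve_left two_ne_zero

variable {F : Type*} [AddCommGroup F] [Module ℂ F] [Module.Finite ℂ F]

theorem delDir_eq_sum (g : (Fin n → ℂ) → F) (y v : Fin n → ℂ) :
    delDir g y v = ∑ k, v k • delDir g y (Pi.single k 1) := by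
  let L : (Fin n → ℂ) →ₗ[ℂ] F :=
    { toFun := delDir g y
      map_add' := delDir_add_dir g
      map_smul' := delDir_smul_dir g }
  change L v = _
  conv_lhs => rw [← sum_smul_single v, map_sum]
  simp only [map_smul]
  rfl

theorem dbarDir_eq_sum (g : (Fin n → ℂ) → F) (y v : Fin n → ℂ) :
    dbarDir g y v = ∑ k, conj (v k) • dbarDir g y (Pi.single k 1) := by
  let L : (Fin n → ℂ) →ₗ⋆[ℂ] F :=
    { toFun := dbarDir g y
      map_add' := dbarDir_add_dir g
      map_smul' := dbarDir_smul_dir g }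
  change L v = _
  conv_lhs => rw [← sum_smul_single v, map_sum]
  simp only [map_smulₛₗ]
  rfl

/-- The complex derivative as a linear map. -/
def cderiv (ψ : (Fin n → ℂ) → (Fin n → ℂ)) (y : Fin n → ℂ) : (Fin n → ℂ) →ₗ[ℂ] (Fin n → ℂ) :=
  (fderiv ℂ ψ y).toLinearMap

theorem smoothOn_cderiv {ψ : (Fin n → ℂ) → (Fin n → ℂ)} {U : Set (Fin n → ℂ)} (hU : IsOpen U)
    (hψ : ContDiffOn ℂ ω ψ U) : SmoothOn (cderiv ψ) U := fun l => by
  have h1 : ContDiffOn ℂ ∞ (fderiv ℂ ψ) U := hψ.fderiv_of_isOpen hU (by simp)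
  let L : ((Fin n → ℂ) →L[ℂ] (Fin n → ℂ)) →L[ℂ] ℂ := LinearMap.toContinuousLinearMap
    (l ∘ₗ ContinuousLinearMap.coeLM ℂ)
  exact (L.contDiff.comp_contDiffOn h1).restrict_scalars ℝ

theorem dirVec_cderiv {ψ : (Fin n → ℂ) → (Fin n → ℂ)} {U : Set (Fin n → ℂ)} (hU : IsOpen U)
    (hψ : ContDiffOn ℂ ω ψ U) {y : Fin n → ℂ} (hy : y ∈ U) (v : Fin n → ℂ) :
    dirVec (cderiv ψ) y v = (fderiv ℂ (fderiv ℂ ψ) y v).toLinearMap := by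
  refine ((smoothOn_cderiv hU hψ).diffAt hU hy).dirVec_eq fun l => ?_
  have h1 : ContDiffOn ℂ ∞ (fderiv ℂ ψ) U := hψ.fderiv_of_isOpen hU (by simp)
  let L : ((Fin n → ℂ) →L[ℂ] (Fin n → ℂ)) →L[ℂ] ℂ := LinearMap.toContinuousLinearMap
    (l ∘ₗ ContinuousLinearMap.coeLM ℂ)
  have h2 : DifferentiableAt ℂ (fderiv ℂ ψ) y :=
    (h1.contDiffAt (hU.mem_nhds hy)).differentiableAt (by simp)
  have h3 : HasFDerivAt (fun y' => L (fderiv ℂ ψ y')) (L.comp (fderiv ℂ (fderiv ℂ ψ) y)) y :=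
    L.hasFDerivAt.comp y h2.hasFDerivAt
  exact congrArg (fun T => T v) (h3.restrictScalars ℝ).fderiv

theorem fderiv_fderiv_symm {ψ : (Fin n → ℂ) → (Fin n → ℂ)} {U : Set (Fin n → ℂ)} (hU : IsOpen U)
    (hψ : ContDiffOn ℂ ω ψ U) {y : Fin n → ℂ} (hy : y ∈ U) (v w : Fin n → ℂ) :
    fderiv ℂ (fderiv ℂ ψ) y v w = fderiv ℂ (fderiv ℂ ψ) y w v :=
  (hψ.contDiffAt (hU.mem_nhds hy)).isSymmSndFDerivAt (by simp) v w

theorem dbarDir_cderiv {ψ : (Fin n → ℂ) → (Fin n → ℂ)} {U : Set (Fin n → ℂ)} (hU : IsOpen U)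
    (hψ : ContDiffOn ℂ ω ψ U) {y : Fin n → ℂ} (hy : y ∈ U) (v : Fin n → ℂ) :
    dbarDir (cderiv ψ) y v = 0 := by
  rw [dbarDir, dirVec_cderiv hU hψ hy, dirVec_cderiv hU hψ hy, map_smul]
  ext1 w
  simp only [ContinuousLinearMap.toLinearMap_smul]
  rw [smul_smul, Complex.I_mul_I]
  simp

theorem delDir_cderiv {ψ : (Fin n → ℂ) → (Fin n → ℂ)} {U : Set (Fin n → ℂ)} (hU : IsOpen U)
    (hψ : ContDiffOn ℂ ω ψ U) {y : Fin n → ℂ} (hy : y ∈ U) (v w : Fin n → ℂ) :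
    delDir (cderiv ψ) y v w = fderiv ℂ (fderiv ℂ ψ) y v w := by
  rw [delDir, dirVec_cderiv hU hψ hy, dirVec_cderiv hU hψ hy, map_smul]
  simp only [LinearMap.smul_apply, LinearMap.sub_apply, ContinuousLinearMap.coe_coe,
    ContinuousLinearMap.toLinearMap_smul]
  rw [smul_smul, Complex.I_mul_I]
  module

/-- Pullback of conjugate covectors is conjugate-linear in the map. Thus a holomorphic Jacobian acts
antiholomorphically on T̄^*, and ∂ treats the transition matrices of Λ^q T̄^* as constants. -/
theorem delDir_cpull {A : (Fin n → ℂ) → F →ₗ[ℂ] F} {y : Fin n → ℂ} (hA : DiffAt A y)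
    (v : Fin n → ℂ) : delDir (fun y => cpull (A y)) y v = cpull (dbarDir A y v) := by
  have h : ∀ v, dirVec (fun y => cpull (A y)) y v = cpull (dirVec A y v) := fun v =>
    dirVec_comp_linear hA (cpullReal F F) v
  rw [delDir, dbarDir, h, h]
  ext l w
  simp [cpull, Complex.conj_ofNat]
  ring

theorem dbarDir_cpull {A : (Fin n → ℂ) → F →ₗ[ℂ] F} {y : Fin n → ℂ} (hA : DiffAt A y)
    (v : Fin n → ℂ) : dbarDir (fun y => cpull (A y)) y v = cpull (delDir A y v) := by
  have h : ∀ v, dirVec (fun y => cpull (A y)) y v = cpull (dirVec A y v) := fun v =>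
    dirVec_comp_linear hA (cpullReal F F) v
  rw [delDir, dbarDir, h, h]
  ext l w
  simp [cpull, Complex.conj_ofNat]
  ring

variable {G : Type*} [AddCommGroup G] [Module ℂ G] [Module.Finite ℂ G]

/-- By the Leibniz rule for v ∧ a ↦ A v ∧ Λᵖ A (a), a family killed by one type of derivative
induces such families on exterior powers. This handles the coefficient bundles Λ^q T̄^* (for ∂) and
Λ^q TX (for ∂̄). -/
theorem wirt_exteriorPower_map {s : ℂ} {A : (Fin n → ℂ) → F →ₗ[ℂ] G} {y : Fin n → ℂ}
    (hA : DiffAt A y) (h0 : ∀ v, wirt s A y v = 0) (p : ℕ) :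
    DiffAt (fun y => exteriorPower.map p (A y)) y ∧
      ∀ v, wirt s (fun y => exteriorPower.map p (A y)) y v = 0 := by
  suffices h : ∀ a : ⋀[ℂ]^p F, DiffAt (fun y => exteriorPower.map p (A y) a) y ∧
      ∀ v, wirt s (fun y => exteriorPower.map p (A y) a) y v = 0 by
    have hd : DiffAt (fun y => exteriorPower.map p (A y)) y := diffAt_hom fun a => (h a).1
    refine ⟨hd, fun v => LinearMap.ext fun a => ?_⟩
    rw [LinearMap.zero_apply, ← (h a).2 v]
    exact (wirt_linC (s := s) hd (LinearMap.applyₗ (R := ℂ) a) v).symm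
  induction p with
  | zero =>
    intro a
    have : ∀ y, exteriorPower.map 0 (A y) a = exteriorPower.map 0 (0 : F →ₗ[ℂ] G) a := by
      intro y
      have : exteriorPower.map 0 (A y) = exteriorPower.map 0 (0 : F →ₗ[ℂ] G) := by
        apply exteriorPower.linearMap_ext
        ext v
        simp
      rw [this]
    simp only [this]
    exact ⟨diffAt_const _ _, wirt_const _⟩
  | succ p ih =>
    intro a
    induction a using exteriorPower_succ_induction with
    | zero => simp only [map_zero]; exact ⟨diffAt_const _ _, wirt_const _⟩
    | add a b ha hb =>
      simp only [map_add]
      exact ⟨ha.1.add hb.1, fun v => by rw [wirt_add ha.1 hb.1, ha.2, hb.2, add_zero]⟩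
    | wedge u a =>
      simp only [wedgeLeft_map]
      have hu : DiffAt (fun y => A y u) y := hA.linC (LinearMap.applyₗ u)
      have hu0 : ∀ v, wirt s (fun y => A y u) y v = 0 := fun v => by
        rw [show wirt s (fun y => A y u) y v = (wirt s A y v) u from
          wirt_linC (s := s) hA (LinearMap.applyₗ (R := ℂ) u) v, h0, LinearMap.zero_apply]
      refine ⟨hu.bilinC (ih a).1 (wedgeBilin p G), fun v => ?_⟩
      have := wirt_bilinC (s := s) hu (ih a).1 (wedgeBilin p G) v
      rw [hu0, (ih a).2, map_zero, map_zero, LinearMap.zero_apply, add_zero] at this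
      exact this

end CoordinateLemmas

/-! ### Transition functions and differentials of charts -/

section Charts

variable {n : ℕ} {X : Type*} [TopologicalSpace X] [ChartedSpace (Fin n → ℂ) X]
  [IsManifold 𝓘(ℂ, Fin n → ℂ) ω X]

/-- The domain of the transition function `φ ∘ φ'⁻¹`. -/
def overlap (φ φ' : OpenPartialHomeomorph X (Fin n → ℂ)) : Set (Fin n → ℂ) :=
  (φ'.symm.trans φ).source

theorem mem_overlap {φ φ' : OpenPartialHomeomorph X (Fin n → ℂ)} {y : Fin n → ℂ} :
    y ∈ overlap φ φ' ↔ y ∈ φ'.target ∧ φ'.symm y ∈ φ.source := by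
  simp [overlap]

theorem isOpen_overlap (φ φ' : OpenPartialHomeomorph X (Fin n → ℂ)) : IsOpen (overlap φ φ') :=
  (φ'.symm.trans φ).open_source

variable {φ φ' : OpenPartialHomeomorph X (Fin n → ℂ)}

theorem contDiffOn_transition (hφ : φ ∈ atlas (Fin n → ℂ) X) (hφ' : φ' ∈ atlas (Fin n → ℂ) X) :
    ContDiffOn ℂ ω (fun y => φ (φ'.symm y)) (overlap φ φ') := by
  have h := HasGroupoid.compatible (G := contDiffGroupoid ω 𝓘(ℂ, Fin n → ℂ)) hφ' hφ
  have h' := (contDiffGroupoid ω 𝓘(ℂ, Fin n → ℂ)).mem_of_eqOnSource h (Setoid.refl _)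
  rw [contDiffGroupoid, mem_groupoid_of_pregroupoid] at h'
  have := h'.1
  simpa [contDiffPregroupoid, overlap, Function.comp_def] using this

/-- `dChartInv` is the total inverse, which is zero for a noninvertible map. On the source of an
atlas chart the differential is an isomorphism, so there it is a genuine inverse. -/
theorem dChartInv_comp_dChart (hφ : φ ∈ atlas (Fin n → ℂ) X) {x : X} (hx : x ∈ φ.source) :
    dChartInv φ x ∘ₗ dChart φ x = LinearMap.id := by
  have : IsManifold 𝓘(ℂ, Fin n → ℂ) 1 X := IsManifold.of_le (n := ω) (by simp)
  have h := mdifferentiable_of_mem_atlas (I := 𝓘(ℂ, Fin n → ℂ)) hφ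
  have h1 : mfderiv 𝓘(ℂ, Fin n → ℂ) 𝓘(ℂ, Fin n → ℂ) φ x = (h.mfderiv hx : _ →L[ℂ] _) := rfl
  ext1 v
  simp only [dChartInv, dChart, h1, ContinuousLinearMap.inverse_equiv]
  exact (h.mfderiv hx).symm_apply_apply v

theorem dChart_comp_dChartInv (hφ : φ ∈ atlas (Fin n → ℂ) X) {x : X} (hx : x ∈ φ.source) :
    dChart φ x ∘ₗ dChartInv φ x = LinearMap.id := by
  have : IsManifold 𝓘(ℂ, Fin n → ℂ) 1 X := IsManifold.of_le (n := ω) (by simp)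
  have h := mdifferentiable_of_mem_atlas (I := 𝓘(ℂ, Fin n → ℂ)) hφ
  have h1 : mfderiv 𝓘(ℂ, Fin n → ℂ) 𝓘(ℂ, Fin n → ℂ) φ x = (h.mfderiv hx : _ →L[ℂ] _) := rfl
  refine LinearMap.ext fun v => ?_
  simp only [dChartInv, dChart, h1, ContinuousLinearMap.inverse_equiv]
  exact (h.mfderiv hx).apply_symm_apply v

theorem dChart_comp_dChartInv_eq (hφ : φ ∈ atlas (Fin n → ℂ) X) (hφ' : φ' ∈ atlas (Fin n → ℂ) X)
    {y : Fin n → ℂ} (hy : y ∈ overlap φ φ') :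
    dChart φ (φ'.symm y) ∘ₗ dChartInv φ' (φ'.symm y) = cderiv (fun z => φ (φ'.symm z)) y := by
  have : IsManifold 𝓘(ℂ, Fin n → ℂ) 1 X := IsManifold.of_le (n := ω) (by simp)
  have h := mdifferentiable_of_mem_atlas (I := 𝓘(ℂ, Fin n → ℂ)) hφ
  have h' := mdifferentiable_of_mem_atlas (I := 𝓘(ℂ, Fin n → ℂ)) hφ'
  obtain ⟨hy1, hy2⟩ := mem_overlap.1 hy
  have e1 : mfderiv 𝓘(ℂ, Fin n → ℂ) 𝓘(ℂ, Fin n → ℂ) (φ ∘ φ'.symm) y =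
      (mfderiv 𝓘(ℂ, Fin n → ℂ) 𝓘(ℂ, Fin n → ℂ) φ (φ'.symm y)).comp
        (mfderiv 𝓘(ℂ, Fin n → ℂ) 𝓘(ℂ, Fin n → ℂ) φ'.symm y) :=
    mfderiv_comp y (h.mdifferentiableAt hy2) (h'.mdifferentiableAt_symm hy1)
  have e2 : (mfderiv 𝓘(ℂ, Fin n → ℂ) 𝓘(ℂ, Fin n → ℂ) φ'.symm y).toLinearMap =
      dChartInv φ' (φ'.symm y) := by
    have hs := φ'.map_target hy1
    have e3 := h'.comp_symm_deriv hy1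
    refine LinearMap.ext fun v => ?_
    have e4 := LinearMap.congr_fun (dChartInv_comp_dChart hφ' hs)
      (mfderiv 𝓘(ℂ, Fin n → ℂ) 𝓘(ℂ, Fin n → ℂ) φ'.symm y v)
    have e5 : dChart φ' (φ'.symm y) (mfderiv 𝓘(ℂ, Fin n → ℂ) 𝓘(ℂ, Fin n → ℂ) φ'.symm y v) = v :=
      congrArg (fun T => T v) e3
    simp only [LinearMap.comp_apply, LinearMap.id_apply] at e4
    rw [e5] at e4
    exact e4.symm
  rw [← e2]
  refine LinearMap.ext fun v => ?_
  have e6 := congrArg (fun T => T v) e1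
  rw [mfderiv_eq_fderiv] at e6
  exact e6.symm

end Charts

/-! ### The operators ∂ and ∂̄ computed in an arbitrary chart -/

section ChartInvariance

variable {n : ℕ} {X : Type*} [TopologicalSpace X] [ChartedSpace (Fin n → ℂ) X]
  [IsManifold 𝓘(ℂ, Fin n → ℂ) ω X]

variable {φ φ' : OpenPartialHomeomorph X (Fin n → ℂ)}

theorem dChart_comp_dChartInv_eq' (hφ : φ ∈ atlas (Fin n → ℂ) X)
    (hφ' : φ' ∈ atlas (Fin n → ℂ) X) {y : Fin n → ℂ} (hy : y ∈ overlap φ φ') :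
    dChart φ' (φ'.symm y) ∘ₗ dChartInv φ (φ'.symm y) =
      cderiv (fun z => φ' (φ.symm z)) (φ (φ'.symm y)) := by
  obtain ⟨hy1, hy2⟩ := mem_overlap.1 hy
  have h1 : φ (φ'.symm y) ∈ overlap φ' φ := by
    rw [mem_overlap, φ.left_inv hy2]
    exact ⟨φ.map_source hy2, φ'.map_target hy1⟩
  have h2 := dChart_comp_dChartInv_eq hφ' hφ h1
  rwa [φ.left_inv hy2] at h2

theorem transition_mem_overlap {y : Fin n → ℂ} (hy : y ∈ overlap φ φ') :
    φ (φ'.symm y) ∈ overlap φ' φ := by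
  obtain ⟨hy1, hy2⟩ := mem_overlap.1 hy
  rw [mem_overlap, φ.left_inv hy2]
  exact ⟨φ.map_source hy2, φ'.map_target hy1⟩

theorem DF.inChart_eq {p q : ℕ} (hφ : φ ∈ atlas (Fin n → ℂ) X) (hφ' : φ' ∈ atlas (Fin n → ℂ) X)
    (α : ∀ x : X, DF p q (TX n x)) {y : Fin n → ℂ} (hy : y ∈ overlap φ φ') :
    DF.inChart φ' α y = DF.transport p q (cderiv (fun z => φ' (φ.symm z)) (φ (φ'.symm y)))
      (cderiv (fun z => φ (φ'.symm z)) y) (DF.inChart φ α (φ (φ'.symm y))) := by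
  obtain ⟨hy1, hy2⟩ := mem_overlap.1 hy
  rw [← dChart_comp_dChartInv_eq hφ hφ' hy, ← dChart_comp_dChartInv_eq' hφ hφ' hy]
  simp only [DF.inChart]
  rw [φ.left_inv hy2, ← DF.transport_transport, DF.transport_transport p q (dChart φ (φ'.symm y)),
    dChartInv_comp_dChart hφ hy2, DF.transport_id]

theorem MF.inChart_eq {q : ℕ} (hφ : φ ∈ atlas (Fin n → ℂ) X) (hφ' : φ' ∈ atlas (Fin n → ℂ) X)
    (η : ∀ x : X, MF q (TX n x)) {y : Fin n → ℂ} (hy : y ∈ overlap φ φ') :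
    MF.inChart φ' η y = MF.transport q (cderiv (fun z => φ (φ'.symm z)) y)
      (MF.inChart φ η (φ (φ'.symm y))) := by
  obtain ⟨hy1, hy2⟩ := mem_overlap.1 hy
  rw [← dChart_comp_dChartInv_eq hφ hφ' hy]
  simp only [MF.inChart]
  rw [φ.left_inv hy2, ← MF.transport_transport, MF.transport_transport q (dChartInv φ (φ'.symm y)),
    dChartInv_comp_dChart hφ hy2, MF.transport_id]

/-- The coordinate expression of `∂`. -/
def delCoord {q : ℕ} (η : (Fin n → ℂ) → MF q (Fin n → ℂ)) (y : Fin n → ℂ) : MF q (Fin n → ℂ) :=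
  ∑ j : Fin n, TensorProduct.map (LinearMap.mulLeft ℂ (ExteriorAlgebra.ι ℂ (covec j)))
    LinearMap.id (delDir η y (Pi.single j 1))

/-- The coordinate expression of `∂̄`. -/
def dbarCoord {p q : ℕ} (α : (Fin n → ℂ) → DF p q (Fin n → ℂ)) (y : Fin n → ℂ) :
    DF (p + 1) q (Fin n → ℂ) :=
  ∑ j : Fin n, TensorProduct.map (wedgeLeft p (covecBar j)) LinearMap.id
    (dbarDir α y (Pi.single j 1))

theorem del_eq {q : ℕ} (η : ∀ x : X, MF q (TX n x)) (x : X) :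
    del η x = MF.transport q (dChart (chartAt (Fin n → ℂ) x) x)
      (delCoord (MF.inChart (chartAt (Fin n → ℂ) x) η) (chartAt (Fin n → ℂ) x x)) := by
  simp only [del, delCoord, dzVec_eq]

theorem dbar_eq {p q : ℕ} (α : ∀ x : X, DF p q (TX n x)) (x : X) :
    dbar α x = DF.transport (p + 1) q (dChartInv (chartAt (Fin n → ℂ) x) x)
      (dChart (chartAt (Fin n → ℂ) x) x)
      (dbarCoord (DF.inChart (chartAt (Fin n → ℂ) x) α) (chartAt (Fin n → ℂ) x x)) := by
  simp only [dbar, dbarCoord, dzbarVec_eq]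

theorem dualMap_covec (A : (Fin n → ℂ) →ₗ[ℂ] (Fin n → ℂ)) (k : Fin n) :
    A.dualMap (covec k) = ∑ j, A (Pi.single j 1) k • covec j := by
  conv_lhs => rw [dual_eq_sum (A.dualMap (covec k))]
  rfl

theorem cpull_covecBar (A : (Fin n → ℂ) →ₗ[ℂ] (Fin n → ℂ)) (k : Fin n) :
    cpull A (covecBar k) = ∑ j, conj (A (Pi.single j 1) k) • covecBar j := by
  conv_lhs => rw [cdual_eq_sum (cpull A (covecBar k))]
  rfl

/-- `∂` may be computed in any chart. -/
theorem inChart_del {q : ℕ} (hφ' : φ' ∈ atlas (Fin n → ℂ) X) (η : ∀ x : X, MF q (TX n x))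
    {y : Fin n → ℂ} (hy : y ∈ φ'.target)
    (hη : DiffAt (MF.inChart (chartAt (Fin n → ℂ) (φ'.symm y)) η)
      (chartAt (Fin n → ℂ) (φ'.symm y) (φ'.symm y))) :
    MF.inChart φ' (del η) y = delCoord (MF.inChart φ' η) y := by
  set x := φ'.symm y with hx
  set φ := chartAt (Fin n → ℂ) x with hφdef
  have hφ : φ ∈ atlas (Fin n → ℂ) X := chart_mem_atlas _ x
  have hyo : y ∈ overlap φ φ' := mem_overlap.2 ⟨hy, mem_chart_source _ x⟩
  have hU := isOpen_overlap φ φ'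
  set ψ : (Fin n → ℂ) → (Fin n → ℂ) := fun z => φ (φ'.symm z) with hψdef
  have hψ : ContDiffOn ℂ ω ψ (overlap φ φ') := contDiffOn_transition hφ hφ'
  have hψd : DifferentiableAt ℂ ψ y :=
    (hψ.contDiffAt (hU.mem_nhds hyo)).differentiableAt (by simp)
  have e1 : MF.inChart φ' (del η) y = MF.transport q (cderiv ψ y)
      (delCoord (MF.inChart φ η) (ψ y)) := by
    rw [← dChart_comp_dChartInv_eq hφ hφ' hyo, ← MF.transport_transport, MF.inChart, ← hx, del_eq]
  have hJ : DiffAt (cderiv ψ) y := (smoothOn_cderiv hU hψ).diffAt hU hyo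
  have hev : MF.inChart φ' η =ᶠ[nhds y] fun z => TensorProduct.map
      (ExteriorAlgebra.map (cderiv ψ z).dualMap).toLinearMap
      (exteriorPower.map q (cpull (cderiv ψ z))) (MF.inChart φ η (ψ z)) := by
    filter_upwards [hU.mem_nhds hyo] with z hz
    exact MF.inChart_eq hφ hφ' η hz
  have hB : DiffAt (fun z => (cderiv ψ z).dualMap) y := hJ.linC Module.Dual.transpose
  have hcJ : DiffAt (fun z => cpull (cderiv ψ z)) y := hJ.comp_linear (cpullReal _ _)
  have hcJ0 : ∀ v, wirt (-Complex.I) (fun z => cpull (cderiv ψ z)) y v = 0 := fun v => by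
    rw [← delDir_eq_wirt, delDir_cpull hJ, dbarDir_cderiv hU hψ hyo]
    exact map_zero (cpullReal _ _)
  obtain ⟨hS, hS0⟩ := wirt_exteriorPower_map hcJ hcJ0 q
  have key := sum_wedge_wirt_pullback (s := -Complex.I) hψd hB covec covec (fun u => ?_) hS hS0
    (fun j k => cderiv ψ y (Pi.single j 1) k) (fun k => dualMap_covec _ k)
    (MF.inChart φ η) hη (fun j => ?_)
  · rw [e1, MF.transport, delCoord, delCoord]
    simp only [delDir_congr hev]
    simp only [delDir_eq_wirt]
    exact key.symm
  -- Closedness of the pullback of forms: the ∂-derivative of ψ^* u has the second derivatives of ψ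
  -- as coefficients, and these are symmetric.
  · have h1 : ∀ v, wirt (-Complex.I) (fun z => (cderiv ψ z).dualMap) y v =
        (delDir (cderiv ψ) y v).dualMap := fun v => by
      rw [delDir_eq_wirt]
      exact wirt_linC (s := -Complex.I) hJ Module.Dual.transpose v
    have h2 : ∀ j, wirt (-Complex.I) (fun z => (cderiv ψ z).dualMap) y (Pi.single j 1) u =
        ∑ k, u (fderiv ℂ (fderiv ℂ ψ) y (Pi.single j 1) (Pi.single k 1)) • covec k := by
      intro j
      rw [h1, dual_eq_sum ((delDir (cderiv ψ) y (Pi.single j 1)).dualMap u)]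
      simp only [LinearMap.dualMap_apply, delDir_cderiv hU hψ hyo]
    simp only [h2]
    exact sum_ι_mul_ι_of_symm covec _ fun j k => by rw [fderiv_fderiv_symm hU hψ hyo]
  · rw [← delDir_eq_wirt, delDir_eq_sum]
    simp only [delDir_eq_wirt]
    rfl

/-- `∂̄` may be computed in any chart. -/
theorem inChart_dbar {p q : ℕ} (hφ' : φ' ∈ atlas (Fin n → ℂ) X) (α : ∀ x : X, DF p q (TX n x))
    {y : Fin n → ℂ} (hy : y ∈ φ'.target)
    (hα : DiffAt (DF.inChart (chartAt (Fin n → ℂ) (φ'.symm y)) α)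
      (chartAt (Fin n → ℂ) (φ'.symm y) (φ'.symm y))) (hα' : DiffAt (DF.inChart φ' α) y) :
    DF.inChart φ' (dbar α) y = dbarCoord (DF.inChart φ' α) y := by
  set x := φ'.symm y with hx
  set φ := chartAt (Fin n → ℂ) x with hφdef
  have hφ : φ ∈ atlas (Fin n → ℂ) X := chart_mem_atlas _ x
  have hyo : y ∈ overlap φ φ' := mem_overlap.2 ⟨hy, mem_chart_source _ x⟩
  have hU := isOpen_overlap φ φ'
  have hU' := isOpen_overlap φ' φ
  set ψ : (Fin n → ℂ) → (Fin n → ℂ) := fun z => φ (φ'.symm z) with hψdef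
  set χ : (Fin n → ℂ) → (Fin n → ℂ) := fun z => φ' (φ.symm z) with hχdef
  have hψ : ContDiffOn ℂ ω ψ (overlap φ φ') := contDiffOn_transition hφ hφ'
  have hχ : ContDiffOn ℂ ω χ (overlap φ' φ) := contDiffOn_transition hφ' hφ
  have hψd : DifferentiableAt ℂ ψ y :=
    (hψ.contDiffAt (hU.mem_nhds hyo)).differentiableAt (by simp)
  have hyo' : ψ y ∈ overlap φ' φ := transition_mem_overlap hyo
  have e1 : DF.inChart φ' (dbar α) y = DF.transport (p + 1) q (cderiv χ (ψ y)) (cderiv ψ y)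
      (dbarCoord (DF.inChart φ α) (ψ y)) := by
    rw [← dChart_comp_dChartInv_eq hφ hφ' hyo, ← dChart_comp_dChartInv_eq' hφ hφ' hyo,
      ← DF.transport_transport, DF.inChart, ← hx, dbar_eq]
  have hJ : DiffAt (cderiv ψ) y := (smoothOn_cderiv hU hψ).diffAt hU hyo
  have hK : DiffAt (cderiv χ) (ψ y) := (smoothOn_cderiv hU' hχ).diffAt hU' hyo'
  have hev : (fun z => DF.emb p q _ (DF.inChart φ' α z)) =ᶠ[nhds y] fun z => TensorProduct.map
      (ExteriorAlgebra.map (cpull (cderiv ψ z))).toLinearMap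
      (exteriorPower.map q (cderiv χ (ψ z))) (DF.emb p q _ (DF.inChart φ α (ψ z))) := by
    filter_upwards [hU.mem_nhds hyo] with z hz
    rw [DF.inChart_eq hφ hφ' α hz, DF.emb_transport]
  have hB : DiffAt (fun z => cpull (cderiv ψ z)) y := hJ.comp_linear (cpullReal _ _)
  have hKψ : DiffAt (fun z => cderiv χ (ψ z)) y := hK.comp (hψd.restrictScalars ℝ)
  -- The frames of Λ^q TX transform by the holomorphic Jacobian of the inverse transition, which ∂̄
  -- does not see.
  have hK0 : ∀ v, wirt Complex.I (fun z => cderiv χ (ψ z)) y v = 0 := fun v => by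
    rw [wirt_comp hK hψd, ← dbarDir_eq_wirt, dbarDir_cderiv hU' hχ hyo']
  obtain ⟨hS, hS0⟩ := wirt_exteriorPower_map hKψ hK0 q
  have hη : DiffAt (fun z => DF.emb p q _ (DF.inChart φ α z)) (ψ y) := hα.linC (DF.emb p q _)
  have key := sum_wedge_wirt_pullback (s := Complex.I) hψd hB covecBar covecBar (fun u => ?_) hS hS0
    (fun j k => conj (cderiv ψ y (Pi.single j 1) k)) (fun k => cpull_covecBar _ k)
    (fun z => DF.emb p q _ (DF.inChart φ α z)) hη (fun j => ?_)
  · apply DF.emb_injective (p + 1) q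
    rw [e1, DF.emb_transport, dbarCoord, dbarCoord]
    simp only [map_sum, DF.emb_wedge]
    have h3 : ∀ v, DF.emb p q _ (dbarDir (DF.inChart φ' α) y v) =
        wirt Complex.I (fun z => TensorProduct.map
          (ExteriorAlgebra.map (cpull (cderiv ψ z))).toLinearMap
          (exteriorPower.map q (cderiv χ (ψ z))) (DF.emb p q _ (DF.inChart φ α (ψ z)))) y v := by
      intro v
      rw [← wirt_congr hev, dbarDir_eq_wirt, wirt_linC hα' (DF.emb p q _)]
    have h4 : ∀ v, DF.emb p q _ (dbarDir (DF.inChart φ α) (ψ y) v) =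
        wirt Complex.I (fun z => DF.emb p q _ (DF.inChart φ α z)) (ψ y) v := by
      intro v
      rw [dbarDir_eq_wirt]
      exact (wirt_linC (s := Complex.I) hα (DF.emb p q _) v).symm
    simp only [h3, h4]
    rw [map_sum] at key
    exact key.symm
  · have h2 : ∀ j, wirt Complex.I (fun z => cpull (cderiv ψ z)) y (Pi.single j 1) u =
        ∑ k, u (fderiv ℂ (fderiv ℂ ψ) y (Pi.single j 1) (Pi.single k 1)) • covecBar k := by
      intro j
      rw [← dbarDir_eq_wirt, dbarDir_cpull hJ,
        cdual_eq_sum (cpull (delDir (cderiv ψ) y (Pi.single j 1)) u)]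
      refine Finset.sum_congr rfl fun k _ => ?_
      rw [← delDir_cderiv hU hψ hyo]
      rfl
    simp only [h2]
    exact sum_ι_mul_ι_of_symm covecBar _ fun j k => by rw [fderiv_fderiv_symm hU hψ hyo]
  · rw [← dbarDir_eq_wirt, dbarDir_eq_sum]
    simp only [dbarDir_eq_wirt]
    rfl

end ChartInvariance

/-! ### Top-degree forms and derivatives of determinants -/

section Volume

/-- Only the i-th summand avoids a repeated argument. Replacing each frame vector in turn by its
covariant derivative and adding up therefore yields the trace of the connection. -/
theorem alternatingMap_update_sum {V W : Type*} [AddCommGroup V] [Module ℂ V] [AddCommGroup W]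
    [Module ℂ W] {n : ℕ} (f : V [⋀^Fin n]→ₗ[ℂ] W) (v : Fin n → V) (i : Fin n) (c : Fin n → ℂ) :
    f (Function.update v i (∑ k, c k • v k)) = c i • f v := by
  rw [f.map_update_sum, Finset.sum_eq_single i]
  · rw [f.map_update_smul, Function.update_eq_self]
  · intro k _ hk
    rw [f.map_update_smul, f.map_update_self v hk.symm, smul_zero]
  · simp

variable {n : ℕ}

theorem delDir_scalar {u : (Fin n → ℂ) → ℂ} {y : Fin n → ℂ} (hu : DifferentiableAt ℝ u y)
    (v : Fin n → ℂ) :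
    delDir u y v = 2⁻¹ * (fderiv ℝ u y v - Complex.I * fderiv ℝ u y (Complex.I • v)) := by
  simp only [delDir, dirVec_scalar hu, smul_eq_mul]

theorem dbarDir_scalar {u : (Fin n → ℂ) → ℂ} {y : Fin n → ℂ} (hu : DifferentiableAt ℝ u y)
    (v : Fin n → ℂ) :
    dbarDir u y v = 2⁻¹ * (fderiv ℝ u y v + Complex.I * fderiv ℝ u y (Complex.I • v)) := by
  simp only [dbarDir, dirVec_scalar hu, smul_eq_mul]

/-- The determinant as a continuous real-multilinear function of the rows. -/
def detRows (n : ℕ) : ContinuousMultilinearMap ℝ (fun _ : Fin n => Fin n → ℂ) ℂ where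
  toMultilinearMap :=
    (Matrix.detRowAlternating (n := Fin n) (R := ℂ)).toMultilinearMap.restrictScalars ℝ
  cont := by
    change Continuous fun M : Matrix (Fin n) (Fin n) ℂ => M.det
    exact continuous_id.matrix_det

theorem fderiv_det {M : (Fin n → ℂ) → Matrix (Fin n) (Fin n) ℂ} {y : Fin n → ℂ}
    (hM : ∀ i j, DifferentiableAt ℝ (fun z => M z i j) y) :
    DifferentiableAt ℝ (fun z => (M z).det) y ∧ ∀ v, fderiv ℝ (fun z => (M z).det) y v =
      ∑ i, ((M y).updateRow i (fun k => fderiv ℝ (fun z => M z i k) y v)).det := by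
  have h1 : ∀ i, HasFDerivAt (fun z => M z i)
      (ContinuousLinearMap.pi fun k => fderiv ℝ (fun z => M z i k) y) y := fun i =>
    hasFDerivAt_pi.2 fun k => (hM i k).hasFDerivAt
  have h2 := HasFDerivAt.multilinear_comp (f := detRows n) h1
  have h3 : HasFDerivAt (fun z => (M z).det) _ y := h2
  refine ⟨h3.differentiableAt, fun v => ?_⟩
  rw [h3.fderiv]
  simp only [sum_apply, ContinuousLinearMap.comp_apply]
  rfl

theorem det_updateRow_linear (M : Matrix (Fin n) (Fin n) ℂ) (i : Fin n) (a b : Fin n → ℂ)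
    (s t : ℂ) : (M.updateRow i fun k => s * (a k + t * b k)).det =
      s * ((M.updateRow i a).det + t * (M.updateRow i b).det) := by
  rw [← Matrix.det_updateRow_smul, ← Matrix.det_updateRow_add, ← Matrix.det_updateRow_smul]
  rfl

/-- The row-by-row form suits the Chern connection, for which the derivative of a row of the Gram
matrix is a combination of its rows. -/
theorem delDir_det {M : (Fin n → ℂ) → Matrix (Fin n) (Fin n) ℂ} {y : Fin n → ℂ}
    (hM : ∀ i j, DifferentiableAt ℝ (fun z => M z i j) y) (v : Fin n → ℂ) :
    delDir (fun z => (M z).det) y v =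
      ∑ i, ((M y).updateRow i (fun k => delDir (fun z => M z i k) y v)).det := by
  rw [delDir_scalar (fderiv_det hM).1, (fderiv_det hM).2, (fderiv_det hM).2]
  simp only [delDir_scalar (hM _ _), sub_eq_add_neg, ← neg_mul, det_updateRow_linear]
  rw [Finset.mul_sum, ← Finset.sum_add_distrib, Finset.mul_sum]

/-- The `(n, 0)`-form `dz₁ ∧ ⋯ ∧ dz_n` of `ℂ^n`. -/
def stdTop (n : ℕ) : ⋀[ℂ]^n (Module.Dual ℂ (Fin n → ℂ)) := exteriorPower.ιMulti ℂ n covec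

/-- The standard frame of `ℂ^n`. -/
def stdFrame (n : ℕ) : Fin n → Fin n → ℂ := fun i => Pi.single i 1

/-- Top-degree alternating maps are multiples of the determinant in a basis, here the basis dz_j.
Evaluation on the standard frame gives the factor. -/
theorem eq_smul_stdTop (a : ⋀[ℂ]^n (Module.Dual ℂ (Fin n → ℂ))) :
    a = exteriorPower.pairingDual ℂ (Fin n → ℂ) n a (exteriorPower.ιMulti ℂ n (stdFrame n)) •
      stdTop n := by
  induction a using exteriorPower_induction with
  | zero => simp
  | add a b ha hb =>
    rw [map_add, LinearMap.add_apply, add_smul, ← ha, ← hb]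
  | smul c a ha => rw [map_smul, LinearMap.smul_apply, smul_eq_mul, mul_smul, ← ha]
  | mk l =>
    apply eq_of_forall_functional
    intro L
    let b := (Pi.basisFun ℂ (Fin n)).dualBasis
    have hb : ⇑b = covec := by
      funext j
      ext v
      simp [b, covec]
    have := AlternatingMap.eq_smul_basis_det b (L.compAlternatingMap (exteriorPower.ιMulti ℂ n))
    have h1 := congrArg (fun f => f l) this
    simp only [LinearMap.compAlternatingMap_apply, AlternatingMap.smul_apply] at h1
    rw [h1, map_smul, exteriorPower.pairingDual_ιMulti_ιMulti, smul_eq_mul, smul_eq_mul, mul_comm,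
      hb, stdTop]
    congr 1
    rw [Module.Basis.det_apply]
    congr 1
    ext i j
    simp [Module.Basis.toMatrix_apply, b, stdFrame]

variable {X : Type*} [TopologicalSpace X] [ChartedSpace (Fin n → ℂ) X]

/-- The coefficient of an `(n, 0)`-form with respect to `dz₁ ∧ ⋯ ∧ dz_n`. -/
def topCoeff (Ω : ∀ x : X, ⋀[ℂ]^n (Module.Dual ℂ (TX n x)))
    (φ : OpenPartialHomeomorph X (Fin n → ℂ)) (y : Fin n → ℂ) : ℂ :=
  formEval Ω φ (stdFrame n) y

theorem formInChart_eq (Ω : ∀ x : X, ⋀[ℂ]^n (Module.Dual ℂ (TX n x)))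
    (φ : OpenPartialHomeomorph X (Fin n → ℂ)) (y : Fin n → ℂ) :
    formInChart Ω φ y = topCoeff Ω φ y • stdTop n := eq_smul_stdTop _

theorem formEval_update (Ω : ∀ x : X, ⋀[ℂ]^n (Module.Dual ℂ (TX n x)))
    (φ : OpenPartialHomeomorph X (Fin n → ℂ)) (y : Fin n → ℂ) (i : Fin n) (c : Fin n → ℂ) :
    formEval Ω φ (Function.update (stdFrame n) i c) y = c i * topCoeff Ω φ y := by
  have := alternatingMap_update_sum ((exteriorPower.pairingDual ℂ (Fin n → ℂ) n
    (formInChart Ω φ y)).compAlternatingMap (exteriorPower.ιMulti ℂ n)) (stdFrame n) i c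
  have e : ∑ k, c k • stdFrame n k = c := sum_smul_single c
  rw [e] at this
  exact this

variable {φ : OpenPartialHomeomorph X (Fin n → ℂ)}

theorem topCoeff_differentiableOn {Ω : ∀ x : X, ⋀[ℂ]^n (Module.Dual ℂ (TX n x))}
    (hΩ : IsHolomorphicForm Ω) (hφ : φ ∈ atlas (Fin n → ℂ) X) :
    DifferentiableOn ℂ (topCoeff Ω φ) φ.target :=
  hΩ φ hφ ((exteriorPower.pairingDual ℂ (Fin n → ℂ) n).flip
    (exteriorPower.ιMulti ℂ n (stdFrame n)))

variable [IsManifold 𝓘(ℂ, Fin n → ℂ) ω X]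

theorem topCoeff_ne_zero {Ω : ∀ x : X, ⋀[ℂ]^n (Module.Dual ℂ (TX n x))}
    (hΩ : ∀ x, Ω x ≠ 0) (hφ : φ ∈ atlas (Fin n → ℂ) X) {y : Fin n → ℂ} (hy : y ∈ φ.target) :
    topCoeff Ω φ y ≠ 0 := by
  intro h0
  have h1 := formInChart_eq Ω φ y
  rw [h0, zero_smul, formInChart] at h1
  have h2 := congrArg (exteriorPower.map n (dChart φ (φ.symm y)).dualMap) h1
  rw [map_zero, ← LinearMap.comp_apply, ← exteriorPower.map_comp, LinearMap.dualMap_comp_dualMap,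
    dChartInv_comp_dChart hφ (φ.map_target hy), LinearMap.dualMap_id, exteriorPower.map_id] at h2
  exact hΩ _ h2

end Volume

/-! ### Consequences of the Kähler condition and of parallelism -/

section Kahler

variable {n : ℕ} {X : Type*} [TopologicalSpace X] [ChartedSpace (Fin n → ℂ) X]
variable (h : KahlerMetric n X) {φ : OpenPartialHomeomorph X (Fin n → ℂ)}

theorem metricInChart_differentiableAt (hφ : φ ∈ atlas (Fin n → ℂ) X) (v w : Fin n → ℂ)
    {y : Fin n → ℂ} (hy : y ∈ φ.target) :
    DifferentiableAt ℝ (metricInChart h.toFun φ v w) y :=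
  ((h.smooth φ hφ v w).contDiffAt (φ.open_target.mem_nhds hy)).differentiableAt (by simp)

theorem metricInChart_smul_left (c : ℂ) (v w : Fin n → ℂ) :
    metricInChart h.toFun φ (c • v) w = fun y => c * metricInChart h.toFun φ v w y := by
  funext y; simp [metricInChart]

theorem metricInChart_smul_right (c : ℂ) (v w : Fin n → ℂ) :
    metricInChart h.toFun φ v (c • w) = fun y => conj c * metricInChart h.toFun φ v w y := by
  funext y; simp [metricInChart]

theorem metricInChart_symm (v w : Fin n → ℂ) :
    metricInChart h.toFun φ w v = fun y => conj (metricInChart h.toFun φ v w y) := by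
  funext y; simp [metricInChart, h.symm]

theorem fderiv_re {u : (Fin n → ℂ) → ℂ} {y : Fin n → ℂ} (hu : DifferentiableAt ℝ u y)
    (v : Fin n → ℂ) : fderiv ℝ (fun z => (u z).re) y v = (fderiv ℝ u y v).re := by
  have := (Complex.reCLM.hasFDerivAt.comp y hu.hasFDerivAt).fderiv
  exact congrArg (fun L => L v) this

theorem fderiv_neg_im {u : (Fin n → ℂ) → ℂ} {y : Fin n → ℂ} (hu : DifferentiableAt ℝ u y)
    (v : Fin n → ℂ) : fderiv ℝ (fun z => -(u z).im) y v = -(fderiv ℝ u y v).im := by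
  have := (Complex.imCLM.hasFDerivAt.comp y hu.hasFDerivAt).neg.fderiv
  exact congrArg (fun L => L v) this

theorem fderiv_conj {u : (Fin n → ℂ) → ℂ} {y : Fin n → ℂ} (hu : DifferentiableAt ℝ u y)
    (v : Fin n → ℂ) : fderiv ℝ (fun z => conj (u z)) y v = conj (fderiv ℝ u y v) := by
  have := (Complex.conjCLE.toContinuousLinearMap.hasFDerivAt.comp y hu.hasFDerivAt).fderiv
  exact congrArg (fun L => L v) this

/-- On a Kähler manifold the Levi-Civita connection is the Chern connection. -/
theorem metricInChart_christoffel (hφ : φ ∈ atlas (Fin n → ℂ) X) {y : Fin n → ℂ}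
    (hy : y ∈ φ.target) {Γ : (Fin n → ℂ) → (Fin n → ℂ) → (Fin n → ℂ)}
    (hΓ : h.IsChristoffel φ y Γ) (u v w : Fin n → ℂ) :
    metricInChart h.toFun φ (Γ u v) w y = delDir (metricInChart h.toFun φ v w) y u := by
  have hd := fun v w => metricInChart_differentiableAt h hφ v w hy
  have key : ∀ w, (metricInChart h.toFun φ (Γ u v) w y).re =
      (delDir (metricInChart h.toFun φ v w) y u).re := by
    intro w
    have h1 := hΓ u v w
    -- With ω = -Im h one has ω(w, iu) = g(w, u) and ω(iu, v) = -g(u, v). Closedness on (iu, v, w)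
    -- thus replaces v g(u, w) - w g(u, v) in the Koszul formula by (iu)(Im h(v, w)), and the result
    -- is 2 Re ∂_u h(v, w).
    have h2 := h.closed φ hφ y hy (Complex.I • u) v w
    simp only [KahlerMetric.riemInChart, fderiv_neg_im (hd _ _)] at h1 h2
    have e : ∀ a b, h.riemInChart φ a b = fun z => (metricInChart h.toFun φ a b z).re :=
      fun _ _ => rfl
    rw [e, e, e, fderiv_re (hd _ _), fderiv_re (hd _ _), fderiv_re (hd _ _)] at h1
    rw [metricInChart_smul_left, metricInChart_smul_right,
      fderiv_const_mul (hd u v), fderiv_const_mul (hd w u),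
      metricInChart_symm h u w] at h2
    simp only [smul_apply, fderiv_conj (hd _ _)] at h2
    rw [delDir_scalar (hd _ _)]
    simp at h1 h2 ⊢
    linarith
  apply Complex.ext (key w)
  -- Conjugate-linearity gives h(·, iw) = -i h(·, w), whose real part is the imaginary part of h(·,
  -- w).
  have := key (Complex.I • w)
  rw [metricInChart_smul_right, metricInChart_smul_right, delDir_scalar ((hd v w).const_mul _),
    fderiv_const_mul (hd _ _)] at this
  rw [delDir_scalar (hd _ _)]
  simp at this ⊢
  linarith

/-- The determinant of the metric in a chart. -/
def volDet (φ : OpenPartialHomeomorph X (Fin n → ℂ)) (y : Fin n → ℂ) : ℂ :=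
  (Matrix.of fun j k : Fin n =>
    metricInChart h.toFun φ (Pi.single j 1) (Pi.single k 1) y).det

theorem fderiv_topCoeff {Ω : ∀ x : X, ⋀[ℂ]^n (Module.Dual ℂ (TX n x))}
    (hΩ : IsHolomorphicForm Ω) (hφ : φ ∈ atlas (Fin n → ℂ) X) {y : Fin n → ℂ}
    (hy : y ∈ φ.target) (u : Fin n → ℂ) :
    delDir (topCoeff Ω φ) y u = fderiv ℝ (topCoeff Ω φ) y u := by
  have hF : DifferentiableAt ℂ (topCoeff Ω φ) y :=
    (topCoeff_differentiableOn hΩ hφ).differentiableAt (φ.open_target.mem_nhds hy)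
  rw [delDir_scalar (hF.restrictScalars ℝ), hF.fderiv_restrictScalars ℝ]
  simp only [ContinuousLinearMap.coe_restrictScalars', map_smul, smul_eq_mul]
  rw [← mul_assoc, Complex.I_mul_I]
  ring

/-- Both logarithmic derivatives are the trace of Γ_u: for F because Ω is parallel, for D because
∂_u acts on the rows of the Gram matrix through the matrix of Γ_u. -/
theorem topCoeff_volDet {Ω : ∀ x : X, ⋀[ℂ]^n (Module.Dual ℂ (TX n x))}
    (hΩ : IsHolomorphicForm Ω) (hpar : h.IsParallel Ω) (hφ : φ ∈ atlas (Fin n → ℂ) X)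
    {y : Fin n → ℂ} (hy : y ∈ φ.target) (u : Fin n → ℂ) :
    volDet h φ y * delDir (topCoeff Ω φ) y u = topCoeff Ω φ y * delDir (volDet h φ) y u := by
  obtain ⟨Γ, hΓ, hpar⟩ := hpar φ hφ y hy
  have hFd := fderiv_topCoeff hΩ hφ hy u
  have h1 : fderiv ℝ (topCoeff Ω φ) y u = ∑ i, Γ u (Pi.single i 1) i * topCoeff Ω φ y := by
    refine (hpar u (stdFrame n)).trans ?_
    exact Finset.sum_congr rfl fun i _ => formEval_update Ω φ y i _
  have h2 : delDir (volDet h φ) y u = ∑ i, Γ u (Pi.single i 1) i * volDet h φ y := by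
    refine (delDir_det (M := fun z => Matrix.of fun j k : Fin n =>
      metricInChart h.toFun φ (Pi.single j 1) (Pi.single k 1) z)
      (fun i j => metricInChart_differentiableAt h hφ _ _ hy) u).trans ?_
    refine Finset.sum_congr rfl fun i _ => ?_
    have e2 : (fun k => delDir (fun z => (Matrix.of fun j k : Fin n =>
        metricInChart h.toFun φ (Pi.single j 1) (Pi.single k 1) z) i k) y u) =
        ∑ l, Γ u (Pi.single i 1) l • (Matrix.of fun j k : Fin n =>
          metricInChart h.toFun φ (Pi.single j 1) (Pi.single k 1) y) l := by
      funext k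
      simp only [Matrix.of_apply, Finset.sum_apply, Pi.smul_apply]
      change delDir (metricInChart h.toFun φ (Pi.single i 1) (Pi.single k 1)) y u = _
      rw [← metricInChart_christoffel h hφ hy hΓ]
      conv_lhs => rw [← sum_smul_single (Γ u (Pi.single i 1))]
      simp [metricInChart]
    rw [e2, Matrix.det_updateRow_sum, smul_eq_mul]
    rfl
  rw [hFd, h1, h2, ← Finset.sum_mul, ← Finset.sum_mul]
  ring

variable [IsManifold 𝓘(ℂ, Fin n → ℂ) ω X]

open scoped ComplexOrder in
-- The Gram matrix is Hermitian and positive definite, since the coordinate frame is a basis and h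
-- is positive.
theorem volDet_pos (hφ : φ ∈ atlas (Fin n → ℂ) X) {y : Fin n → ℂ} (hy : y ∈ φ.target) :
    0 < volDet h φ y := by
  apply Matrix.PosDef.det_pos
  apply Matrix.PosDef.of_dotProduct_mulVec_pos
  · ext i j
    simp [metricInChart, h.symm]
  · intro x hx
    set M : Matrix (Fin n) (Fin n) ℂ := Matrix.of fun j k : Fin n =>
      metricInChart h.toFun φ (Pi.single j 1) (Pi.single k 1) y with hM
    -- The metric is conjugate-linear in its second slot, so the form x* M x is h evaluated on the
    -- conjugate vector.
    have e : star x ⬝ᵥ M.mulVec x = h.toFun (φ.symm y) (dChartInv φ (φ.symm y) (star x))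
        (dChartInv φ (φ.symm y) (star x)) := by
      conv_rhs => rw [← sum_smul_single (star x)]
      simp [hM, metricInChart, dotProduct, Matrix.mulVec, Finset.mul_sum]
      rw [Finset.sum_comm]
      refine Finset.sum_congr rfl fun i _ => Finset.sum_congr rfl fun j _ => ?_
      ring
    rw [e]
    have hne : dChartInv φ (φ.symm y) (star x) ≠ 0 := by
      intro h0
      have := congrArg (dChart φ (φ.symm y)) h0
      rw [← LinearMap.comp_apply, dChart_comp_dChartInv hφ (φ.map_target hy), map_zero] at this
      exact hx (by simpa using this)
    have h1 := h.pos _ _ hne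
    have h2 := h.symm (φ.symm y) (dChartInv φ (φ.symm y) (star x)) (dChartInv φ (φ.symm y) (star x))
    rw [Complex.lt_def]
    exact ⟨h1, (Complex.conj_eq_iff_im.1 h2).symm⟩

theorem volDet_eq (hφ : φ ∈ atlas (Fin n → ℂ) X) {y : Fin n → ℂ} (hy : y ∈ φ.target) :
    volDet h φ y = h.volDensity φ y :=
  have := volDet_pos h hφ hy
  Complex.ext rfl (Complex.lt_def.1 this).2.symm

theorem volDensity_pos (hφ : φ ∈ atlas (Fin n → ℂ) X) {y : Fin n → ℂ} (hy : y ∈ φ.target) :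
    0 < h.volDensity φ y := (Complex.lt_def.1 (volDet_pos h hφ hy)).1

theorem volDet_contDiffOn (hφ : φ ∈ atlas (Fin n → ℂ) X) :
    ContDiffOn ℝ ∞ (volDet h φ) φ.target := by
  have e : volDet h φ = fun z => detRows n (fun j k : Fin n =>
      metricInChart h.toFun φ (Pi.single j 1) (Pi.single k 1) z) := rfl
  rw [e]
  refine (detRows n).contDiff.comp_contDiffOn ?_
  exact contDiffOn_pi.2 fun i => contDiffOn_pi.2 fun j => h.smooth φ hφ _ _

/-- Bootstrapping: dF(u) = F D⁻¹ ∂_u D with D smooth and nonzero, so if F is C^k then so is its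
derivative. This starts from complex differentiability alone, without power series in several
variables. -/
theorem topCoeff_contDiffOn {Ω : ∀ x : X, ⋀[ℂ]^n (Module.Dual ℂ (TX n x))}
    (hΩ : IsHolomorphicForm Ω) (hpar : h.IsParallel Ω) (hφ : φ ∈ atlas (Fin n → ℂ) X) :
    ContDiffOn ℝ ∞ (topCoeff Ω φ) φ.target := by
  have hd : DifferentiableOn ℝ (topCoeff Ω φ) φ.target :=
    (topCoeff_differentiableOn hΩ hφ).restrictScalars ℝ
  have hD := volDet_contDiffOn h hφ
  have hD0 : ∀ y ∈ φ.target, volDet h φ y ≠ 0 := fun y hy => by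
    rw [volDet_eq h hφ hy, Complex.ofReal_ne_zero]
    exact (volDensity_pos h hφ hy).ne'
  rw [contDiffOn_infty]
  intro k
  induction k with
  | zero => exact contDiffOn_zero.2 hd.continuousOn
  | succ k ih =>
    refine (contDiffOn_succ_iff_fderiv_of_isOpen (n := k) φ.open_target).2 ⟨hd, by simp, ?_⟩
    rw [contDiffOn_clm_apply]
    intro u
    have hG : ContDiffOn ℝ ∞ (fun y => delDir (volDet h φ) y u) φ.target :=
      smoothOn_scalar.1 ((smoothOn_scalar.2 hD).delDir φ.open_target u)
    refine ((ih.mul (hG.of_le (by exact_mod_cast le_top))).mul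
      ((hD.inv hD0).of_le (by exact_mod_cast le_top))).congr fun y hy => ?_
    have := topCoeff_volDet h hΩ hpar hφ hy u
    rw [fderiv_topCoeff hΩ hφ hy] at this
    rw [← this]
    simp only [Pi.inv_apply]
    field_simp [hD0 y hy]

end Kahler

/-! ### The operator Δ in coordinates, its existence, uniqueness and smoothness -/

section Delta

variable {n : ℕ}

/-- The coordinate expression of `Δ` for the volume form `F dz₁ ∧ ⋯ ∧ dz_n`. -/
def deltaCoord {p q : ℕ} (F : (Fin n → ℂ) → ℂ) (g : (Fin n → ℂ) → PV (p + 1) q (Fin n → ℂ))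
    (y : Fin n → ℂ) : PV p q (Fin n → ℂ) :=
  (F y)⁻¹ • ∑ j : Fin n, PV.interior p q (covec j)
    (delDir (fun z => F z • g z) y (Pi.single j 1))

theorem SmoothOn.deltaCoord {p q : ℕ} {F : (Fin n → ℂ) → ℂ}
    {g : (Fin n → ℂ) → PV (p + 1) q (Fin n → ℂ)} {U : Set (Fin n → ℂ)} (hU : IsOpen U)
    (hF : ContDiffOn ℝ ∞ F U) (hF0 : ∀ y ∈ U, F y ≠ 0) (hg : SmoothOn g U) :
    SmoothOn (deltaCoord F g) U :=
  SmoothOn.smul (hF.inv hF0) (SmoothOn.sum fun j _ => by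
    have h1 : SmoothOn (fun z => F z • g z) U := SmoothOn.smul hF hg
    have h2 := h1.delDir hU (Pi.single j 1)
    exact SmoothOn.linC (G := PV p q (Fin n → ℂ)) h2 (PV.interior p q (covec j)))

/-- Moves the coefficient F from Ω to γ. What remains is contraction with the constant form dz₁ ∧ ⋯
∧ dz_n, which commutes with ∂_j. -/
theorem contractForm_smul_form {V : Type*} [AddCommGroup V] [Module ℂ V] (p q : ℕ) {n : ℕ} (c : ℂ)
    (Ω : ⋀[ℂ]^n (Module.Dual ℂ V)) (γ : PV p q V) :
    contractForm p q (c • Ω) γ = contractForm p q Ω (c • γ) := by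
  induction γ using TensorProduct.induction_on with
  | zero => simp
  | add a b ha hb => rw [map_add, ha, hb, ← map_add, smul_add]
  | tmul a m =>
    rw [TensorProduct.smul_tmul', contractForm_tmul, contractForm_tmul]
    simp

theorem delCoord_contractForm {p q : ℕ} (Ω : ⋀[ℂ]^n (Module.Dual ℂ (Fin n → ℂ)))
    {g : (Fin n → ℂ) → PV (p + 1) q (Fin n → ℂ)} {y : Fin n → ℂ} (hg : DiffAt g y) :
    delCoord (fun z => contractForm (p + 1) q Ω (g z)) y =
      contractForm p q Ω (∑ j : Fin n, PV.interior p q (covec j)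
        (delDir g y (Pi.single j 1))) := by
  rw [delCoord, map_sum]
  refine Finset.sum_congr rfl fun j _ => ?_
  rw [delDir_linC hg, wedge_contractForm (by simp)]

theorem delCoord_contractForm_zero {q : ℕ} (Ω : ⋀[ℂ]^n (Module.Dual ℂ (Fin n → ℂ)))
    {g : (Fin n → ℂ) → PV 0 q (Fin n → ℂ)} {y : Fin n → ℂ} (hg : DiffAt g y) :
    delCoord (fun z => contractForm 0 q Ω (g z)) y = 0 := by
  rw [delCoord]
  refine Finset.sum_eq_zero fun j _ => ?_
  rw [delDir_linC hg, wedge_contractForm_zero (by simp)]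

variable {X : Type*} [TopologicalSpace X] [ChartedSpace (Fin n → ℂ) X]
  [IsManifold 𝓘(ℂ, Fin n → ℂ) ω X] {φ : OpenPartialHomeomorph X (Fin n → ℂ)}

theorem finrank_TX (x : X) : Module.finrank ℂ (TX n x) = n :=
  (Module.finrank_fin_fun ℂ : Module.finrank ℂ (Fin n → ℂ) = n)

theorem inChart_contractForm {p q : ℕ} (Ω : ∀ x : X, ⋀[ℂ]^n (Module.Dual ℂ (TX n x)))
    (hφ : φ ∈ atlas (Fin n → ℂ) X) (γ : ∀ x : X, PV p q (TX n x)) {y : Fin n → ℂ}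
    (hy : y ∈ φ.target) :
    MF.inChart φ (fun x => contractForm p q (Ω x) (γ x)) y =
      contractForm p q (stdTop n) (topCoeff Ω φ y • PV.inChart φ γ y) := by
  rw [← contractForm_smul_form, ← formInChart_eq, MF.inChart,
    contractForm_transport p q _ (dChart φ (φ.symm y)) _
      (dChartInv_comp_dChart hφ (φ.map_target hy))]
  rfl

theorem MF.transport_dChartInv_injective {q : ℕ} (hφ : φ ∈ atlas (Fin n → ℂ) X) {x : X}
    (hx : x ∈ φ.source) : Function.Injective (MF.transport q (dChartInv φ x)) := by
  refine Function.LeftInverse.injective (g := MF.transport q (dChart φ x)) fun a => ?_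
  rw [MF.transport_transport, dChartInv_comp_dChart hφ hx, MF.transport_id]

theorem PV.transport_dChart_injective {p q : ℕ} (hφ : φ ∈ atlas (Fin n → ℂ) X) {x : X}
    (hx : x ∈ φ.source) :
    Function.Injective (PV.transport p q (dChart φ x) (dChartInv φ x)) := by
  refine Function.LeftInverse.injective
    (g := PV.transport p q (dChartInv φ x) (dChart φ x)) fun a => ?_
  rw [PV.transport_transport, dChartInv_comp_dChart hφ hx, PV.transport_id]

theorem stdTop_ne_zero : stdTop n ≠ 0 := by
  intro h0
  have := exteriorPower.pairingDual_ιMulti_ιMulti (R := ℂ) (M := Fin n → ℂ) covec (stdFrame n)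
  rw [show exteriorPower.ιMulti ℂ n covec = stdTop n from rfl, h0] at this
  have e : (Matrix.of fun i j => covec j (stdFrame n i)) = (1 : Matrix (Fin n) (Fin n) ℂ) := by
    ext i j
    simp [covec, stdFrame, Matrix.one_apply, Pi.single_apply, eq_comm]
  rw [e] at this
  simp at this

variable (h : KahlerMetric n X) {Ω : ∀ x : X, ⋀[ℂ]^n (Module.Dual ℂ (TX n x))}

theorem diffAt_inChart_contractForm (hΩ : IsHolomorphicForm Ω) (hpar : h.IsParallel Ω) {p q : ℕ}
    {γ : ∀ x : X, PV p q (TX n x)} (hγ : PV.IsSmooth γ) (hφ : φ ∈ atlas (Fin n → ℂ) X)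
    {y : Fin n → ℂ} (hy : y ∈ φ.target) :
    DiffAt (fun z => topCoeff Ω φ z • PV.inChart φ γ z) y ∧
    MF.inChart φ (fun x => contractForm p q (Ω x) (γ x)) =ᶠ[nhds y]
      fun z => contractForm p q (stdTop n) (topCoeff Ω φ z • PV.inChart φ γ z) := by
  refine ⟨(SmoothOn.smul (topCoeff_contDiffOn h hΩ hpar hφ) (hγ φ hφ)).diffAt φ.open_target hy, ?_⟩
  filter_upwards [φ.open_target.mem_nhds hy] with z hz
  exact inChart_contractForm Ω hφ γ hz

theorem inChart_del_contractForm (hΩ : IsHolomorphicForm Ω) (hpar : h.IsParallel Ω) {p q : ℕ}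
    {γ : ∀ x : X, PV p q (TX n x)} (hγ : PV.IsSmooth γ) (hφ : φ ∈ atlas (Fin n → ℂ) X)
    {y : Fin n → ℂ} (hy : y ∈ φ.target) :
    MF.inChart φ (del fun x => contractForm p q (Ω x) (γ x)) y =
      delCoord (fun z => contractForm p q (stdTop n) (topCoeff Ω φ z • PV.inChart φ γ z)) y := by
  obtain ⟨-, h2⟩ := diffAt_inChart_contractForm h hΩ hpar hγ hφ hy
  obtain ⟨h1', h2'⟩ := diffAt_inChart_contractForm h hΩ hpar hγ
    (chart_mem_atlas (Fin n → ℂ) (φ.symm y)) (mem_chart_target (Fin n → ℂ) (φ.symm y))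
  rw [inChart_del hφ _ hy ((h1'.linC (contractForm p q (stdTop n))).congr h2')]
  simp only [delCoord, delDir_congr h2]

/-- Transport to the chart and contraction with dz₁ ∧ ⋯ ∧ dz_n are both injective, so the defining
equation at a point becomes F d = ∑ⱼ dz_j ⌟ ∂_j(F γ). Existence and the formula for Δ in any chart
follow from this. -/
theorem contractForm_eq_del_iff (hΩ : IsHolomorphicForm Ω) (hne : ∀ x, Ω x ≠ 0)
    (hpar : h.IsParallel Ω) {p q : ℕ} {γ : ∀ x : X, PV (p + 1) q (TX n x)} (hγ : PV.IsSmooth γ)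
    (hφ : φ ∈ atlas (Fin n → ℂ) X) {y : Fin n → ℂ} (hy : y ∈ φ.target)
    (d : PV p q (TX n (φ.symm y))) :
    contractForm p q (Ω (φ.symm y)) d =
        del (fun x => contractForm (p + 1) q (Ω x) (γ x)) (φ.symm y) ↔
      PV.transport p q (dChart φ (φ.symm y)) (dChartInv φ (φ.symm y)) d =
        deltaCoord (topCoeff Ω φ) (PV.inChart φ γ) y := by
  have hs := φ.map_target hy
  have hF := topCoeff_ne_zero hne hφ hy
  rw [← (MF.transport_dChartInv_injective hφ hs).eq_iff,
    contractForm_transport p q _ (dChart φ (φ.symm y)) _ (dChartInv_comp_dChart hφ hs)]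
  have e1 := formInChart_eq Ω φ y
  rw [formInChart] at e1
  have e2 := inChart_del_contractForm h hΩ hpar hγ hφ hy
  rw [MF.inChart] at e2
  rw [e1, e2, delCoord_contractForm _ (diffAt_inChart_contractForm h hΩ hpar hγ hφ hy).1,
    contractForm_smul_form,
    (contractForm_injective (by simp) (stdTop n) stdTop_ne_zero p q).eq_iff, deltaCoord,
    eq_inv_smul_iff₀ hF]

theorem exists_isDelta (hΩ : IsHolomorphicForm Ω) (hne : ∀ x, Ω x ≠ 0)
    (hpar : h.IsParallel Ω) {p q : ℕ} {γ : ∀ x : X, PV (p + 1) q (TX n x)} (hγ : PV.IsSmooth γ) :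
    ∃ δ : ∀ x : X, PV p q (TX n x), IsDelta Ω γ δ := by
  have key : ∀ x, ∃ d : PV p q (TX n x), contractForm p q (Ω x) d =
      del (fun x' => contractForm (p + 1) q (Ω x') (γ x')) x := by
    intro x
    obtain ⟨φ, hφ, hx⟩ : ∃ φ ∈ atlas (Fin n → ℂ) X, x ∈ φ.source :=
      ⟨_, chart_mem_atlas _ x, mem_chart_source _ x⟩
    obtain ⟨y, hy, rfl⟩ : ∃ y ∈ φ.target, φ.symm y = x := ⟨φ x, φ.map_source hx, φ.left_inv hx⟩
    refine ⟨PV.transport p q (dChartInv φ (φ.symm y)) (dChart φ (φ.symm y))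
      (deltaCoord (topCoeff Ω φ) (PV.inChart φ γ) y), ?_⟩
    rw [contractForm_eq_del_iff h hΩ hne hpar hγ hφ hy, PV.transport_transport,
      dChart_comp_dChartInv hφ hx, PV.transport_id]
  choose δ hδ using key
  exact ⟨δ, hδ⟩

/-- Existence ensures that `Delta` is a chosen solution and not the default 0. Injectivity of
contraction makes it the only one. -/
theorem isDelta_iff (hΩ : IsHolomorphicForm Ω) (hne : ∀ x, Ω x ≠ 0)
    (hpar : h.IsParallel Ω) {p q : ℕ} {γ : ∀ x : X, PV (p + 1) q (TX n x)} (hγ : PV.IsSmooth γ)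
    (δ : ∀ x : X, PV p q (TX n x)) : IsDelta Ω γ δ ↔ δ = Delta Ω γ := by
  have hex := exists_isDelta h hΩ hne hpar hγ
  have hD : IsDelta Ω γ (Delta Ω γ) := by
    rw [Delta, dif_pos hex]
    exact hex.choose_spec
  refine ⟨fun hδ => funext fun x => ?_, fun e => e ▸ hD⟩
  exact contractForm_injective (finrank_TX x) (Ω x) (hne x) p q ((hδ x).trans (hD x).symm)

theorem inChart_Delta (hΩ : IsHolomorphicForm Ω) (hne : ∀ x, Ω x ≠ 0)
    (hpar : h.IsParallel Ω) {p q : ℕ} {γ : ∀ x : X, PV (p + 1) q (TX n x)} (hγ : PV.IsSmooth γ)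
    (hφ : φ ∈ atlas (Fin n → ℂ) X) {y : Fin n → ℂ} (hy : y ∈ φ.target) :
    PV.inChart φ (Delta Ω γ) y = deltaCoord (topCoeff Ω φ) (PV.inChart φ γ) y :=
  (contractForm_eq_del_iff h hΩ hne hpar hγ hφ hy _).1
    ((isDelta_iff h hΩ hne hpar hγ _).2 rfl _)

theorem isSmooth_Delta (hΩ : IsHolomorphicForm Ω) (hne : ∀ x, Ω x ≠ 0)
    (hpar : h.IsParallel Ω) {p q : ℕ} {γ : ∀ x : X, PV (p + 1) q (TX n x)} (hγ : PV.IsSmooth γ) :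
    PV.IsSmooth (Delta Ω γ) := fun φ hφ =>
  (SmoothOn.deltaCoord φ.open_target (topCoeff_contDiffOn h hΩ hpar hφ)
    (fun _ hy => topCoeff_ne_zero hne hφ hy) (hγ φ hφ)).congr fun _ hy =>
      inChart_Delta h hΩ hne hpar hγ hφ hy

theorem del_contractForm_zero (hΩ : IsHolomorphicForm Ω)
    (hpar : h.IsParallel Ω) {q : ℕ} {γ : ∀ x : X, PV 0 q (TX n x)} (hγ : PV.IsSmooth γ) (x : X) :
    del (fun x' => contractForm 0 q (Ω x') (γ x')) x = 0 := by
  obtain ⟨φ, hφ, hx⟩ : ∃ φ ∈ atlas (Fin n → ℂ) X, x ∈ φ.source :=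
    ⟨_, chart_mem_atlas _ x, mem_chart_source _ x⟩
  obtain ⟨y, hy, rfl⟩ : ∃ y ∈ φ.target, φ.symm y = x := ⟨φ x, φ.map_source hx, φ.left_inv hx⟩
  apply MF.transport_dChartInv_injective hφ hx
  have e2 := inChart_del_contractForm h hΩ hpar hγ hφ hy
  rw [MF.inChart] at e2
  rw [map_zero, e2,
    delCoord_contractForm_zero _ (diffAt_inChart_contractForm h hΩ hpar hγ hφ hy).1]

end Delta

/-! ### The isomorphism f in coordinates and its smoothness -/

section Flat

theorem transport_congr_transport {V W : Type*} [AddCommGroup V] [Module ℂ V] [AddCommGroup W]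
    [Module ℂ W] (e : V ≃ₗ[ℂ] CDual V) (p q : ℕ) (A : V →ₗ[ℂ] W) (B : W →ₗ[ℂ] V) (g : PV p q W) :
    DF.transport p q A B (TensorProduct.congr (extEquiv p e) (extEquiv q e.symm)
      (PV.transport p q B A g)) =
    TensorProduct.map (exteriorPower.map p (cpull B ∘ₗ e.toLinearMap ∘ₗ B))
      (exteriorPower.map q (A ∘ₗ e.symm.toLinearMap ∘ₗ cpull A)) g := by
  change TensorProduct.map (exteriorPower.map p (cpull B)) (exteriorPower.map q A)
    (TensorProduct.map (exteriorPower.map p e.toLinearMap) (exteriorPower.map q e.symm.toLinearMap)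
      (TensorProduct.map (exteriorPower.map p B) (exteriorPower.map q (cpull A)) g)) = _
  simp only [exteriorPower.map_comp, TensorProduct.map_comp, LinearMap.comp_apply]

variable {n : ℕ} {X : Type*} [TopologicalSpace X] [ChartedSpace (Fin n → ℂ) X]
  [IsManifold 𝓘(ℂ, Fin n → ℂ) ω X] {φ : OpenPartialHomeomorph X (Fin n → ℂ)}
  (h : KahlerMetric n X)

/-- The isomorphism `TX ≅ T̄^*X` in a chart. -/
def flatCoord (φ : OpenPartialHomeomorph X (Fin n → ℂ)) (y : Fin n → ℂ) :
    (Fin n → ℂ) →ₗ[ℂ] CDual (Fin n → ℂ) :=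
  cpull (dChartInv φ (φ.symm y)) ∘ₗ (h.flat (φ.symm y)).toLinearMap ∘ₗ dChartInv φ (φ.symm y)

/-- The inverse of `flatCoord`. -/
def sharpCoord (φ : OpenPartialHomeomorph X (Fin n → ℂ)) (y : Fin n → ℂ) :
    CDual (Fin n → ℂ) →ₗ[ℂ] (Fin n → ℂ) :=
  dChart φ (φ.symm y) ∘ₗ (h.flat (φ.symm y)).symm.toLinearMap ∘ₗ cpull (dChart φ (φ.symm y))

theorem flatCoord_apply (y u w : Fin n → ℂ) :
    flatCoord h φ y u w = metricInChart h.toFun φ u w y := rfl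

theorem flatCoord_sharpCoord (hφ : φ ∈ atlas (Fin n → ℂ) X) {y : Fin n → ℂ} (hy : y ∈ φ.target) :
    flatCoord h φ y ∘ₗ sharpCoord h φ y = LinearMap.id := by
  have hs := φ.map_target hy
  ext1 a
  have e1 := fun v => LinearMap.congr_fun (dChartInv_comp_dChart hφ hs) v
  have e2 := dChart_comp_dChartInv hφ hs
  simp only [LinearMap.comp_apply, LinearMap.id_apply] at e1
  simp only [flatCoord, sharpCoord, LinearMap.comp_apply, LinearEquiv.coe_coe, e1,
    LinearEquiv.apply_symm_apply, LinearMap.id_apply]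
  rw [← LinearMap.comp_apply, ← cpull_comp, e2, cpull_id, LinearMap.id_apply]

theorem sharpCoord_flatCoord (hφ : φ ∈ atlas (Fin n → ℂ) X) {y : Fin n → ℂ} (hy : y ∈ φ.target) :
    sharpCoord h φ y ∘ₗ flatCoord h φ y = LinearMap.id := by
  have hs := φ.map_target hy
  refine LinearMap.ext fun a => ?_
  have e1 := fun v => LinearMap.congr_fun (dChart_comp_dChartInv hφ hs) v
  have e2 := dChartInv_comp_dChart hφ hs
  have e3 : ∀ m, cpull (dChart φ (φ.symm y)) (cpull (dChartInv φ (φ.symm y)) m) = m := fun m => by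
    rw [← LinearMap.comp_apply, ← cpull_comp, e2, cpull_id, LinearMap.id_apply]
  simp only [LinearMap.comp_apply, LinearMap.id_apply] at e1
  simp only [flatCoord, sharpCoord, LinearMap.comp_apply, LinearEquiv.coe_coe, e3,
    LinearEquiv.symm_apply_apply, LinearMap.id_apply, e1]

theorem smoothOn_flatCoord (hφ : φ ∈ atlas (Fin n → ℂ) X) :
    SmoothOn (flatCoord h φ) φ.target := by
  refine smoothOn_hom fun a => ?_
  refine (SmoothOn.sum (s := Finset.univ) fun k _ => SmoothOn.smul (h.smooth φ hφ a (Pi.single k 1))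
    (smoothOn_const (covecBar k) _)).congr fun y _ => ?_
  conv_lhs => rw [cdual_eq_sum (flatCoord h φ y a)]
  rfl

/-- The Gram matrix of the coordinate frame. -/
def gramMatrix (φ : OpenPartialHomeomorph X (Fin n → ℂ)) (y : Fin n → ℂ) :
    Matrix (Fin n) (Fin n) ℂ :=
  Matrix.of fun j k => metricInChart h.toFun φ (Pi.single j 1) (Pi.single k 1) y

theorem isUnit_det_gramMatrix (hφ : φ ∈ atlas (Fin n → ℂ) X) {y : Fin n → ℂ} (hy : y ∈ φ.target) :
    IsUnit (gramMatrix h φ y).det := by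
  rw [isUnit_iff_ne_zero, show (gramMatrix h φ y).det = volDet h φ y from rfl, volDet_eq h hφ hy,
    Complex.ofReal_ne_zero]
  exact (volDensity_pos h hφ hy).ne'

/-- Cramer's rule: a determinant of smooth entries divided by the nowhere vanishing D. -/
theorem contDiffOn_inv_gramMatrix (hφ : φ ∈ atlas (Fin n → ℂ) X) (j k : Fin n) :
    ContDiffOn ℝ ∞ (fun y => (gramMatrix h φ y)⁻¹ j k) φ.target := by
  have e : ∀ y, (gramMatrix h φ y)⁻¹ j k = (volDet h φ y)⁻¹ *
      detRows n ((gramMatrix h φ y).updateRow k (Pi.single j 1)) := fun y => by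
    rw [Matrix.inv_def, Matrix.smul_apply, Matrix.adjugate_apply, Ring.inverse_eq_inv, smul_eq_mul]
    rfl
  simp only [e]
  refine ((volDet_contDiffOn h hφ).inv fun y hy => (isUnit_det_gramMatrix h hφ hy).ne_zero).mul
    ((detRows n).contDiff.comp_contDiffOn ?_)
  refine contDiffOn_pi.2 fun i => contDiffOn_pi.2 fun l => ?_
  by_cases hik : i = k
  · subst hik
    simpa using contDiffOn_const
  · simpa [Matrix.updateRow_apply, hik, gramMatrix] using h.smooth φ hφ _ _

/-- The abstract inverse is identified with the inverse Gram matrix by applying the injective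
`flatCoord`. Smoothness of the inverse isomorphism is read off from the entries. -/
theorem sharpCoord_apply (hφ : φ ∈ atlas (Fin n → ℂ) X) {y : Fin n → ℂ} (hy : y ∈ φ.target)
    (a : CDual (Fin n → ℂ)) : sharpCoord h φ y a =
      fun l => ∑ k, a (Pi.single k 1) * (gramMatrix h φ y)⁻¹ k l := by
  have hinj : Function.Injective (flatCoord h φ y) :=
    Function.LeftInverse.injective (g := sharpCoord h φ y) fun v =>
      LinearMap.congr_fun (sharpCoord_flatCoord h hφ hy) v
  apply hinj
  rw [← LinearMap.comp_apply, flatCoord_sharpCoord h hφ hy, LinearMap.id_apply]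
  set c : Fin n → ℂ := fun l => ∑ k, a (Pi.single k 1) * (gramMatrix h φ y)⁻¹ k l with hc
  have h1 : c = Matrix.vecMul (fun k => a (Pi.single k 1)) (gramMatrix h φ y)⁻¹ := rfl
  have h2 : ∀ j, flatCoord h φ y c (Pi.single j 1) = Matrix.vecMul c (gramMatrix h φ y) j := by
    intro j
    conv_lhs => rw [← sum_smul_single c]
    simp [flatCoord_apply, metricInChart, Matrix.vecMul, dotProduct, gramMatrix]
  rw [cdual_eq_sum a, cdual_eq_sum (flatCoord h φ y c)]
  refine Finset.sum_congr rfl fun j _ => ?_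
  rw [h2, h1, Matrix.vecMul_vecMul, Matrix.nonsing_inv_mul _ (isUnit_det_gramMatrix h hφ hy),
    Matrix.vecMul_one]

theorem smoothOn_sharpCoord (hφ : φ ∈ atlas (Fin n → ℂ) X) :
    SmoothOn (sharpCoord h φ) φ.target := by
  refine smoothOn_hom fun a => ?_
  refine (SmoothOn.sum (s := Finset.univ) fun l _ => SmoothOn.smul (U := φ.target)
    (u := fun y => ∑ k, a (Pi.single k 1) * (gramMatrix h φ y)⁻¹ k l) ?_
    (smoothOn_const (Pi.single l 1 : Fin n → ℂ) _)).congr fun y hy => ?_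
  · exact ContDiffOn.sum fun k _ => contDiffOn_const.mul (contDiffOn_inv_gramMatrix h hφ k l)
  · rw [sharpCoord_apply h hφ hy]
    exact (sum_smul_single _).symm

theorem inChart_f {p q : ℕ} (hφ : φ ∈ atlas (Fin n → ℂ) X) (γ : ∀ x : X, PV p q (TX n x))
    {y : Fin n → ℂ} (hy : y ∈ φ.target) :
    DF.inChart φ (fun x => h.f p q x (γ x)) y =
      TensorProduct.map (exteriorPower.map p (flatCoord h φ y))
        (exteriorPower.map q (sharpCoord h φ y)) (PV.inChart φ γ y) := by
  have hs := φ.map_target hy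
  obtain ⟨g, hg⟩ : ∃ g, γ (φ.symm y) =
      PV.transport p q (dChartInv φ (φ.symm y)) (dChart φ (φ.symm y)) g :=
    ⟨PV.inChart φ γ y, by
      rw [PV.inChart, PV.transport_transport, dChartInv_comp_dChart hφ hs, PV.transport_id]⟩
  rw [PV.inChart, hg, PV.transport_transport, dChart_comp_dChartInv hφ hs, PV.transport_id,
    DF.inChart, hg]
  exact transport_congr_transport (h.flat (φ.symm y)) p q _ _ g

theorem isSmooth_f {p q : ℕ} {γ : ∀ x : X, PV p q (TX n x)} (hγ : PV.IsSmooth γ) :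
    DF.IsSmooth (fun x => h.f p q x (γ x)) := fun φ hφ =>
  (SmoothOn.tensor_map_apply ((smoothOn_flatCoord h hφ).exteriorPower_map p)
    ((smoothOn_sharpCoord h hφ).exteriorPower_map q) (hγ φ hφ)).congr fun _ hy =>
      inChart_f h hφ γ hy

end Flat

/-! ### Independence of the integral from charts and from the partition of unity -/

section Integral

open MeasureTheory

variable {n : ℕ} {X : Type*} [TopologicalSpace X] [ChartedSpace (Fin n → ℂ) X]
  [IsManifold 𝓘(ℂ, Fin n → ℂ) ω X] {φ φ' : OpenPartialHomeomorph X (Fin n → ℂ)}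
  (h : KahlerMetric n X)

theorem metricInChart_transition (hφ : φ ∈ atlas (Fin n → ℂ) X) (hφ' : φ' ∈ atlas (Fin n → ℂ) X)
    {y : Fin n → ℂ} (hy : y ∈ overlap φ φ') (u v : Fin n → ℂ) :
    metricInChart h.toFun φ' u v y =
      metricInChart h.toFun φ (cderiv (fun z => φ (φ'.symm z)) y u)
        (cderiv (fun z => φ (φ'.symm z)) y v) (φ (φ'.symm y)) := by
  obtain ⟨hy1, hy2⟩ := mem_overlap.1 hy
  have e1 := fun v => LinearMap.congr_fun (dChartInv_comp_dChart hφ hy2) v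
  simp only [LinearMap.comp_apply, LinearMap.id_apply] at e1
  rw [← dChart_comp_dChartInv_eq hφ hφ' hy]
  simp only [metricInChart]
  rw [φ.left_inv hy2]
  simp only [LinearMap.comp_apply, e1]

/-- The Gram matrix changes by Jᵀ G J̄, so its determinant acquires the factor |det J|². -/
theorem volDensity_transition (hφ : φ ∈ atlas (Fin n → ℂ) X) (hφ' : φ' ∈ atlas (Fin n → ℂ) X)
    {y : Fin n → ℂ} (hy : y ∈ overlap φ φ') :
    h.volDensity φ' y = Complex.normSq (LinearMap.det (cderiv (fun z => φ (φ'.symm z)) y)) *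
      h.volDensity φ (φ (φ'.symm y)) := by
  obtain ⟨hy1, hy2⟩ := mem_overlap.1 hy
  set J := cderiv (fun z => φ (φ'.symm z)) y with hJ
  set M := LinearMap.toMatrix' J with hM
  have e : gramMatrix h φ' y = M.transpose * gramMatrix h φ (φ (φ'.symm y)) * M.map conj := by
    ext j k
    rw [gramMatrix, Matrix.of_apply, metricInChart_transition h hφ hφ' hy]
    conv_lhs => rw [← hJ, ← sum_smul_single (J (Pi.single j 1)), ← sum_smul_single (J (Pi.single k 1))]
    simp only [metricInChart, map_sum, LinearMap.sum_apply, map_smul, LinearMap.smul_apply,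
      LinearMap.map_smulₛₗ, Matrix.mul_apply, Matrix.transpose_apply, Matrix.map_apply, gramMatrix,
      Matrix.of_apply, hM, LinearMap.toMatrix'_apply, smul_eq_mul, Finset.sum_mul, Finset.mul_sum]
    refine Finset.sum_congr rfl fun i _ => Finset.sum_congr rfl fun l _ => ?_
    ring
  have h1 : volDet h φ' y = volDet h φ (φ (φ'.symm y)) * (Complex.normSq M.det : ℂ) := by
    change (gramMatrix h φ' y).det = (gramMatrix h φ _).det * _
    rw [e, Matrix.det_mul, Matrix.det_mul, Matrix.det_transpose, Complex.normSq_eq_conj_mul_self,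
      ← RingHom.mapMatrix_apply, ← RingHom.map_det]
    ring
  rw [volDet_eq h hφ' hy1, volDet_eq h hφ (φ.map_source hy2)] at h1
  rw [← LinearMap.det_toMatrix', ← hM, mul_comm]
  exact_mod_cast h1

/-- The real determinant of a complex-linear map is |det|², the same factor by which the density
changes. -/
theorem abs_det_fderiv_transition (hφ : φ ∈ atlas (Fin n → ℂ) X)
    (hφ' : φ' ∈ atlas (Fin n → ℂ) X) {y : Fin n → ℂ} (hy : y ∈ overlap φ φ') :
    DifferentiableAt ℝ (fun z => φ (φ'.symm z)) y ∧
    |(fderiv ℝ (fun z => φ (φ'.symm z)) y).det| =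
      Complex.normSq (LinearMap.det (cderiv (fun z => φ (φ'.symm z)) y)) := by
  have hψ : DifferentiableAt ℂ (fun z => φ (φ'.symm z)) y :=
    ((contDiffOn_transition hφ hφ').contDiffAt
      ((isOpen_overlap φ φ').mem_nhds hy)).differentiableAt (by simp)
  refine ⟨hψ.restrictScalars ℝ, ?_⟩
  rw [hψ.fderiv_restrictScalars ℝ]
  have : ((fderiv ℂ (fun z => φ (φ'.symm z)) y).restrictScalars ℝ).det =
      LinearMap.det ((cderiv (fun z => φ (φ'.symm z)) y).restrictScalars ℝ) := rfl
  rw [this, LinearMap.det_restrictScalars, Algebra.norm_complex_apply,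
    abs_of_nonneg (Complex.normSq_nonneg _)]

/-- The integral of a function supported in the domain of a chart, in that chart. -/
def chartIntegral (φ : OpenPartialHomeomorph X (Fin n → ℂ)) (w : X → ℂ) : ℂ :=
  ∫ y in φ.target, (h.volDensity φ y : ℂ) * w (φ.symm y)

/-- Outside the overlap the integrand vanishes. On the overlap the Jacobian of the change of
variables is absorbed by the transformation of the density. -/
theorem chartIntegral_eq (hφ : φ ∈ atlas (Fin n → ℂ) X) (hφ' : φ' ∈ atlas (Fin n → ℂ) X)
    {w : X → ℂ} (hw : ∀ x, w x ≠ 0 → x ∈ φ.source) (hw' : ∀ x, w x ≠ 0 → x ∈ φ'.source) :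
    chartIntegral h φ w = chartIntegral h φ' w := by
  have key : ∀ φ φ' : OpenPartialHomeomorph X (Fin n → ℂ), (∀ x, w x ≠ 0 → x ∈ φ.source) →
      chartIntegral h φ' w =
        ∫ y in overlap φ φ', (h.volDensity φ' y : ℂ) * w (φ'.symm y) := by
    intro φ φ' hw
    rw [chartIntegral]
    refine setIntegral_eq_of_subset_of_forall_sdiff_eq_zero φ'.open_target.measurableSet
      (fun y hy => (mem_overlap.1 hy).1) fun y hy => ?_
    by_cases h0 : w (φ'.symm y) = 0
    · rw [h0, mul_zero]
    · exact absurd (mem_overlap.2 ⟨hy.1, hw _ h0⟩) hy.2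
  have himg : (fun z => φ (φ'.symm z)) '' overlap φ φ' = overlap φ' φ := by
    ext z
    constructor
    · rintro ⟨y, hy, rfl⟩
      exact transition_mem_overlap hy
    · intro hz
      refine ⟨φ' (φ.symm z), transition_mem_overlap hz, ?_⟩
      obtain ⟨h1, h2⟩ := mem_overlap.1 hz
      simp only [φ'.left_inv h2, φ.right_inv h1]
  have hinj : InjOn (fun z => φ (φ'.symm z)) (overlap φ φ') := by
    intro y hy z hz hyz
    obtain ⟨h1, h2⟩ := mem_overlap.1 hy
    obtain ⟨h3, h4⟩ := mem_overlap.1 hz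
    exact φ'.symm.injOn h1 h3 (φ.injOn h2 h4 hyz)
  rw [key φ' φ hw', key φ φ' hw, ← himg, integral_image_eq_integral_abs_det_fderiv_smul volume
    (isOpen_overlap φ φ').measurableSet
    (fun y hy => (abs_det_fderiv_transition hφ hφ' hy).1.hasFDerivAt.hasFDerivWithinAt) hinj]
  refine setIntegral_congr_fun (isOpen_overlap φ φ').measurableSet fun y hy => ?_
  simp only [(abs_det_fderiv_transition hφ hφ' hy).2, volDensity_transition h hφ hφ' hy,
    φ.left_inv (mem_overlap.1 hy).2, Complex.real_smul, Complex.ofReal_mul, mul_assoc]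

theorem integrableOn_chart [CompactSpace X] [T2Space X] (hφ : φ ∈ atlas (Fin n → ℂ) X)
    {w : X → ℂ} (hw : Continuous w) (hs : tsupport w ⊆ φ.source) :
    IntegrableOn (fun y => (h.volDensity φ y : ℂ) * w (φ.symm y)) φ.target := by
  have hK : IsCompact (φ '' tsupport w) :=
    (isClosed_tsupport w).isCompact.image_of_continuousOn (φ.continuousOn.mono hs)
  have hKs : φ '' tsupport w ⊆ φ.target := by
    rintro _ ⟨x, hx, rfl⟩
    exact φ.map_source (hs hx)
  have hc : ContinuousOn (fun y => (h.volDensity φ y : ℂ) * w (φ.symm y)) φ.target :=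
    (Complex.continuous_ofReal.comp_continuousOn
      (Complex.continuous_re.comp_continuousOn (volDet_contDiffOn h hφ).continuousOn)).mul
      (hw.comp_continuousOn φ.symm.continuousOn)
  refine ((hc.mono hKs).integrableOn_compact hK).of_forall_sdiff_eq_zero
    φ.open_target.measurableSet fun y hy => ?_
  have : w (φ.symm y) = 0 := by
    by_contra h0
    exact hy.2 ⟨φ.symm y, subset_tsupport _ h0, φ.right_inv hy.1⟩
  rw [this, mul_zero]

theorem chartIntegral_sum [CompactSpace X] [T2Space X] (hφ : φ ∈ atlas (Fin n → ℂ) X)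
    {ι : Type*} (s : Finset ι) {w : ι → X → ℂ} (hw : ∀ i ∈ s, Continuous (w i))
    (hs : ∀ i ∈ s, tsupport (w i) ⊆ φ.source) :
    chartIntegral h φ (fun x => ∑ i ∈ s, w i x) = ∑ i ∈ s, chartIntegral h φ (w i) := by
  simp only [chartIntegral, Finset.mul_sum]
  exact integral_finsetSum s fun i hi => integrableOn_chart h hφ (hw i hi) (hs i hi)

variable [CompactSpace X] [T2Space X]

variable (n X) in
/-- The partition of unity that defines the integral. -/
def chartPartition : PartitionOfUnity X X := (exists_chartPartition n X).choose

variable (n X) in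
theorem chartPartition_subordinate (i : X) :
    tsupport (chartPartition n X i) ⊆ (chartAt (Fin n → ℂ) i).source :=
  (exists_chartPartition n X).choose_spec i

variable (n X) in
theorem chartPartition_finite : {i : X | (Function.support (chartPartition n X i)).Nonempty}.Finite :=
  (chartPartition n X).locallyFinite.finite_nonempty_of_compact

variable (n X) in
/-- The indices of the nonzero functions of `chartPartition`. -/
def chartIndices : Finset X := (chartPartition_finite n X).toFinset

theorem chartPartition_eq_zero {i : X} (hi : i ∉ chartIndices n X) (x : X) :
    chartPartition n X i x = 0 := by
  by_contra h0
  exact hi ((chartPartition_finite n X).mem_toFinset.2 ⟨x, h0⟩)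

theorem sum_chartPartition (x : X) : ∑ i ∈ chartIndices n X, chartPartition n X i x = 1 := by
  rw [← (chartPartition n X).sum_eq_one (mem_univ x)]
  refine (finsum_eq_sum_of_support_subset _ fun i hi => ?_).symm
  by_contra h0
  exact hi (chartPartition_eq_zero h0 x)

/-- On a compact space a locally finite family has only finitely many nonzero members, so the sum
over all points of X is an honest finite sum and not the default 0. -/
theorem KahlerMetric.integral_eq_sum (u : X → ℂ) : h.integral u = ∑ i ∈ chartIndices n X,
    chartIntegral h (chartAt (Fin n → ℂ) i) (fun x => (chartPartition n X i x : ℂ) * u x) := by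
  have e : h.integral u = ∑ᶠ i : X,
      chartIntegral h (chartAt (Fin n → ℂ) i) (fun x => (chartPartition n X i x : ℂ) * u x) := by
    refine finsum_congr fun i => ?_
    refine integral_congr_ae (Filter.Eventually.of_forall fun y => ?_)
    simp only [chartPartition, Complex.ofReal_mul]
    ring
  rw [e]
  refine finsum_eq_sum_of_support_subset _ fun i hi => ?_
  by_contra h0
  refine hi ?_
  simp only [chartPartition_eq_zero h0]
  simp [chartIntegral]

theorem continuous_partition_mul {u : X → ℂ} (hu : Continuous u) (i : X) :
    Continuous fun x => (chartPartition n X i x : ℂ) * u x :=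
  (Complex.continuous_ofReal.comp (chartPartition n X i).continuous).mul hu

theorem tsupport_partition_mul (u : X → ℂ) (i : X) :
    tsupport (fun x => (chartPartition n X i x : ℂ) * u x) ⊆
      (chartAt (Fin n → ℂ) i).source ∩ tsupport u := by
  refine subset_inter (Subset.trans (closure_mono fun x hx => ?_) (chartPartition_subordinate n X i))
    (tsupport_mul_subset_right)
  intro h0
  refine hx ?_
  simp only [h0, Complex.ofReal_zero, zero_mul]

theorem KahlerMetric.integral_sum {ι : Type*} (s : Finset ι) {u : ι → X → ℂ}
    (hu : ∀ i ∈ s, Continuous (u i)) :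
    h.integral (fun x => ∑ i ∈ s, u i x) = ∑ i ∈ s, h.integral (u i) := by
  simp only [h.integral_eq_sum, Finset.mul_sum]
  rw [Finset.sum_comm]
  refine Finset.sum_congr rfl fun i _ => ?_
  exact chartIntegral_sum h (chart_mem_atlas _ i) s
    (fun k hk => continuous_partition_mul (hu k hk) i)
    fun k _ => (tsupport_partition_mul _ i).trans inter_subset_left

/-- Insert ∑ ρᵢ = 1 into the integral over φ. Each ρᵢ u is supported in both φ and the i-th chart,
so its integral may be taken in either. -/
theorem KahlerMetric.integral_eq_chartIntegral (hφ : φ ∈ atlas (Fin n → ℂ) X) {u : X → ℂ} (hu : Continuous u)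
    (hs : tsupport u ⊆ φ.source) : h.integral u = chartIntegral h φ u := by
  rw [h.integral_eq_sum]
  have e : chartIntegral h φ u = chartIntegral h φ
      (fun x => ∑ i ∈ chartIndices n X, (chartPartition n X i x : ℂ) * u x) := by
    congr 1
    funext x
    rw [← Finset.sum_mul, ← Complex.ofReal_sum, sum_chartPartition, Complex.ofReal_one, one_mul]
  rw [e, chartIntegral_sum h hφ _ (fun i _ => continuous_partition_mul hu i)
    fun i _ => ((tsupport_partition_mul u i).trans inter_subset_right).trans hs]
  refine Finset.sum_congr rfl fun i _ => ?_
  exact chartIntegral_eq h (chart_mem_atlas _ i) hφ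
    (fun x hx => ((tsupport_partition_mul u i) (subset_tsupport _ hx)).1)
    (fun x hx => hs ((tsupport_partition_mul u i) (subset_tsupport _ hx)).2)

theorem KahlerMetric.integral_neg (u : X → ℂ) : h.integral (fun x => -u x) = -h.integral u := by
  simp only [h.integral_eq_sum, chartIntegral, mul_neg, MeasureTheory.integral_neg,
    Finset.sum_neg_distrib]

end Integral

/-! ### Vanishing integrals of divergences and the pointwise divergence identity -/

section Divergence

open MeasureTheory

variable {n : ℕ}

theorem contDiff_indicator {U K : Set (Fin n → ℂ)} (hU : IsOpen U) (hK : IsCompact K) (hKU : K ⊆ U)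
    {w : (Fin n → ℂ) → ℂ} (hw : ContDiffOn ℝ ∞ w U) (h0 : ∀ y ∈ U, y ∉ K → w y = 0) :
    ContDiff ℝ ∞ (U.indicator w) ∧ tsupport (U.indicator w) ⊆ K := by
  have hz : ∀ y, y ∉ K → U.indicator w y = 0 := fun y hy => by
    by_cases hyU : y ∈ U
    · rw [indicator_of_mem hyU, h0 y hyU hy]
    · exact indicator_of_notMem hyU _
  refine ⟨contDiff_iff_contDiffAt.2 fun y => ?_, closure_minimal (fun y hy => ?_) hK.isClosed⟩
  · by_cases hy : y ∈ K
    · refine (hw.contDiffAt (hU.mem_nhds (hKU hy))).congr_of_eventuallyEq ?_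
      filter_upwards [hU.mem_nhds (hKU hy)] with z hz
      exact indicator_of_mem hz _
    · refine (contDiffAt_const (c := (0 : ℂ))).congr_of_eventuallyEq ?_
      filter_upwards [hK.isClosed.isOpen_compl.mem_nhds hy] with z hy
      exact hz z hy
  · by_contra h1
    exact hy (hz y h1)

theorem integral_fderiv_eq_zero {w : (Fin n → ℂ) → ℂ} (hw : ContDiff ℝ ∞ w)
    (hc : HasCompactSupport w) (v : Fin n → ℂ) :
    Integrable (fun y => fderiv ℝ w y v) ∧ ∫ y, fderiv ℝ w y v = 0 := by
  have h1 : Integrable fun y => fderiv ℝ w y v :=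
    ((hw.continuous_fderiv (by simp)).clm_apply continuous_const).integrable_of_hasCompactSupport
      (hc.fderiv_apply (𝕜 := ℝ) v)
  refine ⟨h1, ?_⟩
  -- Integration by parts against the constant 1. Only the products have to be integrable, and they
  -- are because w has compact support.
  have := integral_mul_fderiv_eq_neg_fderiv_mul_of_integrable (𝕜 := ℂ) (μ := volume)
    (f := fun _ : Fin n → ℂ => (1 : ℂ)) (g := w) (v := v) (by simp)
    (by simpa using h1) (by simpa using hw.continuous.integrable_of_hasCompactSupport hc)
    (fun _ _ => differentiableAt_const _) (fun y _ => hw.differentiable (by simp) y)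
  simpa using this

/-- Extension by zero is smooth on all of ℂⁿ because w vanishes off a compact subset of U, so both
real directional derivatives integrate to zero. -/
theorem setIntegral_dbarDir_eq_zero {U K : Set (Fin n → ℂ)} (hU : IsOpen U) (hK : IsCompact K)
    (hKU : K ⊆ U) {w : (Fin n → ℂ) → ℂ} (hw : ContDiffOn ℝ ∞ w U)
    (h0 : ∀ y ∈ U, y ∉ K → w y = 0) (v : Fin n → ℂ) :
    IntegrableOn (fun y => dbarDir w y v) U ∧ ∫ y in U, dbarDir w y v = 0 := by
  obtain ⟨h1, h2⟩ := contDiff_indicator hU hK hKU hw h0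
  have hc : HasCompactSupport (U.indicator w) := hK.of_isClosed_subset (isClosed_tsupport _) h2
  have e : EqOn (fun y => dbarDir w y v) (fun y => dbarDir (U.indicator w) y v) U := by
    intro y hy
    refine dbarDir_congr ?_ v
    filter_upwards [hU.mem_nhds hy] with z hz
    exact (indicator_of_mem hz _).symm
  have e2 : (fun y => dbarDir (U.indicator w) y v) = fun y =>
      2⁻¹ * (fderiv ℝ (U.indicator w) y v +
        Complex.I * fderiv ℝ (U.indicator w) y (Complex.I • v)) :=
    funext fun y => dbarDir_scalar (h1.differentiable (by simp) y) v
  obtain ⟨i1, j1⟩ := integral_fderiv_eq_zero h1 hc v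
  obtain ⟨i2, j2⟩ := integral_fderiv_eq_zero h1 hc (Complex.I • v)
  have hint : Integrable fun y => dbarDir (U.indicator w) y v := by
    rw [e2]
    exact (i1.add (i2.const_mul _)).const_mul _
  refine ⟨hint.integrableOn.congr_fun e.symm hU.measurableSet, ?_⟩
  rw [setIntegral_congr_fun hU.measurableSet e, setIntegral_eq_integral_of_forall_compl_eq_zero, e2,
    integral_const_mul, integral_add i1 (i2.const_mul _), integral_const_mul, j1, j2]
  · ring
  · intro y hy
    have : U.indicator w =ᶠ[nhds y] fun _ => 0 := by
      filter_upwards [(isClosed_tsupport (U.indicator w)).isOpen_compl.mem_nhds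
        fun h => hy (hKU (h2 h))] with z hz
      exact image_eq_zero_of_notMem_tsupport hz
    rw [dbarDir_congr this, dbarDir_const]

theorem conj_delDir {u : (Fin n → ℂ) → ℂ} {y : Fin n → ℂ} (hu : DifferentiableAt ℝ u y)
    (hr : ∀ᶠ z in nhds y, conj (u z) = u z) (v : Fin n → ℂ) :
    conj (delDir u y v) = dbarDir u y v := by
  have e : ∀ v, conj (fderiv ℝ u y v) = fderiv ℝ u y v := fun v => by
    rw [← fderiv_conj hu]
    exact congrArg (fun L : (Fin n → ℂ) →L[ℝ] ℂ => L v) (Filter.EventuallyEq.fderiv_eq hr)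
  rw [delDir_scalar hu, dbarDir_scalar hu]
  simp only [map_mul, map_sub, map_inv₀, e, Complex.conj_I, Complex.conj_ofNat]
  ring

theorem dbarDir_mul {u v : (Fin n → ℂ) → ℂ} {y : Fin n → ℂ} (hu : DiffAt u y) (hv : DiffAt v y)
    (e : Fin n → ℂ) :
    dbarDir (fun z => u z * v z) y e = dbarDir u y e * v y + u y * dbarDir v y e :=
  dbarDir_bilinC hu hv (LinearMap.mul ℂ ℂ) e

theorem delDir_smul {E : Type*} [AddCommGroup E] [Module ℂ E] [Module.Finite ℂ E]
    {u : (Fin n → ℂ) → ℂ} {g : (Fin n → ℂ) → E} {y : Fin n → ℂ} (hu : DiffAt u y)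
    (hg : DiffAt g y) (v : Fin n → ℂ) :
    delDir (fun z => u z • g z) y v = delDir u y v • g y + u y • delDir g y v :=
  delDir_bilinC hu hg (LinearMap.lsmul ℂ E) v

/-- Since D is real, ∂̄D = D · conj(∂F / F). This conjugated factor enters the conjugate-linear slot
as ∂F / F, where it combines with ∂g into F⁻¹ ∂(F g). -/
theorem dbarDir_weighted_pairing {A G G' : Type*} [AddCommGroup A] [Module ℂ A]
    [Module.Finite ℂ A] [AddCommGroup G] [Module ℂ G] [Module.Finite ℂ G] [AddCommGroup G']
    [Module ℂ G'] [Module.Finite ℂ G'] (b : A →ₗ[ℂ] G' →ₗ⋆[ℂ] ℂ) (L : G →ₗ[ℂ] G')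
    {D F : (Fin n → ℂ) → ℂ} {a : (Fin n → ℂ) → A} {g : (Fin n → ℂ) → G} {y : Fin n → ℂ}
    (hD : DifferentiableAt ℝ D y) (hr : ∀ᶠ z in nhds y, conj (D z) = D z)
    (hF : DifferentiableAt ℝ F y) (hF0 : F y ≠ 0) (v : Fin n → ℂ)
    (hDF : D y * delDir F y v = F y * delDir D y v) (ha : DiffAt a y) (hg : DiffAt g y) :
    dbarDir (fun z => D z * b (a z) (L (g z))) y v = D y * (b (dbarDir a y v) (L (g y)) +
      b (a y) ((F y)⁻¹ • L (delDir (fun z => F z • g z) y v))) := by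
  have hL : DiffAt (fun z => L (g z)) y := hg.linC L
  have e1 : dbarDir D y v = D y * conj ((F y)⁻¹ * delDir F y v) := by
    rw [← conj_delDir hD hr]
    conv_rhs => rw [← hr.self_of_nhds, ← map_mul]
    congr 1
    rw [mul_left_comm, hDF, ← mul_assoc, inv_mul_cancel₀ hF0, one_mul]
  rw [dbarDir_mul (diffAt_scalar.2 hD) (ha.sesq hL b), dbarDir_sesq ha hL b, delDir_linC hg L, e1,
    delDir_smul (diffAt_scalar.2 hF) hg]
  simp only [map_add, map_smul, LinearMap.map_smulₛₗ, smul_eq_mul, map_mul, map_inv₀]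
  have : conj (F y) ≠ 0 := (map_ne_zero _).2 hF0
  field_simp
  ring

/-- Sum the weighted product rule over j, with dz_j ⌟ on g moved to dz̄_j ∧ on the derivative of a.
The terms assemble into ∂̄a and Δg. -/
theorem divergence_identity {p q : ℕ} {D F : (Fin n → ℂ) → ℂ}
    {a : (Fin n → ℂ) → DF p q (Fin n → ℂ)} {g : (Fin n → ℂ) → PV (p + 1) q (Fin n → ℂ)}
    {y : Fin n → ℂ} (hD : DifferentiableAt ℝ D y) (hr : ∀ᶠ z in nhds y, conj (D z) = D z)
    (hF : DifferentiableAt ℝ F y) (hF0 : F y ≠ 0)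
    (hDF : ∀ v, D y * delDir F y v = F y * delDir D y v) (ha : DiffAt a y) (hg : DiffAt g y) :
    D y * (pairing n (p + 1) q (dbarCoord a y) (g y) + pairing n p q (a y) (deltaCoord F g y)) =
      ∑ j, dbarDir (fun z => D z * pairing n p q (a z) (PV.interior p q (covec j) (g z))) y
        (Pi.single j 1) := by
  have e1 := fun j => dbarDir_weighted_pairing (G' := PV p q (Fin n → ℂ))
    (pairing n p q) (PV.interior p q (covec j)) hD hr hF
    hF0 (Pi.single j 1) (hDF _) ha hg
  have e2 : ∀ j, pairing n (p + 1) q (TensorProduct.map (wedgeLeft p (covecBar j)) LinearMap.id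
      (dbarDir a y (Pi.single j 1))) (g y) =
      pairing n p q (dbarDir a y (Pi.single j 1)) (PV.interior p q (covec j) (g y)) := fun j =>
    pairing_wedge n p q (covec j) _ _
  rw [Finset.sum_congr rfl fun j _ => e1 j, ← Finset.mul_sum, Finset.sum_add_distrib, dbarCoord,
    deltaCoord, map_sum, LinearMap.sum_apply, Finset.sum_congr rfl fun j _ => e2 j,
    Finset.smul_sum, map_sum]

end Divergence

/-! ### The integral identity (∂̄α, f γ) = -(α, f Δγ) -/

section Adjoint

open MeasureTheory

variable {n : ℕ} {X : Type*} [TopologicalSpace X] [ChartedSpace (Fin n → ℂ) X]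
  {φ φ' : OpenPartialHomeomorph X (Fin n → ℂ)}

theorem continuous_of_charts {u : X → ℂ}
    (hu : ∀ φ ∈ atlas (Fin n → ℂ) X, ContinuousOn (fun y => u (φ.symm y)) φ.target) :
    Continuous u := by
  refine continuous_iff_continuousAt.2 fun x => ?_
  set φ := chartAt (Fin n → ℂ) x
  have hx : x ∈ φ.source := mem_chart_source _ x
  have h1 : ContinuousAt (fun y => u (φ.symm y)) (φ x) :=
    (hu φ (chart_mem_atlas _ x)).continuousAt (φ.open_target.mem_nhds (φ.map_source hx))
  refine (ContinuousAt.comp h1 (φ.continuousAt hx)).congr ?_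
  filter_upwards [φ.open_source.mem_nhds hx] with z hz
  simp only [Function.comp_apply, φ.left_inv hz]

/-- Locality: the complement of S is open, so α vanishes in a whole neighbourhood of x. -/
theorem dbar_eq_zero {p q : ℕ} {α : ∀ x : X, DF p q (TX n x)} {S : Set X} (hS : IsClosed S)
    (h0 : ∀ x, x ∉ S → α x = 0) {x : X} (hx : x ∉ S) : dbar α x = 0 := by
  have hs : x ∈ (chartAt (Fin n → ℂ) x).source := mem_chart_source _ x
  have h1 : DF.inChart (chartAt (Fin n → ℂ) x) α =ᶠ[nhds (chartAt (Fin n → ℂ) x x)] fun _ => 0 := by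
    have h2 := ((chartAt (Fin n → ℂ) x).continuousAt_symm
      ((chartAt (Fin n → ℂ) x).map_source hs)).preimage_mem_nhds
      (t := Sᶜ) (by rw [(chartAt (Fin n → ℂ) x).left_inv hs]; exact hS.isOpen_compl.mem_nhds hx)
    filter_upwards [h2] with y hy
    rw [DF.inChart, h0 _ hy, map_zero]
  simp only [dbar, dzbarVec_eq, dbarDir_congr h1, dbarDir_const, map_zero, Finset.sum_const_zero]

theorem dbar_sum {p q : ℕ} {ι : Type*} (s : Finset ι) {α : ι → ∀ x : X, DF p q (TX n x)}
    (hα : ∀ i ∈ s, DF.IsSmooth (α i)) (x : X) :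
    dbar (fun x => ∑ i ∈ s, α i x) x = ∑ i ∈ s, dbar (α i) x := by
  classical
  have hy : chartAt (Fin n → ℂ) x x ∈ (chartAt (Fin n → ℂ) x).target := mem_chart_target _ x
  have hd : ∀ i ∈ s, DiffAt (DF.inChart (chartAt (Fin n → ℂ) x) (α i)) (chartAt (Fin n → ℂ) x x) :=
    fun i hi => (hα i hi _ (chart_mem_atlas _ x)).diffAt (chartAt (Fin n → ℂ) x).open_target hy
  have e : DF.inChart (chartAt (Fin n → ℂ) x) (fun x => ∑ i ∈ s, α i x) =
      fun y => ∑ i ∈ s, DF.inChart (chartAt (Fin n → ℂ) x) (α i) y := by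
    funext y
    simp only [DF.inChart, map_sum]
  have e2 : ∀ v, dbarDir (fun y => ∑ i ∈ s, DF.inChart (chartAt (Fin n → ℂ) x) (α i) y)
      (chartAt (Fin n → ℂ) x x) v =
      ∑ i ∈ s, dbarDir (DF.inChart (chartAt (Fin n → ℂ) x) (α i)) (chartAt (Fin n → ℂ) x x) v := by
    intro v
    clear e
    induction s using Finset.induction_on with
    | empty => simp only [Finset.sum_empty, dbarDir_const]
    | insert i s hi ih =>
      simp only [Finset.sum_insert hi]
      rw [dbarDir_add (hd i (Finset.mem_insert_self _ _))
        (diffAt_sum fun j hj => hd j (Finset.mem_insert_of_mem hj)),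
        ih (fun j hj => hα j (Finset.mem_insert_of_mem hj))
          fun j hj => hd j (Finset.mem_insert_of_mem hj)]
  simp only [dbar, dzbarVec_eq, e, e2, map_sum]
  rw [Finset.sum_comm]

variable [IsManifold 𝓘(ℂ, Fin n → ℂ) ω X]

theorem inChart_dbar_of_smooth {p q : ℕ} {α : ∀ x : X, DF p q (TX n x)} (hα : DF.IsSmooth α)
    (hφ : φ ∈ atlas (Fin n → ℂ) X) {y : Fin n → ℂ} (hy : y ∈ φ.target) :
    DF.inChart φ (dbar α) y = dbarCoord (DF.inChart φ α) y :=
  inChart_dbar hφ α hy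
    ((hα _ (chart_mem_atlas _ _)).diffAt (chartAt (Fin n → ℂ) _).open_target (mem_chart_target _ _))
    ((hα φ hφ).diffAt φ.open_target hy)

theorem isSmooth_dbar {p q : ℕ} {α : ∀ x : X, DF p q (TX n x)} (hα : DF.IsSmooth α) :
    DF.IsSmooth (dbar α) := fun φ hφ =>
  (SmoothOn.sum (s := Finset.univ) fun j _ => by
    have h1 := (hα φ hφ).dbarDir φ.open_target (Pi.single j 1)
    exact SmoothOn.linC (G := DF (p + 1) q (Fin n → ℂ)) h1
      (TensorProduct.map (wedgeLeft p (covecBar j)) LinearMap.id)).congr fun y hy =>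
        inChart_dbar_of_smooth hα hφ hy

theorem isSmooth_smul {p q : ℕ} {α : ∀ x : X, DF p q (TX n x)} (hα : DF.IsSmooth α) {u : X → ℝ}
    (hu : ∀ φ ∈ atlas (Fin n → ℂ) X, ContDiffOn ℝ ∞ (fun y => u (φ.symm y)) φ.target) :
    DF.IsSmooth (fun x => (u x : ℂ) • α x) := fun φ hφ =>
  (SmoothOn.smul (u := fun y => (u (φ.symm y) : ℂ))
    (Complex.ofRealCLM.contDiff.comp_contDiffOn (hu φ hφ)) (hα φ hφ)).congr fun y _ => by
      simp only [DF.inChart, map_smul]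

variable (n X) in
-- Cut-off functions are not holomorphic. They live on the underlying real smooth manifold.
theorem isManifold_real : IsManifold 𝓘(ℝ, Fin n → ℂ) ∞ X := by
  refine isManifold_of_contDiffOn _ _ _ fun e e' he he' => ?_
  have h1 := ((contDiffOn_transition he' he).restrict_scalars ℝ).of_le
    (show (∞ : WithTop ℕ∞) ≤ ω from le_top)
  refine h1.mono ?_
  rintro y ⟨hy, -⟩
  exact hy

theorem contDiffOn_of_contMDiff {u : X → ℝ} (hu : ContMDiff 𝓘(ℝ, Fin n → ℂ) 𝓘(ℝ) ∞ u)
    (hφ : φ ∈ atlas (Fin n → ℂ) X) : ContDiffOn ℝ ∞ (fun y => u (φ.symm y)) φ.target := by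
  have := isManifold_real n X
  exact contMDiffOn_iff_contDiffOn.1 (hu.comp_contMDiffOn
    (contMDiffOn_symm_of_mem_maximalAtlas (IsManifold.subset_maximalAtlas hφ)))

variable (n X) in
-- The partition that defines the integral is merely continuous. Multiplying α before ∂̄ is applied
-- requires a smooth one.
theorem exists_smooth_partition [CompactSpace X] [T2Space X] :
    ∃ (s : Finset X) (χ : X → X → ℝ),
      (∀ i, ∀ φ ∈ atlas (Fin n → ℂ) X, ContDiffOn ℝ ∞ (fun y => χ i (φ.symm y)) φ.target) ∧
      (∀ i, tsupport (χ i) ⊆ (chartAt (Fin n → ℂ) i).source) ∧ ∀ x, ∑ i ∈ s, χ i x = 1 := by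
  have := isManifold_real n X
  obtain ⟨f, hf⟩ := SmoothPartitionOfUnity.exists_isSubordinate_chartAt_source
    𝓘(ℝ, Fin n → ℂ) X
  have hfin := f.locallyFinite.finite_nonempty_of_compact
  refine ⟨hfin.toFinset, fun i => f i, fun i φ hφ => contDiffOn_of_contMDiff (f i).contMDiff hφ, hf,
    fun x => ?_⟩
  rw [← f.sum_eq_one (mem_univ x)]
  refine (finsum_eq_sum_of_support_subset _ fun i hi => ?_).symm
  rw [Finset.mem_coe, hfin.mem_toFinset]
  exact ⟨x, hi⟩

variable (h : KahlerMetric n X)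

/-- The function `⟨α, f γ⟩`. -/
def pairFun {p q : ℕ} (α : ∀ x : X, DF p q (TX n x)) (γ : ∀ x : X, PV p q (TX n x)) (x : X) : ℂ :=
  h.dfForm p q x (α x) (h.f p q x (γ x))

theorem pairFun_inChart {p q : ℕ} (α : ∀ x : X, DF p q (TX n x)) (γ : ∀ x : X, PV p q (TX n x))
    (hφ : φ ∈ atlas (Fin n → ℂ) X) {y : Fin n → ℂ} (hy : y ∈ φ.target) :
    pairFun h α γ (φ.symm y) = pairing n p q (DF.inChart φ α y) (PV.inChart φ γ y) :=
  dfFormOf_fOf_eq_pairing (h.toFun _) (h.symm _) (h.pos _) p q _ _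
    (dChartInv_comp_dChart hφ (φ.map_target hy)) _ _

theorem contDiffOn_pairing {p q : ℕ} {a : (Fin n → ℂ) → DF p q (Fin n → ℂ)}
    {g : (Fin n → ℂ) → PV p q (Fin n → ℂ)} {U : Set (Fin n → ℂ)} (ha : SmoothOn a U)
    (hg : SmoothOn g U) : ContDiffOn ℝ ∞ (fun y => pairing n p q (a y) (g y)) U :=
  smoothOn_scalar.1 (ha.sesq hg (pairing n p q))

theorem continuous_pairFun {p q : ℕ} {α : ∀ x : X, DF p q (TX n x)}
    {γ : ∀ x : X, PV p q (TX n x)} (hα : DF.IsSmooth α) (hγ : PV.IsSmooth γ) :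
    Continuous (pairFun h α γ) :=
  continuous_of_charts fun φ hφ =>
    (contDiffOn_pairing (hα φ hφ) (hγ φ hφ)).continuousOn.congr fun _ hy =>
      pairFun_inChart h α γ hφ hy

theorem tsupport_pairFun {p q : ℕ} {α : ∀ x : X, DF p q (TX n x)} (γ : ∀ x : X, PV p q (TX n x))
    {S : Set X} (hS : IsClosed S) (h0 : ∀ x, x ∉ S → α x = 0) : tsupport (pairFun h α γ) ⊆ S := by
  refine closure_minimal (fun x hx => ?_) hS
  by_contra hxS
  refine hx ?_
  rw [pairFun, h0 x hxS, map_zero, LinearMap.zero_apply]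

variable [CompactSpace X] [T2Space X] {Ω : ∀ x : X, ⋀[ℂ]^n (Module.Dual ℂ (TX n x))}

theorem integral_pairFun {p q : ℕ} {α : ∀ x : X, DF p q (TX n x)} {γ : ∀ x : X, PV p q (TX n x)}
    (hα : DF.IsSmooth α) (hγ : PV.IsSmooth γ) (hφ : φ ∈ atlas (Fin n → ℂ) X) {S : Set X}
    (hS : IsClosed S) (hSφ : S ⊆ φ.source) (h0 : ∀ x, x ∉ S → α x = 0) :
    h.integral (pairFun h α γ) = ∫ y in φ.target, (volDet h φ y) *
      pairing n p q (DF.inChart φ α y) (PV.inChart φ γ y) ∧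
    IntegrableOn (fun y => (volDet h φ y) *
      pairing n p q (DF.inChart φ α y) (PV.inChart φ γ y)) φ.target := by
  have hs := (tsupport_pairFun h γ hS h0).trans hSφ
  have hc := continuous_pairFun h hα hγ
  have e : EqOn (fun y => (h.volDensity φ y : ℂ) * pairFun h α γ (φ.symm y)) (fun y => volDet h φ y *
      pairing n p q (DF.inChart φ α y) (PV.inChart φ γ y)) φ.target := fun y hy => by
    simp only [pairFun_inChart h α γ hφ hy, volDet_eq h hφ hy]
  refine ⟨?_, (integrableOn_chart h hφ hc hs).congr_fun e φ.open_target.measurableSet⟩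
  rw [h.integral_eq_chartIntegral hφ hc hs, chartIntegral,
    setIntegral_congr_fun φ.open_target.measurableSet e]

/-- Both integrals are computed in the chart φ, where the sum of the integrands is a divergence of
functions vanishing off the compact set φ(S). -/
theorem integral_dbar_of_support (hΩ : IsHolomorphicForm Ω) (hne : ∀ x, Ω x ≠ 0)
    (hpar : h.IsParallel Ω) {p q : ℕ} {α : ∀ x : X, DF p q (TX n x)}
    {γ : ∀ x : X, PV (p + 1) q (TX n x)} (hα : DF.IsSmooth α) (hγ : PV.IsSmooth γ)
    (hφ : φ ∈ atlas (Fin n → ℂ) X) {S : Set X} (hS : IsClosed S) (hSφ : S ⊆ φ.source)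
    (h0 : ∀ x, x ∉ S → α x = 0) :
    h.integral (pairFun h (dbar α) γ) = -h.integral (pairFun h α (Delta Ω γ)) := by
  obtain ⟨e1, i1⟩ := integral_pairFun h (isSmooth_dbar hα) hγ hφ hS hSφ
    fun x hx => dbar_eq_zero hS h0 hx
  obtain ⟨e2, i2⟩ := integral_pairFun h hα (isSmooth_Delta h hΩ hne hpar hγ) hφ hS hSφ h0
  rw [← add_eq_zero_iff_eq_neg, e1, e2, ← integral_add i1 i2]
  have hD := volDet_contDiffOn h hφ
  have hF := topCoeff_contDiffOn h hΩ hpar hφ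
  have key : EqOn (fun y => volDet h φ y * pairing n (p + 1) q (DF.inChart φ (dbar α) y)
        (PV.inChart φ γ y) + volDet h φ y * pairing n p q (DF.inChart φ α y)
        (PV.inChart φ (Delta Ω γ) y))
      (fun y => ∑ j, dbarDir (fun z => volDet h φ z * pairing n p q (DF.inChart φ α z)
        (PV.interior p q (covec j) (PV.inChart φ γ z))) y (Pi.single j 1)) φ.target := by
    intro y hy
    have hn := φ.open_target.mem_nhds hy
    simp only
    rw [← mul_add, inChart_dbar_of_smooth hα hφ hy, inChart_Delta h hΩ hne hpar hγ hφ hy]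
    refine divergence_identity ((hD.contDiffAt hn).differentiableAt (by simp)) ?_
      ((hF.contDiffAt hn).differentiableAt (by simp)) (topCoeff_ne_zero hne hφ hy)
      (topCoeff_volDet h hΩ hpar hφ hy) ((hα φ hφ).diffAt φ.open_target hy)
      ((hγ φ hφ).diffAt φ.open_target hy)
    filter_upwards [hn] with z hz
    rw [volDet_eq h hφ hz, Complex.conj_ofReal]
  rw [setIntegral_congr_fun φ.open_target.measurableSet key]
  have hK : IsCompact (φ '' S) := hS.isCompact.image_of_continuousOn (φ.continuousOn.mono hSφ)
  have hKs : φ '' S ⊆ φ.target := by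
    rintro _ ⟨x, hx, rfl⟩
    exact φ.map_source (hSφ hx)
  have hz : ∀ j : Fin n, _ := fun j => setIntegral_dbarDir_eq_zero φ.open_target hK hKs
    (w := fun z => volDet h φ z * pairing n p q (DF.inChart φ α z)
        (PV.interior p q (covec j) (PV.inChart φ γ z)))
    (hD.mul (contDiffOn_pairing (hα φ hφ) (SmoothOn.linC (G := PV p q (Fin n → ℂ)) (hγ φ hφ)
      (PV.interior p q (covec j)))))
    (fun y hy hyK => by
      have : α (φ.symm y) = 0 := h0 _ fun h1 => hyK ⟨_, h1, φ.right_inv hy⟩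
      simp only [DF.inChart, this, map_zero, LinearMap.zero_apply, mul_zero]) (Pi.single j 1)
  rw [integral_finsetSum _ fun j _ => (hz j).1]
  exact Finset.sum_eq_zero fun j _ => (hz j).2

/-- `(∂̄α, f γ) = -(α, f (Δγ))`. -/
theorem integral_dbar (hΩ : IsHolomorphicForm Ω) (hne : ∀ x, Ω x ≠ 0)
    (hpar : h.IsParallel Ω) {p q : ℕ} {α : ∀ x : X, DF p q (TX n x)}
    {γ : ∀ x : X, PV (p + 1) q (TX n x)} (hα : DF.IsSmooth α) (hγ : PV.IsSmooth γ) :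
    h.integral (pairFun h (dbar α) γ) = -h.integral (pairFun h α (Delta Ω γ)) := by
  obtain ⟨s, χ, hχ, hsupp, hsum⟩ := exists_smooth_partition n X
  -- Both sides are additive in α, so it is enough to treat the pieces χᵢ α. No derivative of χᵢ has
  -- to be computed, because each piece is inserted whole into ∂̄.
  have hαi : ∀ i, DF.IsSmooth fun x => (χ i x : ℂ) • α x := fun i => isSmooth_smul hα (hχ i)
  have e : α = fun x => ∑ i ∈ s, (χ i x : ℂ) • α x := by
    funext x
    rw [← Finset.sum_smul, ← Complex.ofReal_sum, hsum, Complex.ofReal_one, one_smul]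
  have e1 : pairFun h (dbar α) γ = fun x => ∑ i ∈ s,
      pairFun h (dbar fun x => (χ i x : ℂ) • α x) γ x := by
    funext x
    conv_lhs => rw [e]
    simp only [pairFun, dbar_sum s (fun i _ => hαi i), map_sum, LinearMap.sum_apply]
  have e2 : pairFun h α (Delta Ω γ) = fun x => ∑ i ∈ s,
      pairFun h (fun x => (χ i x : ℂ) • α x) (Delta Ω γ) x := by
    funext x
    conv_lhs => rw [e]
    simp only [pairFun, map_sum, LinearMap.sum_apply]
  rw [e1, e2, h.integral_sum s fun i _ => continuous_pairFun h (isSmooth_dbar (hαi i)) hγ,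
    h.integral_sum s fun i _ => continuous_pairFun h (hαi i) (isSmooth_Delta h hΩ hne hpar hγ),
    ← Finset.sum_neg_distrib]
  refine Finset.sum_congr rfl fun i _ => ?_
  refine integral_dbar_of_support h hΩ hne hpar (hαi i) hγ (chart_mem_atlas _ i)
    (isClosed_tsupport (χ i)) (hsupp i) fun x hx => ?_
  rw [image_eq_zero_of_notMem_tsupport hx, Complex.ofReal_zero, zero_smul]

end Adjoint

/-! ### Signs under f and the metric -/

section Neg

variable {n : ℕ} {X : Type*} [TopologicalSpace X] [ChartedSpace (Fin n → ℂ) X]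
  (h : KahlerMetric n X)

theorem KahlerMetric.f_neg {p q : ℕ} {x : X} (a : PV p q (TX n x)) :
    h.f p q x (-a) = -h.f p q x a :=
  LinearMap.map_neg (M := PV p q (TX n x)) (M₂ := DF p q (TX n x)) (h.f p q x).toLinearMap a

theorem KahlerMetric.pairing_f_neg {p q : ℕ} {x : X} (a : DF p q (TX n x)) (b : PV p q (TX n x)) :
    h.dfForm p q x a (h.f p q x (-b)) = -h.dfForm p q x a (h.f p q x b) := by
  rw [h.f_neg]
  exact LinearMap.map_neg (M := DF p q (TX n x)) (h.dfForm p q x a) _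

end Neg

/-! ### Test sections and uniqueness of the formal adjoint -/

section Uniqueness

open MeasureTheory

variable {n : ℕ} {X : Type*} [TopologicalSpace X] [ChartedSpace (Fin n → ℂ) X]
  [IsManifold 𝓘(ℂ, Fin n → ℂ) ω X] {φ φ' : OpenPartialHomeomorph X (Fin n → ℂ)}
  (h : KahlerMetric n X)

/-- Every candidate for the adjoint becomes f of a smooth polyvector field, so uniqueness can be
tested with the metric-free pairing. -/
theorem isSmooth_f_symm {p q : ℕ} {σ : ∀ x : X, DF p q (TX n x)} (hσ : DF.IsSmooth σ) :
    PV.IsSmooth (fun x => (h.f p q x).symm (σ x)) := fun φ hφ =>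
  (SmoothOn.tensor_map_apply ((smoothOn_sharpCoord h hφ).exteriorPower_map p)
    ((smoothOn_flatCoord h hφ).exteriorPower_map q) (hσ φ hφ)).congr fun y hy => by
      have h1 := inChart_f h hφ (fun x => (h.f p q x).symm (σ x)) hy
      simp only [LinearEquiv.apply_symm_apply] at h1
      rw [h1, ← LinearMap.comp_apply, ← TensorProduct.map_comp, ← exteriorPower.map_comp,
        ← exteriorPower.map_comp, sharpCoord_flatCoord h hφ hy, flatCoord_sharpCoord h hφ hy,
        exteriorPower.map_id, exteriorPower.map_id, TensorProduct.map_id, LinearMap.id_apply]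

/-- The section with coordinate expression `χ a`, extended by zero. -/
def testSection {p q : ℕ} (φ : OpenPartialHomeomorph X (Fin n → ℂ)) (χ : (Fin n → ℂ) → ℝ)
    (a : DF p q (Fin n → ℂ)) (x : X) : DF p q (TX n x) :=
  ((φ.source.indicator (fun x => χ (φ x)) x : ℝ) : ℂ) •
    DF.transport p q (dChartInv φ x) (dChart φ x) a

theorem inChart_testSection {p q : ℕ} (hφ : φ ∈ atlas (Fin n → ℂ) X) (χ : (Fin n → ℂ) → ℝ)
    (a : DF p q (Fin n → ℂ)) {y : Fin n → ℂ} (hy : y ∈ φ.target) :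
    DF.inChart φ (testSection φ χ a) y = (χ y : ℂ) • a := by
  have hs := φ.map_target hy
  rw [DF.inChart, testSection, map_smul, DF.transport_transport, dChart_comp_dChartInv hφ hs,
    DF.transport_id, indicator_of_mem hs, φ.right_inv hy]

theorem testSection_eq_zero {p q : ℕ} {χ : (Fin n → ℂ) → ℝ} (a : DF p q (Fin n → ℂ)) {x : X}
    (hx : x ∉ φ.symm '' tsupport χ) : testSection φ χ a x = 0 := by
  have : φ.source.indicator (fun x => χ (φ x)) x = 0 := by
    by_cases hs : x ∈ φ.source
    · rw [indicator_of_mem hs]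
      exact image_eq_zero_of_notMem_tsupport fun h1 => hx ⟨_, h1, φ.left_inv hs⟩
    · exact indicator_of_notMem hs _
  rw [testSection, this, Complex.ofReal_zero, zero_smul]

/-- Near the support the expression in another chart is a smooth transform of χ a. Elsewhere it is
locally zero, because the support is compact in a Hausdorff space and therefore closed. -/
theorem isSmooth_testSection [T2Space X] {p q : ℕ} (hφ : φ ∈ atlas (Fin n → ℂ) X)
    {χ : (Fin n → ℂ) → ℝ} (hχ : ContDiff ℝ ∞ χ) (hc : HasCompactSupport χ)
    (hs : tsupport χ ⊆ φ.target) (a : DF p q (Fin n → ℂ)) :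
    DF.IsSmooth (testSection φ χ a : ∀ x : X, DF p q (TX n x)) := by
  intro φ' hφ' l y hy
  refine ContDiffAt.contDiffWithinAt ?_
  have hS : IsClosed (φ.symm '' tsupport χ) :=
    (hc.isCompact.image_of_continuousOn (φ.continuousOn_symm.mono hs)).isClosed
  by_cases hyS : φ'.symm y ∈ φ.symm '' tsupport χ
  · have hyo : y ∈ overlap φ φ' := by
      obtain ⟨z, hz, hzy⟩ := hyS
      exact mem_overlap.2 ⟨hy, hzy ▸ φ.map_target (hs hz)⟩
    have hψ := contDiffOn_transition hφ hφ'
    have hψr : ContDiffOn ℝ ∞ (fun z => φ (φ'.symm z)) (overlap φ φ') :=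
      (hψ.restrict_scalars ℝ).of_le le_top
    have h1 : SmoothOn (cderiv fun z => φ' (φ.symm z)) (overlap φ' φ) :=
      smoothOn_cderiv (isOpen_overlap φ' φ) (contDiffOn_transition hφ' hφ)
    have h2 : SmoothOn (fun z => cderiv (fun z => φ' (φ.symm z)) (φ (φ'.symm z)))
        (overlap φ φ') := h1.comp_smooth hψr fun z hz => transition_mem_overlap hz
    have h3 : SmoothOn (fun z => ((χ (φ (φ'.symm z)) : ℝ) : ℂ) • a) (overlap φ φ') :=
      SmoothOn.smul (u := fun z => ((χ (φ (φ'.symm z)) : ℝ) : ℂ))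
        (Complex.ofRealCLM.contDiff.comp_contDiffOn (hχ.comp_contDiffOn hψr)) (smoothOn_const a _)
    have h4 : SmoothOn (DF.inChart φ' (testSection φ χ a)) (overlap φ φ') :=
      (h2.df_transport (smoothOn_cderiv (isOpen_overlap φ φ') hψ) h3).congr fun z hz => by
        rw [DF.inChart_eq hφ hφ' _ hz,
          inChart_testSection hφ χ a (φ.map_source (mem_overlap.1 hz).2)]
    exact (h4 l).contDiffAt ((isOpen_overlap φ φ').mem_nhds hyo)
  · refine (contDiffAt_const (c := (0 : ℂ))).congr_of_eventuallyEq ?_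
    filter_upwards [(φ'.continuousAt_symm hy).preimage_mem_nhds (hS.isOpen_compl.mem_nhds hyS)]
      with z hz
    rw [DF.inChart, testSection_eq_zero a hz, map_zero, map_zero]

variable [CompactSpace X] [T2Space X]

/-- Fundamental lemma of the calculus of variations: testing against χ a for every bump χ in a chart
forces D times the difference of the pairings to vanish there. Then D ≠ 0 and nondegeneracy of the
pairing give the equality. -/
theorem eq_of_integral_pairFun_eq {p q : ℕ} {γ γ' : ∀ x : X, PV p q (TX n x)}
    (hγ : PV.IsSmooth γ) (hγ' : PV.IsSmooth γ')
    (heq : ∀ α : ∀ x : X, DF p q (TX n x), DF.IsSmooth α →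
      h.integral (pairFun h α γ) = h.integral (pairFun h α γ')) : γ = γ' := by
  funext x
  obtain ⟨φ, hφ, hx⟩ : ∃ φ ∈ atlas (Fin n → ℂ) X, x ∈ φ.source :=
    ⟨_, chart_mem_atlas _ x, mem_chart_source _ x⟩
  obtain ⟨y, hy, rfl⟩ : ∃ y ∈ φ.target, φ.symm y = x := ⟨φ x, φ.map_source hx, φ.left_inv hx⟩
  apply PV.transport_dChart_injective hφ hx
  change PV.inChart φ γ y = PV.inChart φ γ' y
  rw [← sub_eq_zero]
  refine eq_zero_of_pairing n p q _ fun a => ?_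
  have hD := volDet_contDiffOn h hφ
  have hcont : ContinuousOn (fun z => volDet h φ z * (pairing n p q a (PV.inChart φ γ z) -
      pairing n p q a (PV.inChart φ γ' z))) φ.target :=
    hD.continuousOn.mul
      ((contDiffOn_pairing (smoothOn_const a _) (hγ φ hφ)).continuousOn.sub
        (contDiffOn_pairing (smoothOn_const a _) (hγ' φ hφ)).continuousOn)
  have hae := φ.open_target.ae_eq_zero_of_integral_contDiff_smul_eq_zero (μ := volume)
    (hcont.locallyIntegrableOn φ.open_target.measurableSet) fun χ hχ hc hs => by
      have hS : IsClosed (φ.symm '' tsupport χ) :=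
        (hc.isCompact.image_of_continuousOn (φ.continuousOn_symm.mono hs)).isClosed
      have hSφ : φ.symm '' tsupport χ ⊆ φ.source := by
        rintro _ ⟨z, hz, rfl⟩
        exact φ.map_target (hs hz)
      have hα := isSmooth_testSection hφ hχ hc hs a
      obtain ⟨e1, i1⟩ := integral_pairFun h hα hγ hφ hS hSφ fun x hx => testSection_eq_zero a hx
      obtain ⟨e2, i2⟩ := integral_pairFun h hα hγ' hφ hS hSφ fun x hx => testSection_eq_zero a hx
      have e3 := heq _ hα
      rw [e1, e2, ← sub_eq_zero, ← integral_sub i1 i2] at e3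
      rw [← setIntegral_eq_integral_of_forall_compl_eq_zero (s := φ.target), ← e3]
      · refine setIntegral_congr_fun φ.open_target.measurableSet fun z hz => ?_
        simp only [inChart_testSection hφ χ a hz, map_smul, LinearMap.smul_apply, smul_eq_mul,
          Complex.real_smul]
        ring
      · intro z hz
        rw [image_eq_zero_of_notMem_tsupport fun h1 => hz (hs h1), zero_smul]
  -- Both functions are continuous, so equality almost everywhere on an open set is equality at
  -- every point, in particular at y.
  have h0 := Measure.eqOn_open_of_ae_eq (f := fun z => volDet h φ z *
      (pairing n p q a (PV.inChart φ γ z) - pairing n p q a (PV.inChart φ γ' z)))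
      (g := fun _ => (0 : ℂ)) (μ := volume)
      ((ae_restrict_iff' φ.open_target.measurableSet).2 hae) φ.open_target hcont continuousOn_const hy
  rw [map_sub]
  refine (mul_eq_zero.1 h0).resolve_left ?_
  rw [volDet_eq h hφ hy]
  exact Complex.ofReal_ne_zero.2 (volDensity_pos h hφ hy).ne'

variable {Ω : ∀ x : X, ⋀[ℂ]^n (Module.Dual ℂ (TX n x))}

/-- The integral identity shows that -f Δγ is an adjoint. Any other adjoint has the same pairing
with every smooth α and therefore agrees with it. -/
theorem isDbarAdjoint_iff (hΩ : IsHolomorphicForm Ω) (hne : ∀ x, Ω x ≠ 0)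
    (hpar : h.IsParallel Ω) {p q : ℕ} {γ : ∀ x : X, PV (p + 1) q (TX n x)} (hγ : PV.IsSmooth γ)
    (η : ∀ x : X, DF p q (TX n x)) :
    h.IsDbarAdjoint (fun x => h.f (p + 1) q x (γ x)) η ↔
      η = fun x => -h.f p q x (Delta Ω γ x) := by
  have hΔ : PV.IsSmooth fun x => -Delta Ω γ x := fun φ hφ =>
    (isSmooth_Delta h hΩ hne hpar hγ φ hφ).neg.congr fun y _ => by
      exact LinearMap.map_neg (M := PV p q (TX n (φ.symm y))) (M₂ := PV p q (Fin n → ℂ))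
        (PV.transport p q _ _) _
  have key : ∀ α : ∀ x : X, DF p q (TX n x), DF.IsSmooth α →
      h.l2 (dbar α) (fun x => h.f (p + 1) q x (γ x)) =
        h.integral (pairFun h α fun x => -Delta Ω γ x) := fun α hα => by
    refine (integral_dbar h hΩ hne hpar hα hγ).trans ?_
    rw [← h.integral_neg]
    congr 1
    funext x
    exact (h.pairing_f_neg _ _).symm
  constructor
  · rintro ⟨hη, hadj⟩
    have := eq_of_integral_pairFun_eq h (isSmooth_f_symm h hη) hΔ fun α hα => by
      rw [← key α hα, hadj α hα]
      refine congrArg h.integral (funext fun x => ?_)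
      exact congrArg (h.dfForm p q x (α x)) ((h.f p q x).apply_symm_apply (η x))
    funext x
    rw [← h.f_neg, ← (congrFun this x)]
    exact ((h.f p q x).apply_symm_apply (η x)).symm
  · rintro rfl
    have e : (fun x => -h.f p q x (Delta Ω γ x)) = fun x => h.f p q x (-Delta Ω γ x) := by
      funext x
      exact (h.f_neg _).symm
    rw [e]
    exact ⟨isSmooth_f h hΔ, key⟩

theorem dbarStar_f (hΩ : IsHolomorphicForm Ω) (hne : ∀ x, Ω x ≠ 0)
    (hpar : h.IsParallel Ω) {p q : ℕ} {γ : ∀ x : X, PV (p + 1) q (TX n x)} (hγ : PV.IsSmooth γ) :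
    h.dbarStar (fun x => h.f (p + 1) q x (γ x)) = fun x => -h.f p q x (Delta Ω γ x) := by
  have hex : ∃ η, h.IsDbarAdjoint (fun x => h.f (p + 1) q x (γ x)) η :=
    ⟨_, (isDbarAdjoint_iff h hΩ hne hpar hγ _).2 rfl⟩
  rw [KahlerMetric.dbarStar, dif_pos hex]
  exact (isDbarAdjoint_iff h hΩ hne hpar hγ _).1 hex.choose_spec

end Uniqueness

end BK

end

theorem lemma3p1 {n : ℕ} {X : Type*} [TopologicalSpace X] [CompactSpace X] [T2Space X]
    [ChartedSpace (Fin n → ℂ) X] [IsManifold 𝓘(ℂ, Fin n → ℂ) ω X]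
    (h : KahlerMetric n X) (Ω : ∀ x : X, ⋀[ℂ]^n (Module.Dual ℂ (TX n x)))
    (hΩ_hol : IsHolomorphicForm Ω) (hΩ_ne : ∀ x, Ω x ≠ 0) (hΩ_par : h.IsParallel Ω) (q : ℕ) :
    (∀ (p : ℕ) (γ : ∀ x : X, PV (p + 1) q (TX n x)), PV.IsSmooth γ →
      PV.IsSmooth (Delta Ω γ) ∧
      (∀ δ : ∀ x : X, PV p q (TX n x), IsDelta Ω γ δ ↔ δ = Delta Ω γ) ∧
      DF.IsSmooth (fun x => h.f (p + 1) q x (γ x)) ∧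
      (∀ η : ∀ x : X, DF p q (TX n x),
        h.IsDbarAdjoint (fun x => h.f (p + 1) q x (γ x)) η ↔
          η = h.dbarStar (fun x => h.f (p + 1) q x (γ x))) ∧
      ∀ x, h.f p q x (Delta Ω γ x) = -h.dbarStar (fun x' => h.f (p + 1) q x' (γ x')) x) ∧
    (∀ γ : ∀ x : X, PV 0 q (TX n x), PV.IsSmooth γ →
      ∀ x, del (fun x' => contractForm 0 q (Ω x') (γ x')) x = 0) := by
  refine ⟨fun p γ hγ => ?_, fun γ hγ x => del_contractForm_zero h hΩ_hol hΩ_par hγ x⟩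
  -- Since ∂̄^*(f γ) = -f Δγ, the characterization of the adjoint and the final identity are both
  -- statements about -f Δγ.
  have hstar := dbarStar_f h hΩ_hol hΩ_ne hΩ_par hγ
  refine ⟨isSmooth_Delta h hΩ_hol hΩ_ne hΩ_par hγ,
    fun δ => isDelta_iff h hΩ_hol hΩ_ne hΩ_par hγ δ, isSmooth_f h hγ, fun η => ?_, fun x => ?_⟩
  · rw [hstar]
    exact isDbarAdjoint_iff h hΩ_hol hΩ_ne hΩ_par hγ η
  · rw [hstar]
    exact (neg_neg (h.f p q x (Delta Ω γ x))).symm
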